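/- Let $\Omega=(0,1)$, $V_1=\{w\in H^1(\Omega): w(0)=0\}$, $V_2=\{w\in H^1(\Omega): w(1)=0\}$, and write $\|\cdot\|$ for the norm of $L^2(\Omega)$. Let $\lambda_i,\mu_i,K_i>0$ and $p_i>2$ $(i=1,2)$, and consider the linearly damped system without external forces $$u_{tt}-u_{xx}+\lambda_1u_t=f_1(u,v),\qquad v_{tt}-v_{xx}+\lambda_2v_t=f_2(u,v)\qquad\text{in }\Omega\times(0,T),$$ with the boundary conditions $$u(0,t)=0,\quad -u_x(1,t)+K_1|u(1,t)|^{p_1-2}u(1,t)=\mu_1u_t(1,t),$$ $$v_x(0,t)+K_2|v(0,t)|^{p_2-2}v(0,t)=\mu_2v_t(0,t),\quad v(1,t)=0,$$ and the initial conditions $(u,u_t)(0)=(\tilde u_0,\tilde u_1)\in V_1\times L^2(\Omega)$, $(v,v_t)(0)=(\tilde v_0,\tilde v_1)\in V_2\times L^2(\Omega)$. For $0<T\le\infty$, a weak solution on $[0,T)$ is a pair $(u,v)\in C^0([0,T);V_1\times V_2)\cap C^1([0,T);L^2\times L^2)$ with $u(1,\cdot),v(0,\cdot)\in H^1(0,\tau)$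 for every finite $\tau<T$, which takes the initial values and satisfies, for all $(\phi,\tilde\phi)\in V_1\times V_2$, in the sense of distributions on $(0,T)$, $$\tfrac{d}{dt}\langle u_t,\phi\rangle+\langle u_x,\phi_x\rangle+\lambda_1\langle u_t,\phi\rangle+\mu_1u_t(1,t)\phi(1)=K_1|u(1,t)|^{p_1-2}u(1,t)\phi(1)+\langle f_1(u,v),\phi\rangle,$$ $$\tfrac{d}{dt}\langle v_t,\tilde\phi\rangle+\langle v_x,\tilde\phi_x\rangle+\lambda_2\langle v_t,\tilde\phi\rangle+\mu_2v_t(0,t)\tilde\phi(0)=K_2|v(0,t)|^{p_2-2}v(0,t)\tilde\phi(0)+\langle f_2(u,v),\tilde\phi\rangle.$$ It is maximal if it does not extend to a weak solution on a strictly longer interval $[0,T')$. Assume that there are a $C^2$ function $\mathcal F:\mathbb R^2\to\mathbb R$ with $\partial_u\mathcal F=f_1$, $\partial_v\mathcal F=f_2$, and constants $\alpha,\beta>2$, $d_1,d_2,\bar d_1,\bar d_2>0$ such that for all $(u,v)\in\mathbb R^2$ $$d_1\mathcal F(u,v)\le uf_1(u,v)+vf_2(u,v)\le d_2\mathcal F(u,v),\qquad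 \bar d_1(|u|^\alpha+|v|^\beta)\le\mathcal F(u,v)\le\bar d_2(|u|^\alpha+|v|^\beta),$$ that $$2\max\{K_1/p_1,\,K_2/p_2,\,\bar d_2\}<\min\{K_1,\,K_2,\,d_1\bar d_1\},$$ and that the initial energy is negative, i.e. $H(0)>0$, where $$-H(0)=\tfrac12\big(\|\tilde u_1\|^2+\|\tilde v_1\|^2+\|\tilde u_{0x}\|^2+\|\tilde v_{0x}\|^2\big)-\Big(\tfrac{K_1}{p_1}|\tilde u_0(1)|^{p_1}+\tfrac{K_2}{p_2}|\tilde v_0(0)|^{p_2}\Big)-\int_0^1\mathcal F(\tilde u_0,\tilde v_0)\,dx.$$ Then every weak solution blows up in finite time: there is a finite $T_*>0$, determined by the equations and the initial data, such that every weak solution on an interval $[0,T)$ has $T\le T_*$ (in particular there is no global weak solution), and if the weak solution is maximal, then $$\|u(t)\|_{H^1}+\|v(t)\|_{H^1}+\|u_t(t)\|+\|v_t(t)\|\to\infty\quad\text{as }t\to T^-.$$ -/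

import Mathlib

open MeasureTheory Set Filter Topology
open scoped ContDiff

noncomputable section

namespace WaveSystem

/-! ## Weak derivatives and the space `H¹(0,1)` -/

/-- `g` is the weak (distributional) derivative of `w` on the open set `U ⊆ ℝ`. -/
structure HasWeakDerivOn (w g : ℝ → ℝ) (U : Set ℝ) : Prop where
  locallyIntegrableOn : LocallyIntegrableOn w U
  locallyIntegrableOn_deriv : LocallyIntegrableOn g U
  integral_eq : ∀ η : ℝ → ℝ, ContDiff ℝ ∞ η → HasCompactSupport η → tsupport η ⊆ U →
    ∫ x in U, w x * deriv η x = -∫ x in U, g x * η x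

/-- A test function on `(0,1)` with zero mean is the derivative of a test function. -/
theorem exists_primitive_test {ζ : ℝ → ℝ} (hζ : ContDiff ℝ ∞ ζ) (hc : HasCompactSupport ζ)
    (hs : tsupport ζ ⊆ Ioo 0 1) (h0 : ∫ x in (0 : ℝ)..1, ζ x = 0) :
    ∃ η : ℝ → ℝ, ContDiff ℝ ∞ η ∧ HasCompactSupport η ∧ tsupport η ⊆ Ioo 0 1 ∧ deriv η = ζ := by
  have hcont : Continuous ζ := hζ.continuous
  have hd : ∀ x, HasDerivAt (fun y => ∫ t in (0 : ℝ)..y, ζ t) (ζ x) x := fun x =>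
    intervalIntegral.integral_hasDerivAt_right (hcont.intervalIntegrable _ _)
      (hcont.stronglyMeasurableAtFilter _ _) hcont.continuousAt
  have hderiv : deriv (fun y => ∫ t in (0 : ℝ)..y, ζ t) = ζ := funext fun x => (hd x).deriv
  obtain ⟨a, b, ha, hb, hab⟩ : ∃ a b : ℝ, 0 < a ∧ b < 1 ∧ tsupport ζ ⊆ Icc a b := by
    rcases (tsupport ζ).eq_empty_or_nonempty with he | hne
    · exact ⟨1, 0, one_pos, one_pos, by simp [he]⟩
    · have hk : IsCompact (tsupport ζ) := hc
      refine ⟨sInf (tsupport ζ), sSup (tsupport ζ), (hs (hk.sInf_mem hne)).1,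
        (hs (hk.sSup_mem hne)).2, fun x hx => ⟨csInf_le hk.bddBelow hx, le_csSup hk.bddAbove hx⟩⟩
  have hz : ∀ x, x ∉ Icc a b → ζ x = 0 := fun x hx => image_eq_zero_of_notMem_tsupport fun h => hx (hab h)
  have hsup : tsupport (fun y => ∫ t in (0 : ℝ)..y, ζ t) ⊆ Icc a b := by
    refine closure_minimal (fun x hx => ?_) isClosed_Icc
    by_contra hx'
    apply hx
    rcases not_and_or.1 hx' with h | h
    · show ∫ t in (0 : ℝ)..x, ζ t = 0
      rw [intervalIntegral.integral_congr (g := fun _ => (0 : ℝ)), intervalIntegral.integral_zero]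
      intro t ht
      apply hz
      rintro ⟨h1, -⟩
      rcases le_total 0 x with hx0 | hx0
      · rw [uIcc_of_le hx0] at ht; linarith [ht.2]
      · rw [uIcc_of_ge hx0] at ht; linarith [ht.2]
    · show ∫ t in (0 : ℝ)..x, ζ t = 0
      rw [← intervalIntegral.integral_add_adjacent_intervals (hcont.intervalIntegrable 0 1)
        (hcont.intervalIntegrable 1 x), h0, zero_add,
        intervalIntegral.integral_congr (g := fun _ => (0 : ℝ)), intervalIntegral.integral_zero]
      intro t ht
      apply hz
      rintro ⟨-, h1⟩
      rcases le_total 1 x with hx0 | hx0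
      · rw [uIcc_of_le hx0] at ht; linarith [ht.1]
      · rw [uIcc_of_ge hx0] at ht; linarith [ht.1]
  refine ⟨fun y => ∫ t in (0 : ℝ)..y, ζ t, ?_, isCompact_Icc.of_isClosed_subset (isClosed_tsupport _) hsup, ?_, hderiv⟩
  · rw [contDiff_infty_iff_deriv, hderiv]
    exact ⟨fun x => (hd x).differentiableAt, hζ⟩
  · exact hsup.trans fun x hx => ⟨ha.trans_le hx.1, hx.2.trans_lt hb⟩

/-- The lemma of du Bois-Reymond on `(0,1)`. -/
theorem ae_const_of_integral_deriv_zero {h : ℝ → ℝ} (hi : IntegrableOn h (Ioo 0 1))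
    (hh : ∀ η : ℝ → ℝ, ContDiff ℝ ∞ η → HasCompactSupport η → tsupport η ⊆ Ioo 0 1 →
      ∫ x in Ioo (0 : ℝ) 1, h x * deriv η x = 0) :
    ∃ c : ℝ, ∀ᵐ x ∂(volume.restrict (Ioo (0 : ℝ) 1)), h x = c := by
  have eqI : ∀ k : ℝ → ℝ, ∫ x in (0 : ℝ)..1, k x = ∫ x in Ioo (0 : ℝ) 1, k x := fun k => by
    rw [intervalIntegral.integral_of_le zero_le_one, integral_Ioc_eq_integral_Ioo]
  let B : ContDiffBump (1 / 2 : ℝ) := ⟨1 / 8, 1 / 4, by norm_num, by norm_num⟩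
  have hBs : tsupport B ⊆ Ioo 0 1 := by
    rw [B.tsupport_eq, Real.closedBall_eq_Icc]
    intro x hx
    simp only [B] at hx
    constructor <;> norm_num at hx <;> linarith [hx.1, hx.2]
  have hBfull : ∫ x in Ioo (0 : ℝ) 1, B x = ∫ x, B x :=
    setIntegral_eq_integral_of_forall_compl_eq_zero fun x hx =>
      image_eq_zero_of_notMem_tsupport fun h' => hx (hBs h')
  have hBpos : 0 < ∫ x in Ioo (0 : ℝ) 1, B x := hBfull ▸ B.integral_pos
  set m := ∫ x in Ioo (0 : ℝ) 1, B x with hm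
  have hBd : ContDiff ℝ ∞ (B : ℝ → ℝ) := B.contDiff
  have mulint : ∀ k : ℝ → ℝ, Continuous k → HasCompactSupport k →
      IntegrableOn (fun x => h x * k x) (Ioo 0 1) := fun k hk hkc => by
    obtain ⟨C, hC⟩ := hkc.exists_bound_of_continuous hk
    exact hi.mul_bdd hk.aestronglyMeasurable (Eventually.of_forall hC)
  set c := (∫ x in Ioo (0 : ℝ) 1, h x * B x) / m with hcdef
  refine ⟨c, ?_⟩
  have key := isOpen_Ioo.ae_eq_zero_of_integral_contDiff_smul_eq_zero (μ := volume)
    (U := Ioo (0 : ℝ) 1) (f := fun x => h x - c)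
    ((hi.sub (integrableOn_const (by simp))).locallyIntegrableOn) ?_
  · rw [ae_restrict_iff' measurableSet_Ioo]
    filter_upwards [key] with x hx hxU
    exact sub_eq_zero.1 (hx hxU)
  intro ζ hζ hζc hζs
  set I := ∫ x in Ioo (0 : ℝ) 1, ζ x with hI
  have hζI : IntegrableOn ζ (Ioo 0 1) := (hζ.continuous.integrable_of_hasCompactSupport hζc).integrableOn
  have hBI : IntegrableOn B (Ioo 0 1) := (hBd.continuous.integrable_of_hasCompactSupport B.hasCompactSupport).integrableOn
  obtain ⟨η, h1, h2, h3, h4⟩ := exists_primitive_test (ζ := fun x => ζ x - I / m * B x)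
    (hζ.sub (contDiff_const.mul hBd)) (hζc.sub B.hasCompactSupport.mul_left)
    ((tsupport_sub _ _).trans (union_subset hζs (((closure_mono (Function.support_mul_subset_right _ _))).trans hBs))) (by
      rw [eqI, integral_sub hζI (hBI.const_mul _), integral_const_mul, ← hm, ← hI]
      field_simp; ring)
  have h5 := hh η h1 h2 h3
  rw [h4] at h5
  have h6 : ∫ x in Ioo (0 : ℝ) 1, h x * (ζ x - I / m * B x)
      = (∫ x in Ioo (0 : ℝ) 1, h x * ζ x) - I / m * ∫ x in Ioo (0 : ℝ) 1, h x * B x := by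
    rw [← integral_const_mul, ← integral_sub (mulint _ hζ.continuous hζc)
      ((mulint _ hBd.continuous B.hasCompactSupport).const_mul _)]
    congr 1; ext x; ring
  rw [h6] at h5
  rw [← setIntegral_eq_integral_of_forall_compl_eq_zero (s := Ioo (0 : ℝ) 1)]
  · simp only [smul_eq_mul]
    have : ∀ x, ζ x * (h x - c) = h x * ζ x - c * ζ x := fun x => by ring
    simp_rw [this]
    rw [integral_sub (mulint _ hζ.continuous hζc) (hζI.const_mul _), integral_const_mul, ← hI, hcdef]
    refine Eq.trans ?_ h5
    ring
  · intro x hx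
    rw [image_eq_zero_of_notMem_tsupport fun h' => hx (hζs h')]; simp

/-- An integrable function on `(0,1)` with an integrable weak derivative has a representative that is
continuous on `[0,1]`. -/
theorem HasWeakDerivOn.exists_continuousOn {w g : ℝ → ℝ} (hw : HasWeakDerivOn w g (Ioo 0 1))
    (hwi : IntegrableOn w (Ioo 0 1)) (hgi : IntegrableOn g (Ioo 0 1)) :
    ∃ c : ℝ → ℝ, ContinuousOn c (Icc 0 1) ∧ w =ᵐ[volume.restrict (Ioo 0 1)] c := by
  have eqI : ∀ k : ℝ → ℝ, ∫ x in (0 : ℝ)..1, k x = ∫ x in Ioo (0 : ℝ) 1, k x := fun k => by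
    rw [intervalIntegral.integral_of_le zero_le_one, integral_Ioc_eq_integral_Ioo]
  have hgI : IntervalIntegrable g volume 0 1 :=
    (intervalIntegrable_iff_integrableOn_Ioo_of_le zero_le_one).2 hgi
  set G : ℝ → ℝ := fun x => ∫ t in (0 : ℝ)..x, g t
  have hG : AbsolutelyContinuousOnInterval G 0 1 :=
    hgI.absolutelyContinuousOnInterval_intervalIntegral (by simp)
  have hGc : ContinuousOn G (Icc 0 1) := by simpa using hG.continuousOn
  have hGi : IntegrableOn G (Ioo 0 1) := (hGc.integrableOn_Icc).mono_set Ioo_subset_Icc_self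
  have hGd : ∀ᵐ x, x ∈ uIcc (0 : ℝ) 1 → HasDerivAt G (g x) x := by
    filter_upwards [hgI.ae_hasDerivAt_integral] with x hx h
    exact hx h 0 (by simp)
  obtain ⟨c, hc⟩ := ae_const_of_integral_deriv_zero (h := fun x => w x - G x) (hwi.sub hGi) (by
    intro η h1 h2 h3
    have h1' : ContDiff ℝ ∞ (deriv η) := (contDiff_infty_iff_deriv.1 h1).2
    obtain ⟨C, hC⟩ := h2.deriv.exists_bound_of_continuous h1'.continuous
    have e0 : η 0 = 0 := image_eq_zero_of_notMem_tsupport fun h => by simpa using h3 h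
    have e1 : η 1 = 0 := image_eq_zero_of_notMem_tsupport fun h => by simpa using h3 h
    have hη : AbsolutelyContinuousOnInterval η 0 1 :=
      (h1.of_le (by norm_num : (1 : WithTop ℕ∞) ≤ ∞)).contDiffOn.absolutelyContinuousOnInterval
    have parts := hG.integral_mul_deriv_eq_deriv_mul hη
    have e2 : ∫ x in (0 : ℝ)..1, deriv G x * η x = ∫ x in (0 : ℝ)..1, g x * η x := by
      apply intervalIntegral.integral_congr_ae
      filter_upwards [hGd] with x hx h
      rw [(hx (uIoc_subset_uIcc h)).deriv]
    rw [e0, e1, e2, eqI, eqI] at parts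
    have e3 := hw.integral_eq η h1 h2 h3
    have : ∀ x, (w x - G x) * deriv η x = w x * deriv η x - G x * deriv η x := fun x => by ring
    simp_rw [this]
    rw [integral_sub (hwi.mul_bdd h1'.continuous.aestronglyMeasurable (Eventually.of_forall hC))
      (hGi.mul_bdd h1'.continuous.aestronglyMeasurable (Eventually.of_forall hC)), e3, parts]
    ring)
  refine ⟨fun x => G x + c, hGc.add continuousOn_const, ?_⟩
  filter_upwards [hc] with x hx
  linarith

/-- `w ∈ H¹(U)` with weak derivative `g`: both are in `L²(U)`. -/
structure MemH1On (w g : ℝ → ℝ) (U : Set ℝ) : Prop where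
  memLp : MemLp w 2 (volume.restrict U)
  memLp_deriv : MemLp g 2 (volume.restrict U)
  hasWeakDerivOn : HasWeakDerivOn w g U

/-- `L² = L²(Ω)` with `Ω = (0,1)`. -/
abbrev L2 : Type := Lp ℝ 2 (volume.restrict (Ioo (0 : ℝ) 1))

theorem L2.integrableOn (w : L2) : IntegrableOn w (Ioo (0 : ℝ) 1) :=
  (Lp.memLp w).integrable one_le_two

theorem L2.integrableOn_mul (w : L2) {η : ℝ → ℝ} (hη : Continuous η) (hc : HasCompactSupport η) :
    IntegrableOn (fun x => w x * η x) (Ioo (0 : ℝ) 1) := by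
  obtain ⟨C, hC⟩ := hc.exists_bound_of_continuous hη
  exact (L2.integrableOn w).mul_bdd hη.aestronglyMeasurable (Eventually.of_forall hC)

/-- `H¹(Ω)`: the pairs `(w, w_x)` in `L² × L²` such that `w_x` is the weak derivative of `w`.
As a subspace of the Hilbert sum it carries the norm `(‖w‖² + ‖w_x‖²)^(1/2)`. -/
def H1Submodule : Submodule ℝ (WithLp 2 (L2 × L2)) where
  carrier := {w | HasWeakDerivOn w.fst w.snd (Ioo 0 1)}
  zero_mem' := by
    refine ⟨(L2.integrableOn _).locallyIntegrableOn, (L2.integrableOn _).locallyIntegrableOn, ?_⟩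
    intro η h1 h2 h3
    have e : ((0 : L2) : ℝ → ℝ) =ᵐ[volume.restrict (Ioo (0 : ℝ) 1)] 0 := Lp.coeFn_zero _ _ _
    have i1 : ∀ k : ℝ → ℝ, ∫ x in Ioo (0 : ℝ) 1, (0 : L2) x * k x = 0 := fun k => by
      apply integral_eq_zero_of_ae
      filter_upwards [e] with x hx
      show (0 : L2) x * k x = 0
      rw [hx, Pi.zero_apply, zero_mul]
    simp only [WithLp.zero_fst, WithLp.zero_snd, i1, neg_zero]
  add_mem' := by
    intro w z hw hz
    refine ⟨(L2.integrableOn _).locallyIntegrableOn, (L2.integrableOn _).locallyIntegrableOn, ?_⟩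
    intro η h1 h2 h3
    have h1' : ContDiff ℝ ∞ (deriv η) := (contDiff_infty_iff_deriv.1 h1).2
    have i1 : ∀ (a b : L2) (k : ℝ → ℝ), Continuous k → HasCompactSupport k →
        ∫ x in Ioo (0 : ℝ) 1, (a + b : L2) x * k x
          = (∫ x in Ioo (0 : ℝ) 1, a x * k x) + ∫ x in Ioo (0 : ℝ) 1, b x * k x := by
      intro a b k hk hkc
      rw [← integral_add (L2.integrableOn_mul a hk hkc) (L2.integrableOn_mul b hk hkc)]
      apply integral_congr_ae
      filter_upwards [Lp.coeFn_add a b] with x hx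
      rw [hx, Pi.add_apply, add_mul]
    rw [WithLp.add_fst, WithLp.add_snd, i1 _ _ _ h1'.continuous h2.deriv, i1 _ _ _ h1.continuous h2,
      hw.integral_eq η h1 h2 h3, hz.integral_eq η h1 h2 h3]
    ring
  smul_mem' := by
    intro r w hw
    refine ⟨(L2.integrableOn _).locallyIntegrableOn, (L2.integrableOn _).locallyIntegrableOn, ?_⟩
    intro η h1 h2 h3
    have i1 : ∀ (a : L2) (k : ℝ → ℝ), ∫ x in Ioo (0 : ℝ) 1, (r • a : L2) x * k x
          = r * ∫ x in Ioo (0 : ℝ) 1, a x * k x := by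
      intro a k
      rw [← integral_const_mul]
      apply integral_congr_ae
      filter_upwards [Lp.coeFn_smul r a] with x hx
      rw [hx, Pi.smul_apply, smul_eq_mul, mul_assoc]
    rw [WithLp.smul_fst, WithLp.smul_snd, i1, i1, hw.integral_eq η h1 h2 h3]
    ring

/-- The Hilbert space `H¹(Ω)`. -/
abbrev H1 : Type := H1Submodule

/-- An element of `H¹` as an element of `L²`. -/
def H1.toL2 (w : H1) : L2 := (w : WithLp 2 (L2 × L2)).fst

/-- The weak derivative `w_x ∈ L²` of `w ∈ H¹`. -/
def H1.dx (w : H1) : L2 := (w : WithLp 2 (L2 × L2)).snd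

theorem H1.exists_rep (w : H1) :
    ∃ c : ℝ → ℝ, ContinuousOn c (Icc 0 1) ∧ w.toL2 =ᵐ[volume.restrict (Ioo (0 : ℝ) 1)] c :=
  HasWeakDerivOn.exists_continuousOn (g := w.dx) w.2 (L2.integrableOn _) (L2.integrableOn _)

/-- The continuous representative of `w ∈ H¹` on `[0,1]` (unique there; only its values at points of
`[0,1]` are ever used). It gives the point values `w(x)`, in particular `w(0)` and `w(1)`. -/
def H1.rep (w : H1) : ℝ → ℝ := Classical.choose w.exists_rep

theorem H1.continuousOn_rep (w : H1) : ContinuousOn w.rep (Icc 0 1) :=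
  (Classical.choose_spec w.exists_rep).1

theorem H1.toL2_ae_eq_rep (w : H1) : w.toL2 =ᵐ[volume.restrict (Ioo (0 : ℝ) 1)] w.rep :=
  (Classical.choose_spec w.exists_rep).2

/-- `{w ∈ H¹ : w(a) = 0}` for an end point `a` of `(0,1)`; thus `𝕍₁ = V 0` and `𝕍₂ = V 1`. -/
def V (a : ℝ) : Set H1 := {w | w.rep a = 0}

/-! ## The system -/

/-- `Ψ_p(z) = |z|^(p-2) z`. -/
def Psi (p z : ℝ) : ℝ := |z| ^ (p - 2) * z

/-- The real times `t` with `0 ≤ t < T`, where `T` may be `∞`. -/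
def timeIco (T : EReal) : Set ℝ := {t | 0 ≤ t ∧ (t : EReal) < T}

/-- The real times `t` with `0 < t < T`, where `T` may be `∞`. -/
def timeIoo (T : EReal) : Set ℝ := {t | 0 < t ∧ (t : EReal) < T}

/-- Weak solution on `[0,T)` of one wave equation `w_tt - w_xx + lam w_t = S(t,x)` on `(0,1)`, with
`w = 0` at the end point `a`, and at the end point `c` the condition
`∂w/∂n + mu w_t = K |w|^(p-2) w` (`n` the outer normal). Here
`w ∈ C⁰([0,T); H¹) ∩ C¹([0,T); L²)` with time derivative `w'`, the trace `w(c,·)` is in `H¹(0,τ)` for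
all finite `τ < T`, with derivative `b`, and for every `φ ∈ H¹` with `φ(a) = 0`
`d/dt ⟨w_t, φ⟩ + ⟨w_x, φ_x⟩ + lam ⟨w_t, φ⟩ + mu w_t(c,t) φ(c) = K Ψ_p(w(c,t)) φ(c) + ⟨S(t), φ⟩`
as distributions on `(0,T)`. -/
structure IsWeakComponent (lam mu K p a c : ℝ) (S : ℝ → ℝ → ℝ) (T : EReal)
    (w : ℝ → H1) (w' : ℝ → L2) : Prop where
  dirichlet : ∀ t ∈ timeIco T, w t ∈ V a
  continuousOn : ContinuousOn w (timeIco T)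
  hasDerivWithinAt : ∀ t ∈ timeIco T,
    HasDerivWithinAt (fun s => (w s).toL2) (w' t) (timeIco T) t
  continuousOn_deriv : ContinuousOn w' (timeIco T)
  weak_form : ∃ b : ℝ → ℝ,
    (∀ τ : ℝ, 0 < τ → (τ : EReal) < T → MemH1On (fun t => (w t).rep c) b (Ioo 0 τ)) ∧
    ∀ φ ∈ V a, HasWeakDerivOn (fun t => inner ℝ (w' t) φ.toL2)
      (fun t => K * Psi p ((w t).rep c) * φ.rep c + (∫ x in Ioo (0 : ℝ) 1, S t x * φ.rep x)
        - inner ℝ (w t).dx φ.dx - lam * inner ℝ (w' t) φ.toL2 - mu * b t * φ.rep c) (timeIoo T)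

/-- The constants of the system. -/
structure Params where
  (lam₁ lam₂ mu₁ mu₂ K₁ K₂ p₁ p₂ : ℝ)

/-- `(u, v)`, with time derivatives `(u', v')`, is a weak solution on `[0,T)`, `T ≤ ∞`, of
`u_tt - u_xx + λ₁ u_t = f₁(u,v)`, `v_tt - v_xx + λ₂ v_t = f₂(u,v)` on `(0,1)`,
`u(0,t) = 0`, `-u_x(1,t) + K₁ |u(1,t)|^(p₁-2) u(1,t) = μ₁ u_t(1,t)`,
`v(1,t) = 0`, `v_x(0,t) + K₂ |v(0,t)|^(p₂-2) v(0,t) = μ₂ v_t(0,t)`,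
with initial values `(u₀, u₁)`, `(v₀, v₁)`. -/
structure IsWeakSolution (P : Params) (f₁ f₂ : ℝ → ℝ → ℝ) (u₀ v₀ : H1) (u₁ v₁ : L2) (T : EReal)
    (u v : ℝ → H1) (u' v' : ℝ → L2) : Prop where
  fst : IsWeakComponent P.lam₁ P.mu₁ P.K₁ P.p₁ 0 1
    (fun t x => f₁ ((u t).rep x) ((v t).rep x)) T u u'
  snd : IsWeakComponent P.lam₂ P.mu₂ P.K₂ P.p₂ 1 0
    (fun t x => f₂ ((u t).rep x) ((v t).rep x)) T v v'
  init_u : u 0 = u₀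
  init_u' : u' 0 = u₁
  init_v : v 0 = v₀
  init_v' : v' 0 = v₁

/-- A weak solution on `[0,T)` is maximal if no weak solution on an interval `[0,T')` with `T < T'`
agrees with it on `[0,T)`. -/
def IsMaximalWeakSolution (P : Params) (f₁ f₂ : ℝ → ℝ → ℝ) (u₀ v₀ : H1) (u₁ v₁ : L2) (T : EReal)
    (u v : ℝ → H1) (u' v' : ℝ → L2) : Prop :=
  IsWeakSolution P f₁ f₂ u₀ v₀ u₁ v₁ T u v u' v' ∧
    ∀ (T' : EReal) (y z : ℝ → H1) (y' z' : ℝ → L2), T < T' →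
      IsWeakSolution P f₁ f₂ u₀ v₀ u₁ v₁ T' y z y' z' →
      ¬ ∀ t ∈ timeIco T, y t = u t ∧ z t = v t

/-- The hypotheses on the interior sources: `(f₁, f₂)` is the gradient of the `C²` function `F`,
with two-sided bounds on `F` and on `a f₁(a,b) + b f₂(a,b)`. -/
structure SourceCondition (f₁ f₂ F : ℝ → ℝ → ℝ) (α β d₁ d₂ e₁ e₂ : ℝ) : Prop where
  contDiff : ContDiff ℝ 2 (fun z : ℝ × ℝ => F z.1 z.2)
  hasDerivAt_fst : ∀ a b : ℝ, HasDerivAt (fun s => F s b) (f₁ a b) a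
  hasDerivAt_snd : ∀ a b : ℝ, HasDerivAt (fun s => F a s) (f₂ a b) b
  two_lt_α : 2 < α
  two_lt_β : 2 < β
  d₁_pos : 0 < d₁
  d₂_pos : 0 < d₂
  e₁_pos : 0 < e₁
  e₂_pos : 0 < e₂
  lower : ∀ a b : ℝ, d₁ * F a b ≤ a * f₁ a b + b * f₂ a b
  upper : ∀ a b : ℝ, a * f₁ a b + b * f₂ a b ≤ d₂ * F a b
  lower_pow : ∀ a b : ℝ, e₁ * (|a| ^ α + |b| ^ β) ≤ F a b
  upper_pow : ∀ a b : ℝ, F a b ≤ e₂ * (|a| ^ α + |b| ^ β)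

/-- The total energy `E` of a state `(u, v, u_t, v_t)`; `H = -E`. -/
def energy (P : Params) (F : ℝ → ℝ → ℝ) (u v : H1) (u' v' : L2) : ℝ :=
  1 / 2 * (‖u'‖ ^ 2 + ‖v'‖ ^ 2 + ‖u.dx‖ ^ 2 + ‖v.dx‖ ^ 2)
    - (P.K₁ / P.p₁ * |u.rep 1| ^ P.p₁ + P.K₂ / P.p₂ * |v.rep 0| ^ P.p₂)
    - ∫ x in Ioo (0 : ℝ) 1, F (u.rep x) (v.rep x)

end WaveSystem

end

/-! Bound on the existence time. Let `Y = ⟨u,u_t⟩ + ⟨v,v_t⟩ + λ₁/2 ‖u‖² + λ₂/2 ‖v‖² + μ₁/2 u(1)² +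
μ₂/2 v(0)²` (`virial`). The quadratic terms cancel the interior and boundary damping exactly, so
that `Y'` is `‖u_t‖² + ‖v_t‖² - ‖u_x‖² - ‖v_x‖²` plus `K₁|u(1)|^p₁ + K₂|v(0)|^p₂ + ∫ (u f₁ + v f₂)`.
The energy does not increase and hence stays below `-H(0)`; this trades `-‖u_x‖² - ‖v_x‖²` for
kinetic energy, `2H(0)` and minus twice the source potentials. The strict inequality between the
constants says that what remains of the sources is positive, so `Y' ≥ c X`, where `X - 1` is the sum
of `‖u_t‖² + ‖v_t‖²` and the source powers (`le_virialRate`). In the other direction `Y ≤ A X^(1/2 +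
1/q)` with `q = min(p₁, p₂, α, β) > 2` (`virial_le`). The exponent is below 1, so `Y' ≥ const · Y^r`
with `r > 1` as soon as `Y ≥ 1`, and `Y ≥ Y(0) + ct` brings `Y` there. `le_of_superlinear_growth`
turns this into a time bound that depends only on the constants and the initial state.

Blow-up of the norm. A solution that stays below some bound `R` along times accumulating at a finite
`T` can be restarted at such a time, for a duration that depends only on `R`
(`exists_coupledWave_source`). Restarting close enough to `T` passes `T`; by uniqueness the result
is an extension, which contradicts maximality.

Framework. An element of `V 0` is the Volterra primitive of its derivative, so the unknowns are `g =
u_x` and `k = u_t` in `L²`, and the trace at 1 is the inner product with the constant function 1.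
The reflection `x ↦ 1 - x` gives `v` the same form. In the time-integrated equation `DampedWave`
only `g`, `k` and integrals of the sources occur, and the passage is made in both directions
(`IsWeakSolution.isCoupled`, `IsCoupled.isWeakSolution`). Since `u_t` is not an admissible test
function, the energy identity is proved for forward time averages, whose time derivatives are
difference quotients, and then the window shrinks to zero. The right derivatives of `Y` and of the
potential come from expansions around a fixed time, where test functions independent of time
suffice.

Existence. D'Alembert's formula solves the homogeneous linear problem. Constant sources reduce to it
by a stationary solution, continuous sources are uniform limits of piecewise constant ones,
Lipschitz sources follow by contraction, and the actual sources by truncation at a level that the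
solution does not reach. Stability (`DampedWave.stability`) drives every limit, the contraction and
uniqueness. -/

section Averages

/-! ### Forward time averages of square integrable functions -/

variable {E : Type*} [NormedAddCommGroup E]

/-- Cauchy–Schwarz against the constant 1, read off from the nonnegativity of the quadratic
polynomial `l ↦ ∫ (‖f‖ - l)²`. -/
theorem norm_intervalIntegral_sq_le [NormedSpace ℝ E] {f : ℝ → E} {a b : ℝ} (hab : a ≤ b)
    (hf : IntervalIntegrable f volume a b)
    (hf2 : IntervalIntegrable (fun t => ‖f t‖ ^ 2) volume a b) :
    ‖∫ t in a..b, f t‖ ^ 2 ≤ (b - a) * ∫ t in a..b, ‖f t‖ ^ 2 := by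
  rcases hab.eq_or_lt with rfl | hlt
  · simp
  have h1 : ‖∫ t in a..b, f t‖ ≤ ∫ t in a..b, ‖f t‖ := intervalIntegral.norm_integral_le_integral_norm hab
  set c := ∫ t in a..b, ‖f t‖ with hc
  have h2 : ∀ l : ℝ, 0 ≤ (∫ t in a..b, ‖f t‖ ^ 2) - 2 * l * c + l ^ 2 * (b - a) := by
    intro l
    have h3 : 0 ≤ ∫ t in a..b, (‖f t‖ - l) ^ 2 :=
      intervalIntegral.integral_nonneg hab fun t _ => sq_nonneg _
    have h4 : ∫ t in a..b, (‖f t‖ - l) ^ 2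
        = (∫ t in a..b, ‖f t‖ ^ 2) - 2 * l * c + l ^ 2 * (b - a) := by
      have : ∀ t, (‖f t‖ - l) ^ 2 = ‖f t‖ ^ 2 - 2 * l * ‖f t‖ + l ^ 2 := fun t => by ring
      simp_rw [this]
      rw [intervalIntegral.integral_add (hf2.sub (hf.norm.const_mul _)) (by simp),
        intervalIntegral.integral_sub hf2 (hf.norm.const_mul _), intervalIntegral.integral_const_mul]
      simp [hc, mul_comm]
    linarith
  have hpos : 0 < b - a := sub_pos.2 hlt
  -- The minimiser of the polynomial: the mean of `‖f‖`.
  have h5 := h2 (c / (b - a))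
  have h6 : (∫ t in a..b, ‖f t‖ ^ 2) - 2 * (c / (b - a)) * c + (c / (b - a)) ^ 2 * (b - a)
      = ((b - a) * (∫ t in a..b, ‖f t‖ ^ 2) - c ^ 2) / (b - a) := by
    field_simp; ring
  rw [h6, le_div_iff₀ hpos] at h5
  have h7 : ‖∫ t in a..b, f t‖ ^ 2 ≤ c ^ 2 := by gcongr
  linarith

theorem intervalIntegrable_of_memLp_Ioc {f : ℝ → E} {τ : ℝ}
    (hf : MemLp f 2 (volume.restrict (Ioc 0 τ))) {a b : ℝ} (ha : a ∈ Icc 0 τ) (hb : b ∈ Icc 0 τ) :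
    IntervalIntegrable f volume a b := by
  have h : IntegrableOn f (Ioc 0 τ) := hf.integrable one_le_two
  rw [intervalIntegrable_iff]
  exact h.mono_set fun x hx => ⟨(le_min ha.1 hb.1).trans_lt hx.1, hx.2.trans (max_le ha.2 hb.2)⟩

theorem intervalIntegrable_sq_of_memLp_Ioc {f : ℝ → E} {τ : ℝ}
    (hf : MemLp f 2 (volume.restrict (Ioc 0 τ))) {a b : ℝ} (ha : a ∈ Icc 0 τ) (hb : b ∈ Icc 0 τ) :
    IntervalIntegrable (fun t => ‖f t‖ ^ 2) volume a b := by
  have h : IntegrableOn (fun t => ‖f t‖ ^ 2) (Ioc 0 τ) := by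
    exact hf.integrable_norm_pow (p := 2) (by norm_num)
  rw [intervalIntegrable_iff]
  exact h.mono_set fun x hx => ⟨(le_min ha.1 hb.1).trans_lt hx.1, hx.2.trans (max_le ha.2 hb.2)⟩

theorem continuousOn_primitive_of_memLp_Ioc [NormedSpace ℝ E] {f : ℝ → E} {τ : ℝ}
    (hf : IntegrableOn f (Ioc 0 τ)) :
    ContinuousOn (fun t => ∫ s in (0 : ℝ)..t, f s) (Icc 0 τ) := by
  rcases le_or_gt 0 τ with h | h
  · have := intervalIntegral.continuousOn_primitive_interval (μ := volume) (f := f) (a := 0) (b := τ)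
      (by rw [uIcc_of_le h, integrableOn_Icc_iff_integrableOn_Ioc]; exact hf)
    rwa [uIcc_of_le h] at this
  · simp [Icc_eq_empty_of_lt h]

theorem intervalIntegrable_of_integrableOn_Ioc {f : ℝ → E} {τ : ℝ}
    (h : IntegrableOn f (Ioc 0 τ)) {a b : ℝ} (ha : a ∈ Icc 0 τ) (hb : b ∈ Icc 0 τ) :
    IntervalIntegrable f volume a b := by
  rw [intervalIntegrable_iff]
  exact h.mono_set fun x hx => ⟨(le_min ha.1 hb.1).trans_lt hx.1, hx.2.trans (max_le ha.2 hb.2)⟩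

theorem continuousOn_forward_integral [NormedSpace ℝ E] {f : ℝ → E} {τ τ' η : ℝ}
    (hf : IntegrableOn f (Ioc 0 τ)) (hη : 0 ≤ η) (hτ : τ' + η ≤ τ) :
    ContinuousOn (fun t => ∫ s in t..t + η, f s) (Icc 0 τ') := by
  have hc := continuousOn_primitive_of_memLp_Ioc hf
  have h3 : ContinuousOn (fun t => (∫ s in (0 : ℝ)..t + η, f s) - ∫ s in (0 : ℝ)..t, f s) (Icc 0 τ') := by
    refine ContinuousOn.sub ?_ (hc.mono (Icc_subset_Icc_right (by linarith)))
    exact hc.comp (by fun_prop) fun t ht => ⟨by linarith [ht.1], by linarith [ht.2]⟩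
  refine h3.congr fun t ht => ?_
  have m0 : (0 : ℝ) ∈ Icc 0 τ := ⟨le_rfl, by linarith [ht.1, ht.2]⟩
  exact (intervalIntegral.integral_interval_sub_left
    (intervalIntegrable_of_integrableOn_Ioc hf m0 ⟨by linarith [ht.1], by linarith [ht.2]⟩)
    (intervalIntegrable_of_integrableOn_Ioc hf m0 ⟨ht.1, by linarith [ht.2]⟩)).symm

/-- With the primitive `W` of `w` the inner integral is `W(t + η) - W(t)`, so after a shift the
double integral is the integral of `W` over `[τ', τ' + η]` minus that over `[0, η]`. The second is
nonnegative, and `W` is monotone in the first. -/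
theorem integral_integral_forward_le {w : ℝ → ℝ} {τ τ' η : ℝ} (hw : IntegrableOn w (Ioc 0 τ))
    (hw0 : ∀ t, 0 ≤ w t) (h0 : 0 ≤ τ') (hη : 0 < η) (hτ : τ' + η ≤ τ) :
    ∫ t in (0 : ℝ)..τ', ∫ s in t..t + η, w s ≤ η * ∫ s in (0 : ℝ)..τ' + η, w s := by
  set W : ℝ → ℝ := fun t => ∫ s in (0 : ℝ)..t, w s with hW
  have hint : ∀ {a b : ℝ}, a ∈ Icc 0 τ → b ∈ Icc 0 τ → IntervalIntegrable w volume a b := by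
    intro a b ha hb
    rw [intervalIntegrable_iff]
    exact hw.mono_set fun x hx => ⟨(le_min ha.1 hb.1).trans_lt hx.1, hx.2.trans (max_le ha.2 hb.2)⟩
  have hWc : ContinuousOn W (Icc 0 τ) := continuousOn_primitive_of_memLp_Ioc hw
  have hWi : ∀ {a b : ℝ}, a ∈ Icc 0 τ → b ∈ Icc 0 τ → IntervalIntegrable W volume a b := by
    intro a b ha hb
    refine (hWc.mono ?_).intervalIntegrable
    exact uIcc_subset_Icc ha hb
  have e0 : (0 : ℝ) ∈ Icc 0 τ := ⟨le_rfl, by linarith⟩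
  have e1 : ∀ t ∈ Icc 0 τ', ∫ s in t..t + η, w s = W (t + η) - W t := by
    intro t ht
    rw [hW]
    simp only
    rw [intervalIntegral.integral_interval_sub_left (hint e0 ⟨by linarith [ht.1], by linarith [ht.2]⟩)
      (hint e0 ⟨ht.1, by linarith [ht.2]⟩)]
  have m1 : τ' ∈ Icc 0 τ := ⟨h0, by linarith⟩
  have m2 : τ' + η ∈ Icc 0 τ := ⟨by linarith, by linarith⟩
  have m3 : η ∈ Icc 0 τ := ⟨by linarith, by linarith⟩
  have e2 : ∫ t in (0 : ℝ)..τ', ∫ s in t..t + η, w s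
      = (∫ t in τ'..τ' + η, W t) - ∫ t in (0 : ℝ)..η, W t := by
    rw [intervalIntegral.integral_congr (g := fun t => W (t + η) - W t)
      (fun t ht => e1 t (by rwa [uIcc_of_le h0] at ht)), intervalIntegral.integral_sub _ (hWi e0 m1),
      intervalIntegral.integral_comp_add_right, zero_add,
      intervalIntegral.integral_interval_sub_interval_comm (hWi m3 m2) (hWi e0 m1) (hWi m3 e0)]
    · rw [intervalIntegral.integral_symm 0 η, intervalIntegral.integral_symm τ' (τ' + η)]; ring
    · have := (hWi m3 m2).comp_add_right η
      simpa using this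
  rw [e2]
  have nonneg : ∀ {a b}, a ≤ b → 0 ≤ ∫ s in a..b, w s := fun h =>
    intervalIntegral.integral_nonneg h fun t _ => hw0 t
  have h3 : 0 ≤ ∫ t in (0 : ℝ)..η, W t :=
    intervalIntegral.integral_nonneg hη.le fun t ht => nonneg ht.1
  have h4 : ∫ t in τ'..τ' + η, W t ≤ ∫ t in τ'..τ' + η, W (τ' + η) := by
    apply intervalIntegral.integral_mono_on (by linarith) (hWi m1 m2) (by simp)
    intro t ht
    have := intervalIntegral.integral_add_adjacent_intervals
      (hint e0 (⟨by linarith [ht.1], by linarith [ht.2]⟩ : t ∈ Icc 0 τ)) (hint ⟨by linarith [ht.1], by linarith [ht.2]⟩ m2)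
    have h6 := nonneg ht.2
    simp only [hW]
    linarith
  have h5 : ∫ t in τ'..τ' + η, W (τ' + η) = η * W (τ' + η) := by simp
  linarith

/-- Forward averages of a square integrable function converge in `L²`, norm version. -/
theorem tendsto_integral_norm_sq_average [NormedSpace ℝ E] [CompleteSpace E] {f : ℝ → E} {τ τ' : ℝ}
    (hf : MemLp f 2 (volume.restrict (Ioc 0 τ))) (h0 : 0 ≤ τ') (hτ : τ' < τ) {u : ℕ → ℝ}
    (hu : Tendsto u atTop (𝓝[>] 0)) :
    Tendsto (fun n => ∫ t in (0 : ℝ)..τ', ‖(u n)⁻¹ • ∫ s in t..t + u n, f s‖ ^ 2) atTop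
      (𝓝 (∫ t in (0 : ℝ)..τ', ‖f t‖ ^ 2)) := by
  have hu0 : Tendsto u atTop (𝓝 0) := hu.mono_right nhdsWithin_le_nhds
  have hupos : ∀ᶠ n in atTop, 0 < u n := hu self_mem_nhdsWithin
  have husm : ∀ᶠ n in atTop, u n < τ - τ' := hu0.eventually_lt_const (by linarith)
  have mem0 : (0 : ℝ) ∈ Icc 0 τ := ⟨le_rfl, by linarith⟩
  have mem1 : τ' ∈ Icc 0 τ := ⟨h0, hτ.le⟩
  have hI := fun {a b : ℝ} (ha : a ∈ Icc 0 τ) (hb : b ∈ Icc 0 τ) => intervalIntegrable_of_memLp_Ioc hf ha hb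
  have hI2 := fun {a b : ℝ} (ha : a ∈ Icc 0 τ) (hb : b ∈ Icc 0 τ) => intervalIntegrable_sq_of_memLp_Ioc hf ha hb
  have h_on : IntegrableOn f (Ioc 0 τ) := hf.integrable one_le_two
  have h_on2 : IntegrableOn (fun t => ‖f t‖ ^ 2) (Ioc 0 τ) :=
    (intervalIntegrable_iff_integrableOn_Ioc_of_le (by linarith)).1 (hI2 mem0 ⟨by linarith, le_rfl⟩)
  set A : ℕ → ℝ → E := fun n t => (u n)⁻¹ • ∫ s in t..t + u n, f s with hA
  have hAc : ∀ᶠ n in atTop, ContinuousOn (A n) (Icc 0 τ') := by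
    filter_upwards [hupos, husm] with n h1 h2
    exact (continuousOn_forward_integral h_on h1.le (by linarith)).const_smul _
  -- Cauchy–Schwarz on each window, then the bound for the double integral. Averaging does not
  -- increase the `L²` norm, apart from the overhang of length `u n`.
  have upper : ∀ᶠ n in atTop, ∫ t in (0 : ℝ)..τ', ‖A n t‖ ^ 2 ≤ ∫ t in (0 : ℝ)..τ' + u n, ‖f t‖ ^ 2 := by
    filter_upwards [hupos, husm, hAc] with n h1 h2 h3
    have h4 : ∀ t ∈ Icc 0 τ', ‖A n t‖ ^ 2 ≤ (u n)⁻¹ * ∫ s in t..t + u n, ‖f s‖ ^ 2 := by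
      intro t ht
      have m : t ∈ Icc 0 τ := ⟨ht.1, by linarith [ht.2]⟩
      have m' : t + u n ∈ Icc 0 τ := ⟨by linarith [ht.1], by linarith [ht.2]⟩
      have := norm_intervalIntegral_sq_le (by linarith) (hI m m') (hI2 m m')
      rw [hA]
      simp only
      rw [norm_smul, mul_pow, norm_inv, Real.norm_eq_abs, abs_of_pos h1]
      calc _ ≤ ((u n)⁻¹) ^ 2 * ((t + u n - t) * ∫ s in t..t + u n, ‖f s‖ ^ 2) := by gcongr
        _ = _ := by field_simp; ring
    have hc2 : ContinuousOn (fun t => (u n)⁻¹ * ∫ s in t..t + u n, ‖f s‖ ^ 2) (Icc 0 τ') := by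
      exact (continuousOn_forward_integral h_on2 h1.le (by linarith)).const_mul _
    calc _ ≤ ∫ t in (0 : ℝ)..τ', (u n)⁻¹ * ∫ s in t..t + u n, ‖f s‖ ^ 2 := by
          refine intervalIntegral.integral_mono_on h0 ?_ ?_ h4
          · exact (by rw [uIcc_of_le h0]; exact h3.norm.pow 2 : ContinuousOn _ (uIcc 0 τ')).intervalIntegrable
          · exact (by rw [uIcc_of_le h0]; exact hc2 : ContinuousOn _ (uIcc 0 τ')).intervalIntegrable
      _ = (u n)⁻¹ * ∫ t in (0 : ℝ)..τ', ∫ s in t..t + u n, ‖f s‖ ^ 2 := by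
          rw [intervalIntegral.integral_const_mul]
      _ ≤ (u n)⁻¹ * (u n * ∫ s in (0 : ℝ)..τ' + u n, ‖f s‖ ^ 2) := by
          gcongr
          exact integral_integral_forward_le h_on2 (fun t => sq_nonneg _) h0 h1 (by linarith)
      _ = _ := by field_simp
  have ulim : Tendsto (fun n => ∫ t in (0 : ℝ)..τ' + u n, ‖f t‖ ^ 2) atTop (𝓝 (∫ t in (0 : ℝ)..τ', ‖f t‖ ^ 2)) := by
    have hc := continuousOn_primitive_of_memLp_Ioc h_on2
    have h1 : Tendsto (fun n => τ' + u n) atTop (𝓝[Icc 0 τ] τ') := by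
      apply tendsto_nhdsWithin_iff.2 ⟨by simpa using hu0.const_add τ', ?_⟩
      filter_upwards [hupos, husm] with n h1 h2
      exact ⟨by linarith, by linarith⟩
    exact (hc τ' mem1).tendsto.comp h1
  -- Lebesgue differentiation.
  have ae : ∀ᵐ t ∂(volume.restrict (Ioc 0 τ')), Tendsto (fun n => A n t) atTop (𝓝 (f t)) := by
    rw [ae_restrict_iff' measurableSet_Ioc]
    filter_upwards [(hI mem0 (⟨by linarith, le_rfl⟩ : τ ∈ Icc 0 τ)).ae_hasDerivAt_integral] with t ht hmem
    have hm : t ∈ Icc 0 τ := ⟨hmem.1.le, by linarith [hmem.2]⟩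
    have hd := ht (by rwa [uIcc_of_le (by linarith)]) 0 (by simp)
    have hs := (hasDerivAt_iff_tendsto_slope_zero.1 hd).comp
      (hu.mono_right (nhdsWithin_mono _ fun x (hx : 0 < x) => hx.ne'))
    refine hs.congr' ?_
    filter_upwards [hupos, husm] with n h1 h2
    simp only [Function.comp, hA]
    rw [intervalIntegral.integral_interval_sub_left
      (hI mem0 ⟨by linarith [hmem.1], by linarith [hmem.2]⟩) (hI mem0 hm)]
  have toR : ∀ k : ℝ → ℝ, (∀ t, 0 ≤ k t) → IntervalIntegrable k volume 0 τ' →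
      ENNReal.ofReal (∫ t in (0 : ℝ)..τ', k t) = ∫⁻ t in Ioc 0 τ', ENNReal.ofReal (k t) := by
    intro k hk hki
    rw [intervalIntegral.integral_of_le h0, ofReal_integral_eq_lintegral_ofReal
      ((intervalIntegrable_iff_integrableOn_Ioc_of_le h0).1 hki) (Eventually.of_forall hk)]
  have hA2i : ∀ᶠ n in atTop, IntervalIntegrable (fun t => ‖A n t‖ ^ 2) volume 0 τ' := by
    filter_upwards [hAc] with n h
    exact (by rw [uIcc_of_le h0]; exact h.norm.pow 2 : ContinuousOn _ (uIcc 0 τ')).intervalIntegrable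
  have key : Tendsto (fun n => ENNReal.ofReal (∫ t in (0 : ℝ)..τ', ‖A n t‖ ^ 2)) atTop
      (𝓝 (ENNReal.ofReal (∫ t in (0 : ℝ)..τ', ‖f t‖ ^ 2))) := by
    -- The lower bound is Fatou's lemma with the almost everywhere convergence; the upper bound is
    -- `upper`.
    refine tendsto_of_le_liminf_of_limsup_le ?_ ?_
    · have fatou : ∫⁻ t in Ioc 0 τ', liminf (fun n => ENNReal.ofReal (‖A n t‖ ^ 2)) atTop
          ≤ liminf (fun n => ∫⁻ t in Ioc 0 τ', ENNReal.ofReal (‖A n t‖ ^ 2)) atTop := by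
        -- Measurability of the averages is known only from some index `N` on; dropping finitely
        -- many terms leaves the lower limit unchanged.
        obtain ⟨N, hN⟩ := eventually_atTop.1 hAc
        have : ∀ n, AEMeasurable (fun t => ENNReal.ofReal (‖A (n + N) t‖ ^ 2)) (volume.restrict (Ioc 0 τ')) := by
          intro n
          have h := ((hN (n + N) (by omega)).mono Ioc_subset_Icc_self).aestronglyMeasurable
            measurableSet_Ioc (μ := volume)
          exact (h.norm.aemeasurable.pow_const 2).ennreal_ofReal
        have h2 := lintegral_liminf_le' (u := atTop) this
        rw [Filter.liminf_nat_add (fun n => ∫⁻ t in Ioc 0 τ', ENNReal.ofReal (‖A n t‖ ^ 2)) N] at h2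
        refine le_trans (le_of_eq ?_) h2
        congr 1; ext t
        rw [Filter.liminf_nat_add (fun n => ENNReal.ofReal (‖A n t‖ ^ 2)) N]
      rw [toR _ (fun t => sq_nonneg _) (hI2 mem0 mem1)]
      calc _ = ∫⁻ t in Ioc 0 τ', liminf (fun n => ENNReal.ofReal (‖A n t‖ ^ 2)) atTop := by
            apply lintegral_congr_ae
            filter_upwards [ae] with t ht
            exact ((ENNReal.continuous_ofReal.tendsto _).comp ((ht.norm).pow 2)).liminf_eq.symm
        _ ≤ _ := fatou
        _ = _ := by
            apply liminf_congr
            filter_upwards [hA2i] with n h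
            rw [toR _ (fun t => sq_nonneg _) h]
    · calc _ ≤ limsup (fun n => ENNReal.ofReal (∫ t in (0 : ℝ)..τ' + u n, ‖f t‖ ^ 2)) atTop := by
            refine limsup_le_limsup ?_
            filter_upwards [upper] with n h
            exact ENNReal.ofReal_le_ofReal h
        _ = _ := ((ENNReal.continuous_ofReal.tendsto _).comp ulim).limsup_eq
  have := (ENNReal.tendsto_toReal ENNReal.ofReal_ne_top).comp key
  have nn : ∀ k : ℝ → E, 0 ≤ ∫ t in (0 : ℝ)..τ', ‖k t‖ ^ 2 := fun k =>
    intervalIntegral.integral_nonneg h0 fun t _ => sq_nonneg _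
  simpa [Function.comp_def, ENNReal.toReal_ofReal (nn _)] using this

/-- Forward averages of square integrable functions converge in `L²`, inner product version. -/
theorem tendsto_integral_inner_average {E : Type*} [NormedAddCommGroup E] [InnerProductSpace ℝ E]
    [CompleteSpace E] {f k : ℝ → E} {τ τ' : ℝ}
    (hf : MemLp f 2 (volume.restrict (Ioc 0 τ))) (hk : MemLp k 2 (volume.restrict (Ioc 0 τ)))
    (h0 : 0 ≤ τ') (hτ : τ' < τ) {u : ℕ → ℝ} (hu : Tendsto u atTop (𝓝[>] 0)) :
    Tendsto (fun n => ∫ t in (0 : ℝ)..τ', inner ℝ ((u n)⁻¹ • ∫ s in t..t + u n, f s)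
      ((u n)⁻¹ • ∫ s in t..t + u n, k s)) atTop (𝓝 (∫ t in (0 : ℝ)..τ', inner ℝ (f t) (k t))) := by
  have hu0 : Tendsto u atTop (𝓝 0) := hu.mono_right nhdsWithin_le_nhds
  have hupos : ∀ᶠ n in atTop, 0 < u n := hu self_mem_nhdsWithin
  have husm : ∀ᶠ n in atTop, u n < τ - τ' := hu0.eventually_lt_const (by linarith)
  have mem0 : (0 : ℝ) ∈ Icc 0 τ := ⟨le_rfl, by linarith⟩
  have mem1 : τ' ∈ Icc 0 τ := ⟨h0, hτ.le⟩
  -- Polarisation reduces the inner product to the norms of `f + k` and `f - k`.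
  have hp := tendsto_integral_norm_sq_average (hf.add hk) h0 hτ hu
  have hm := tendsto_integral_norm_sq_average (hf.sub hk) h0 hτ hu
  have pol : ∀ x y : E, inner ℝ x y = (1 / 4) * ‖x + y‖ ^ 2 - (1 / 4) * ‖x - y‖ ^ 2 := by
    intro x y
    rw [norm_add_sq_real, norm_sub_sq_real]; ring
  have hlim := (hp.const_mul (1 / 4)).sub (hm.const_mul (1 / 4))
  have e : ∫ t in (0 : ℝ)..τ', inner ℝ (f t) (k t)
      = 1 / 4 * (∫ t in (0 : ℝ)..τ', ‖(f + k) t‖ ^ 2) - 1 / 4 * ∫ t in (0 : ℝ)..τ', ‖(f - k) t‖ ^ 2 := by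
    rw [← intervalIntegral.integral_const_mul, ← intervalIntegral.integral_const_mul,
      ← intervalIntegral.integral_sub]
    · simp only [pol, Pi.add_apply, Pi.sub_apply]
    · exact (intervalIntegrable_sq_of_memLp_Ioc (hf.add hk) mem0 mem1).const_mul _
    · exact (intervalIntegrable_sq_of_memLp_Ioc (hf.sub hk) mem0 mem1).const_mul _
  rw [e]
  refine hlim.congr' ?_
  filter_upwards [hupos, husm] with n h1 h2
  have avc : ∀ l : ℝ → E, MemLp l 2 (volume.restrict (Ioc 0 τ)) →
      IntervalIntegrable (fun t => (1 / 4 : ℝ) * ‖(u n)⁻¹ • ∫ s in t..t + u n, l s‖ ^ 2) volume 0 τ' := by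
    intro l hl
    have h4 : ContinuousOn (fun t => (1 / 4 : ℝ) * ‖(u n)⁻¹ • ∫ s in t..t + u n, l s‖ ^ 2) (Icc 0 τ') :=
      ((((continuousOn_forward_integral (hl.integrable one_le_two) h1.le (by linarith)).const_smul
        (u n)⁻¹).norm).pow 2).const_mul _
    exact (by rwa [uIcc_of_le h0] : ContinuousOn _ (uIcc 0 τ')).intervalIntegrable
  rw [← intervalIntegral.integral_const_mul, ← intervalIntegral.integral_const_mul,
    ← intervalIntegral.integral_sub (avc _ (hf.add hk)) (avc _ (hf.sub hk))]
  apply intervalIntegral.integral_congr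
  intro t ht
  rw [uIcc_of_le h0] at ht
  have m : t ∈ Icc 0 τ := ⟨ht.1, by linarith [ht.2]⟩
  have m' : t + u n ∈ Icc 0 τ := ⟨by linarith [ht.1], by linarith [ht.2]⟩
  simp only [Pi.add_apply, Pi.sub_apply]
  rw [intervalIntegral.integral_add (intervalIntegrable_of_memLp_Ioc hf m m') (intervalIntegrable_of_memLp_Ioc hk m m'),
    intervalIntegral.integral_sub (intervalIntegrable_of_memLp_Ioc hf m m') (intervalIntegrable_of_memLp_Ioc hk m m'),
    smul_add, smul_sub, pol]

end Averages

/-! ### Averages and primitives of continuous functions; Grönwall's inequality -/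

section ContinuousOnAverages

variable {E : Type*} [NormedAddCommGroup E]

theorem memLp_two_of_continuousOn_Icc {k : ℝ → E} {τ : ℝ} (hk : ContinuousOn k (Icc 0 τ)) :
    MemLp k 2 (volume.restrict (Ioc 0 τ)) := by
  obtain ⟨C, hC⟩ := isCompact_Icc.exists_bound_of_continuousOn hk
  refine MemLp.of_bound ?_ C ?_
  · exact (hk.mono Ioc_subset_Icc_self).aestronglyMeasurable measurableSet_Ioc
  · exact (ae_restrict_iff' measurableSet_Ioc).2
      (Eventually.of_forall fun x hx => hC x (Ioc_subset_Icc_self hx))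

theorem integrableOn_Ioc_of_continuousOn_Icc {k : ℝ → E} {τ : ℝ} (hk : ContinuousOn k (Icc 0 τ)) :
    IntegrableOn k (Ioc 0 τ) :=
  (memLp_two_of_continuousOn_Icc hk).integrable one_le_two

variable [NormedSpace ℝ E] [CompleteSpace E]

theorem hasDerivWithinAt_integral_Ici {k : ℝ → E} {τ t : ℝ} (hk : ContinuousOn k (Icc 0 τ))
    (ht : t ∈ Ico 0 τ) : HasDerivWithinAt (fun s => ∫ r in (0 : ℝ)..s, k r) (k t) (Ici t) t := by
  have hmem : Icc 0 τ ∈ 𝓝[Ici t] t :=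
    mem_of_superset (Icc_mem_nhdsGE ht.2) (Icc_subset_Icc_left ht.1)
  have hmem' : Icc 0 τ ∈ 𝓝[>] t := nhdsWithin_mono _ Ioi_subset_Ici_self hmem
  have hc : ContinuousWithinAt k (Ioi t) t :=
    (hk t ⟨ht.1, ht.2.le⟩).mono_of_mem_nhdsWithin hmem'
  refine intervalIntegral.integral_hasDerivWithinAt_right ?_ ?_ hc
  · exact intervalIntegrable_of_integrableOn_Ioc (integrableOn_Ioc_of_continuousOn_Icc hk)
      ⟨le_rfl, ht.1.trans ht.2.le⟩ ⟨ht.1, ht.2.le⟩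
  · exact ⟨Icc 0 τ, hmem', hk.aestronglyMeasurable measurableSet_Icc⟩

theorem tendsto_average_of_continuousOn {k : ℝ → E} {τ t : ℝ} (hk : ContinuousOn k (Icc 0 τ))
    (ht : t ∈ Ico 0 τ) {u : ℕ → ℝ} (hu : Tendsto u atTop (𝓝[>] 0)) :
    Tendsto (fun n => (u n)⁻¹ • ∫ s in t..t + u n, k s) atTop (𝓝 (k t)) := by
  have hu0 : Tendsto u atTop (𝓝 0) := hu.mono_right nhdsWithin_le_nhds
  have hupos : ∀ᶠ n in atTop, 0 < u n := hu self_mem_nhdsWithin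
  have husm : ∀ᶠ n in atTop, u n < τ - t := hu0.eventually_lt_const (by linarith [ht.2])
  have h := hasDerivWithinAt_iff_tendsto_slope.1 (hasDerivWithinAt_integral_Ici hk ht)
  have h1 : Tendsto (fun n => t + u n) atTop (𝓝[Ici t \ {t}] t) := by
    apply tendsto_nhdsWithin_iff.2 ⟨by simpa using hu0.const_add t, ?_⟩
    filter_upwards [hupos] with n hn
    exact ⟨by simp [hn.le], by simp [hn.ne']⟩
  refine (h.comp h1).congr' ?_
  have hI := integrableOn_Ioc_of_continuousOn_Icc hk
  have m0 : (0 : ℝ) ∈ Icc 0 τ := ⟨le_rfl, ht.1.trans ht.2.le⟩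
  filter_upwards [hupos, husm] with n h1 h2
  rw [Function.comp, slope_def_module, add_sub_cancel_left,
    intervalIntegral.integral_interval_sub_left
    (intervalIntegrable_of_integrableOn_Ioc hI m0 ⟨by linarith [ht.1], by linarith⟩)
    (intervalIntegrable_of_integrableOn_Ioc hI m0 ⟨ht.1, ht.2.le⟩)]

theorem hasDerivAt_integral_of_continuousOn {k : ℝ → E} {τ t : ℝ} (hk : ContinuousOn k (Icc 0 τ))
    (ht : t ∈ Ioo 0 τ) : HasDerivAt (fun s => ∫ r in (0 : ℝ)..s, k r) (k t) t := by
  have hmem : Icc 0 τ ∈ 𝓝 t := Icc_mem_nhds ht.1 ht.2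
  refine intervalIntegral.integral_hasDerivAt_right ?_ ?_ (hk.continuousAt hmem)
  · exact intervalIntegrable_of_integrableOn_Ioc (integrableOn_Ioc_of_continuousOn_Icc hk)
      ⟨le_rfl, (ht.1.trans ht.2).le⟩ ⟨ht.1.le, ht.2.le⟩
  · exact ⟨Icc 0 τ, hmem, hk.aestronglyMeasurable measurableSet_Icc⟩

/-- Averaging gains a time derivative: for the averaged fields the energy can be differentiated. -/
theorem hasDerivAt_forward_integral {k : ℝ → E} {τ t η : ℝ} (hk : ContinuousOn k (Icc 0 τ))
    (ht : 0 < t) (hη : 0 < η) (htη : t + η < τ) :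
    HasDerivAt (fun s => ∫ r in s..s + η, k r) (k (t + η) - k t) t := by
  have hI := integrableOn_Ioc_of_continuousOn_Icc hk
  have h1 := hasDerivAt_integral_of_continuousOn hk (t := t + η) ⟨by linarith, htη⟩
  have h2 := hasDerivAt_integral_of_continuousOn hk (t := t) ⟨by linarith, by linarith⟩
  refine ((h1.comp_add_const t η).sub h2).congr_of_eventuallyEq ?_
  filter_upwards [Ioo_mem_nhds (show 0 < t from ht) (show t < τ - η by linarith)] with s hs
  simp only [Pi.sub_apply]
  have m0 : (0 : ℝ) ∈ Icc 0 τ := ⟨le_rfl, by linarith [hs.1]⟩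
  rw [intervalIntegral.integral_interval_sub_left
    (intervalIntegrable_of_integrableOn_Ioc hI m0 ⟨by linarith [hs.1], by linarith [hs.2]⟩)
    (intervalIntegrable_of_integrableOn_Ioc hI m0 ⟨hs.1.le, by linarith [hs.2]⟩)]

end ContinuousOnAverages

/-- Integral form of Grönwall's inequality. -/
theorem le_mul_exp_of_le_add_integral {N : ℝ → ℝ} {A C τ : ℝ} (hN : ContinuousOn N (Icc 0 τ))
    (hC : 0 ≤ C) (h : ∀ t ∈ Icc 0 τ, N t ≤ A + C * ∫ s in (0 : ℝ)..t, N s) :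
    ∀ t ∈ Icc 0 τ, N t ≤ A * Real.exp (C * t) := by
  set X : ℝ → ℝ := fun t => A + C * ∫ s in (0 : ℝ)..t, N s with hX
  have hXc : ContinuousOn X (Icc 0 τ) :=
    continuousOn_const.add ((continuousOn_primitive_of_memLp_Ioc
      (integrableOn_Ioc_of_continuousOn_Icc hN)).const_mul C)
  have hXd : ∀ t ∈ Ico 0 τ, HasDerivWithinAt X (C * N t) (Ici t) t := fun t ht =>
    ((hasDerivWithinAt_integral_Ici hN ht).const_mul C).const_add A
  have hb := le_gronwallBound_of_liminf_deriv_right_le (f := X) (f' := fun t => C * N t) (δ := A)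
    (K := C) (ε := 0) hXc
    (fun t ht r hr => (hXd t ht).liminf_right_slope_le hr)
    (by simp [hX]) (fun t ht => by
      have := h t ⟨ht.1, ht.2.le⟩
      rw [add_zero]
      exact mul_le_mul_of_nonneg_left this hC)
  intro t ht
  have := hb t ht
  rw [gronwallBound_ε0, sub_zero] at this
  exact (h t ht).trans this

theorem MemLp.integrable_real_inner {X E : Type*} [MeasurableSpace X] {ν : Measure X}
    [NormedAddCommGroup E] [InnerProductSpace ℝ E] {f k : X → E} (hf : MemLp f 2 ν)
    (hk : MemLp k 2 ν) : Integrable (fun x => inner ℝ (f x) (k x)) ν := by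
  refine memLp_one_iff_integrable.1 (MemLp.of_bilin (fun x y : E => (inner ℝ x y : ℝ)) 1 hf hk
    (hf.1.inner hk.1) (Eventually.of_forall fun x => ?_))
  simpa using nnnorm_inner_le_nnnorm (𝕜 := ℝ) (f x) (k x)

/-! ### The abstract damped wave equation: energy identity and stability -/

namespace WaveSystem

variable {𝓗 : Type*} [NormedAddCommGroup 𝓗] [InnerProductSpace ℝ 𝓗]

/-- Solutions on `[0,τ]` of the abstract linear wave equation with boundary damping, in first order
form: `(J g)' = k`, `J† k' + g + μ ⟨e, g'⟩ e = h e + J† G`, where the trace `⟨e, g⟩` has the square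
integrable derivative `b`. -/
structure DampedWave (J : 𝓗 →L[ℝ] 𝓗) (e : 𝓗) (μ τ : ℝ) (G : ℝ → 𝓗) (h : ℝ → ℝ)
    (g k : ℝ → 𝓗) (b : ℝ → ℝ) : Prop where
  continuousOn_g : ContinuousOn g (Icc 0 τ)
  continuousOn_k : ContinuousOn k (Icc 0 τ)
  memLp_G : MemLp G 2 (volume.restrict (Ioc 0 τ))
  memLp_h : MemLp h 2 (volume.restrict (Ioc 0 τ))
  memLp_b : MemLp b 2 (volume.restrict (Ioc 0 τ))
  apply_g : ∀ t ∈ Icc 0 τ, J (g t) = J (g 0) + ∫ s in (0 : ℝ)..t, k s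
  trace : ∀ t ∈ Icc 0 τ, inner ℝ e (g t) = inner ℝ e (g 0) + ∫ s in (0 : ℝ)..t, b s
  weak : ∀ φ, ∀ t ∈ Icc 0 τ, inner ℝ (J φ) (k t) + inner ℝ φ (∫ s in (0 : ℝ)..t, g s)
      + μ * inner ℝ e (g t) * inner ℝ e φ
    = inner ℝ (J φ) (k 0) + μ * inner ℝ e (g 0) * inner ℝ e φ
      + (∫ s in (0 : ℝ)..t, h s) * inner ℝ e φ + inner ℝ (J φ) (∫ s in (0 : ℝ)..t, G s)

namespace DampedWave

variable {J : 𝓗 →L[ℝ] 𝓗} {e : 𝓗} {μ τ : ℝ} {G : ℝ → 𝓗} {h : ℝ → ℝ} {g k : ℝ → 𝓗} {b : ℝ → ℝ}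

theorem integrableOn_G (S : DampedWave J e μ τ G h g k b) : IntegrableOn G (Ioc 0 τ) :=
  S.memLp_G.integrable one_le_two

theorem integrableOn_h (S : DampedWave J e μ τ G h g k b) : IntegrableOn h (Ioc 0 τ) :=
  S.memLp_h.integrable one_le_two

theorem integrableOn_b (S : DampedWave J e μ τ G h g k b) : IntegrableOn b (Ioc 0 τ) :=
  S.memLp_b.integrable one_le_two

theorem integrableOn_g (S : DampedWave J e μ τ G h g k b) : IntegrableOn g (Ioc 0 τ) :=
  integrableOn_Ioc_of_continuousOn_Icc S.continuousOn_g

theorem integrableOn_k (S : DampedWave J e μ τ G h g k b) : IntegrableOn k (Ioc 0 τ) :=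
  integrableOn_Ioc_of_continuousOn_Icc S.continuousOn_k

theorem apply_g_sub [CompleteSpace 𝓗] (S : DampedWave J e μ τ G h g k b) {s t : ℝ} (hs : s ∈ Icc 0 τ) (ht : t ∈ Icc 0 τ) :
    J (g t - g s) = ∫ r in s..t, k r := by
  have m0 : (0 : ℝ) ∈ Icc 0 τ := ⟨le_rfl, hs.1.trans hs.2⟩
  rw [map_sub, S.apply_g t ht, S.apply_g s hs, add_sub_add_left_eq_sub,
    intervalIntegral.integral_interval_sub_left
    (intervalIntegrable_of_integrableOn_Ioc S.integrableOn_k m0 ht)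
    (intervalIntegrable_of_integrableOn_Ioc S.integrableOn_k m0 hs)]

theorem trace_sub (S : DampedWave J e μ τ G h g k b) {s t : ℝ} (hs : s ∈ Icc 0 τ) (ht : t ∈ Icc 0 τ) :
    inner ℝ e (g t - g s) = ∫ r in s..t, b r := by
  have m0 : (0 : ℝ) ∈ Icc 0 τ := ⟨le_rfl, hs.1.trans hs.2⟩
  rw [inner_sub_right, S.trace t ht, S.trace s hs, add_sub_add_left_eq_sub,
    intervalIntegral.integral_interval_sub_left
    (intervalIntegrable_of_integrableOn_Ioc S.integrableOn_b m0 ht)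
    (intervalIntegrable_of_integrableOn_Ioc S.integrableOn_b m0 hs)]

theorem weak_sub [CompleteSpace 𝓗] (S : DampedWave J e μ τ G h g k b) {s t : ℝ} (hs : s ∈ Icc 0 τ) (ht : t ∈ Icc 0 τ)
    (φ : 𝓗) : inner ℝ (J φ) (k t - k s) + inner ℝ φ (∫ r in s..t, g r)
      + μ * (∫ r in s..t, b r) * inner ℝ e φ
    = (∫ r in s..t, h r) * inner ℝ e φ + inner ℝ (J φ) (∫ r in s..t, G r) := by
  have m0 : (0 : ℝ) ∈ Icc 0 τ := ⟨le_rfl, hs.1.trans hs.2⟩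
  have h1 := S.weak φ t ht
  have h2 := S.weak φ s hs
  rw [← S.trace_sub hs ht, ← intervalIntegral.integral_interval_sub_left
    (intervalIntegrable_of_integrableOn_Ioc S.integrableOn_g m0 ht)
    (intervalIntegrable_of_integrableOn_Ioc S.integrableOn_g m0 hs),
    ← intervalIntegral.integral_interval_sub_left
    (intervalIntegrable_of_integrableOn_Ioc S.integrableOn_h m0 ht)
    (intervalIntegrable_of_integrableOn_Ioc S.integrableOn_h m0 hs),
    ← intervalIntegral.integral_interval_sub_left
    (intervalIntegrable_of_integrableOn_Ioc S.integrableOn_G m0 ht)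
    (intervalIntegrable_of_integrableOn_Ioc S.integrableOn_G m0 hs)]
  simp only [inner_sub_right]
  linarith

variable [CompleteSpace 𝓗]

/-- The energy identity. -/
theorem energy_identity (S : DampedWave J e μ τ G h g k b) {t : ℝ} (ht0 : 0 ≤ t) (htτ : t < τ) :
    1 / 2 * (‖k t‖ ^ 2 + ‖g t‖ ^ 2) = 1 / 2 * (‖k 0‖ ^ 2 + ‖g 0‖ ^ 2)
      + ((∫ s in (0 : ℝ)..t, (h s - μ * b s) * b s) + ∫ s in (0 : ℝ)..t, inner ℝ (G s) (k s)) := by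
  set u : ℕ → ℝ := fun n => 1 / ((n : ℝ) + 1) with hu_def
  have hupos' : ∀ n, 0 < u n := fun n => by positivity
  have hu : Tendsto u atTop (𝓝[>] 0) :=
    tendsto_nhdsWithin_iff.2 ⟨tendsto_one_div_add_atTop_nhds_zero_nat, Eventually.of_forall hupos'⟩
  have hu0 : Tendsto u atTop (𝓝 0) := hu.mono_right nhdsWithin_le_nhds
  have husm : ∀ᶠ n in atTop, u n < τ - t := hu0.eventually_lt_const (by linarith)
  have hl : MemLp (fun s => h s - μ * b s) 2 (volume.restrict (Ioc 0 τ)) :=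
    S.memLp_h.sub (S.memLp_b.const_mul μ)
  have R1 := tendsto_integral_inner_average hl S.memLp_b ht0 htτ hu
  have R2 := tendsto_integral_inner_average S.memLp_G (memLp_two_of_continuousOn_Icc S.continuousOn_k)
    ht0 htτ hu
  have m0 : (0 : ℝ) ∈ Ico 0 τ := ⟨le_rfl, by linarith⟩
  have L : ∀ s ∈ Ico 0 τ, Tendsto (fun n => 1 / 2 * (‖(u n)⁻¹ • ∫ r in s..s + u n, k r‖ ^ 2
      + ‖(u n)⁻¹ • ∫ r in s..s + u n, g r‖ ^ 2)) atTop (𝓝 (1 / 2 * (‖k s‖ ^ 2 + ‖g s‖ ^ 2))) :=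
    fun s hs => (((tendsto_average_of_continuousOn S.continuousOn_k hs hu).norm.pow 2).add
      ((tendsto_average_of_continuousOn S.continuousOn_g hs hu).norm.pow 2)).const_mul _
  have L' := (L t ⟨ht0, htτ⟩).sub (L 0 m0)
  have key := tendsto_nhds_unique_of_eventuallyEq L' (R1.add R2) ?_
  · have e1 : ∀ s, inner ℝ (h s - μ * b s) (b s) = (h s - μ * b s) * b s := fun s => by
      simp [mul_comm]
    simp only [e1] at key
    linarith
  -- For a fixed window `η` the identity holds exactly for the averaged fields, by the fundamental
  -- theorem of calculus.
  filter_upwards [husm] with n hn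
  have hη := hupos' n
  set η := u n with hηdef
  have cK := continuousOn_forward_integral (τ' := t) (η := η) S.integrableOn_k hη.le (by linarith)
  have cg := continuousOn_forward_integral (τ' := t) (η := η) S.integrableOn_g hη.le (by linarith)
  have cG := continuousOn_forward_integral (τ' := t) (η := η) S.integrableOn_G hη.le (by linarith)
  have ch := continuousOn_forward_integral (τ' := t) (η := η) (hl.integrable one_le_two) hη.le (by linarith)
  have cb := continuousOn_forward_integral (τ' := t) (η := η) S.integrableOn_b hη.le (by linarith)
  have i1 : ContinuousOn (fun s => inner ℝ (η⁻¹ • ∫ r in s..s + η, (h r - μ * b r)) (η⁻¹ • ∫ r in s..s + η, b r)) (Icc 0 t) :=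
    (ch.const_smul η⁻¹).inner (cb.const_smul η⁻¹)
  have i2 : ContinuousOn (fun s => inner ℝ (η⁻¹ • ∫ r in s..s + η, G r) (η⁻¹ • ∫ r in s..s + η, k r)) (Icc 0 t) :=
    (cG.const_smul η⁻¹).inner (cK.const_smul η⁻¹)
  have ii : ∀ {c : ℝ → ℝ}, ContinuousOn c (Icc 0 t) → IntervalIntegrable c volume 0 t := fun hc =>
    (by rwa [uIcc_of_le ht0] : ContinuousOn _ (uIcc 0 t)).intervalIntegrable
  rw [← intervalIntegral.integral_add (ii i1) (ii i2)]
  symm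
  refine intervalIntegral.integral_eq_sub_of_hasDerivAt_of_le ht0
    (f := fun s => 1 / 2 * (‖η⁻¹ • ∫ r in s..s + η, k r‖ ^ 2 + ‖η⁻¹ • ∫ r in s..s + η, g r‖ ^ 2))
    ((((cK.const_smul η⁻¹).norm.pow 2).add ((cg.const_smul η⁻¹).norm.pow 2)).const_mul _) ?_ (ii (i1.add i2))
  intro s hs
  have dk := ((hasDerivAt_forward_integral S.continuousOn_k hs.1 hη (by linarith [hs.2])).const_smul η⁻¹).norm_sq
  have dg := ((hasDerivAt_forward_integral S.continuousOn_g hs.1 hη (by linarith [hs.2])).const_smul η⁻¹).norm_sq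
  convert! (dk.add dg).const_mul (1 / 2 : ℝ) using 1
  have ms : s ∈ Icc 0 τ := ⟨hs.1.le, by linarith [hs.2]⟩
  have ms' : s + η ∈ Icc 0 τ := ⟨by linarith [hs.1], by linarith [hs.2]⟩
  clear_value η
  -- The increment of `g` is the right test function: `J` maps it to `∫ k` and its trace is `∫ b`.
  -- The equation becomes `η²` times the identity for the derivative of the averaged energy.
  have w := S.weak_sub ms ms' (g (s + η) - g s)
  rw [S.apply_g_sub ms ms', S.trace_sub ms ms'] at w
  rw [intervalIntegral.integral_sub (intervalIntegrable_of_integrableOn_Ioc S.integrableOn_h ms ms')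
    ((intervalIntegrable_of_integrableOn_Ioc S.integrableOn_b ms ms').const_mul _),
    intervalIntegral.integral_const_mul]
  simp only [Pi.smul_apply, inner_smul_left, inner_smul_right, smul_eq_mul, map_inv₀, conj_trivial, RCLike.inner_apply]
  rw [real_inner_comm (∫ r in s..s + η, k r) (∫ r in s..s + η, G r)] 
  rw [real_inner_comm (∫ r in s..s + η, g r) (g (s + η) - g s)] at w
  linear_combination (-(η⁻¹ * η⁻¹)) * w

/-- Stability: the energy of a solution is controlled by its initial value and the sources. -/
theorem stability (S : DampedWave J e μ τ G h g k b) (hμ : 0 < μ) (hτ : 0 < τ) {t : ℝ} (ht : t ∈ Icc 0 τ) :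
    ‖k t‖ ^ 2 + ‖g t‖ ^ 2 ≤ (‖k 0‖ ^ 2 + ‖g 0‖ ^ 2
      + ∫ s in (0 : ℝ)..τ, (μ⁻¹ * h s ^ 2 + ‖G s‖ ^ 2)) * Real.exp t ∧
    μ * ∫ s in (0 : ℝ)..t, b s ^ 2 ≤ (‖k 0‖ ^ 2 + ‖g 0‖ ^ 2
      + ∫ s in (0 : ℝ)..τ, (μ⁻¹ * h s ^ 2 + ‖G s‖ ^ 2)) * Real.exp t := by
  set N : ℝ → ℝ := fun t => ‖k t‖ ^ 2 + ‖g t‖ ^ 2 with hN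
  have hNc : ContinuousOn N (Icc 0 τ) := (S.continuousOn_k.norm.pow 2).add (S.continuousOn_g.norm.pow 2)
  set D := ∫ s in (0 : ℝ)..τ, (μ⁻¹ * h s ^ 2 + ‖G s‖ ^ 2) with hD
  have m0 : (0 : ℝ) ∈ Icc 0 τ := ⟨le_rfl, hτ.le⟩
  have ib2 : ∀ {a c}, a ∈ Icc 0 τ → c ∈ Icc 0 τ → IntervalIntegrable (fun s => b s ^ 2) volume a c := by
    intro a c ha hc; simpa using intervalIntegrable_sq_of_memLp_Ioc S.memLp_b ha hc
  have ih2 : ∀ {a c}, a ∈ Icc 0 τ → c ∈ Icc 0 τ → IntervalIntegrable (fun s => h s ^ 2) volume a c := by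
    intro a c ha hc; simpa using intervalIntegrable_sq_of_memLp_Ioc S.memLp_h ha hc
  have iG2 : ∀ {a c}, a ∈ Icc 0 τ → c ∈ Icc 0 τ → IntervalIntegrable (fun s => ‖G s‖ ^ 2) volume a c :=
    fun ha hc => intervalIntegrable_sq_of_memLp_Ioc S.memLp_G ha hc
  have iD : ∀ {a c}, a ∈ Icc 0 τ → c ∈ Icc 0 τ →
      IntervalIntegrable (fun s => μ⁻¹ * h s ^ 2 + ‖G s‖ ^ 2) volume a c :=
    fun ha hc => ((ih2 ha hc).const_mul _).add (iG2 ha hc)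
  have iN : ∀ {c}, c ∈ Icc 0 τ → IntervalIntegrable N volume 0 c := fun hc =>
    intervalIntegrable_of_integrableOn_Ioc (integrableOn_Ioc_of_continuousOn_Icc hNc) m0 hc
  have key1 : ∀ t, 0 ≤ t → t < τ → N t + μ * ∫ s in (0 : ℝ)..t, b s ^ 2 ≤ (N 0 + D) + ∫ s in (0 : ℝ)..t, N s := by
    intro t h0 ht
    have mt : t ∈ Icc 0 τ := ⟨h0, ht.le⟩
    have E := S.energy_identity h0 ht
    have b1 : ∫ s in (0 : ℝ)..t, (h s - μ * b s) * b s
        ≤ ∫ s in (0 : ℝ)..t, (1 / 2 * (μ⁻¹ * h s ^ 2) - 1 / 2 * (μ * b s ^ 2)) := by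
      apply intervalIntegral.integral_mono_on h0
      · have hl : MemLp (fun s => h s - μ * b s) 2 (volume.restrict (Ioc 0 τ)) :=
          S.memLp_h.sub (S.memLp_b.const_mul μ)
        have : IntegrableOn (fun s => (h s - μ * b s) * b s) (Ioc 0 τ) := hl.integrable_mul S.memLp_b
        exact intervalIntegrable_of_integrableOn_Ioc this m0 mt
      · exact (((ih2 m0 mt).const_mul _).const_mul _).sub (((ib2 m0 mt).const_mul _).const_mul _)
      · intro s _
        -- Completing the square: half of the boundary damping absorbs the boundary source, the
        -- other half remains and yields the bound for `∫ b²`.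
        have : 0 ≤ 1 / 2 * μ⁻¹ * (h s - μ * b s) ^ 2 := by positivity
        have e : 1 / 2 * μ⁻¹ * (h s - μ * b s) ^ 2
          = 1 / 2 * (μ⁻¹ * h s ^ 2) - h s * b s + 1 / 2 * (μ * b s ^ 2) := by field_simp; ring
        nlinarith
    have b2 : ∫ s in (0 : ℝ)..t, inner ℝ (G s) (k s) ≤ ∫ s in (0 : ℝ)..t, (1 / 2 * ‖G s‖ ^ 2 + 1 / 2 * N s) := by
      apply intervalIntegral.integral_mono_on h0
      · have : IntegrableOn (fun s => inner ℝ (G s) (k s)) (Ioc 0 τ) :=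
          _root_.MemLp.integrable_real_inner S.memLp_G (memLp_two_of_continuousOn_Icc S.continuousOn_k)
        exact intervalIntegrable_of_integrableOn_Ioc this m0 mt
      · exact ((iG2 m0 mt).const_mul _).add ((iN mt).const_mul _)
      · intro s _
        have h1 := real_inner_le_norm (G s) (k s)
        have h2 : ‖G s‖ * ‖k s‖ ≤ 1 / 2 * ‖G s‖ ^ 2 + 1 / 2 * ‖k s‖ ^ 2 := by
          nlinarith [sq_nonneg (‖G s‖ - ‖k s‖)]
        have h3 : ‖k s‖ ^ 2 ≤ N s := by simp only [hN]; nlinarith [sq_nonneg ‖g s‖]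
        linarith
    rw [intervalIntegral.integral_sub (((ih2 m0 mt).const_mul _).const_mul _) (((ib2 m0 mt).const_mul _).const_mul _),
      intervalIntegral.integral_const_mul, intervalIntegral.integral_const_mul, intervalIntegral.integral_const_mul (1 / 2),
      intervalIntegral.integral_const_mul μ] at b1
    rw [intervalIntegral.integral_add ((iG2 m0 mt).const_mul _) ((iN mt).const_mul _),
      intervalIntegral.integral_const_mul, intervalIntegral.integral_const_mul] at b2
    have b3 : μ⁻¹ * (∫ s in (0 : ℝ)..t, h s ^ 2) + ∫ s in (0 : ℝ)..t, ‖G s‖ ^ 2 ≤ D := by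
      rw [← intervalIntegral.integral_const_mul, ← intervalIntegral.integral_add ((ih2 m0 mt).const_mul _) (iG2 m0 mt),
        hD, ← intervalIntegral.integral_add_adjacent_intervals (iD m0 mt) (iD mt ⟨hτ.le, le_rfl⟩)]
      have : 0 ≤ ∫ s in t..τ, (μ⁻¹ * h s ^ 2 + ‖G s‖ ^ 2) :=
        intervalIntegral.integral_nonneg ht.le fun s _ => by positivity
      linarith
    simp only [hN] at *
    linarith
  -- The energy identity excludes `t = τ`, because forward averages look beyond `t`. Continuity
  -- includes the end point.
  have key2 : ∀ t ∈ Icc 0 τ, N t + μ * ∫ s in (0 : ℝ)..t, b s ^ 2 ≤ (N 0 + D) + ∫ s in (0 : ℝ)..t, N s := by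
    have c1 : ContinuousOn (fun t => N t + μ * ∫ s in (0 : ℝ)..t, b s ^ 2) (Icc 0 τ) :=
      hNc.add ((continuousOn_primitive_of_memLp_Ioc
        ((intervalIntegrable_iff_integrableOn_Ioc_of_le hτ.le).1 (ib2 m0 ⟨hτ.le, le_rfl⟩))).const_mul _)
    have c2 : ContinuousOn (fun t => (N 0 + D) + ∫ s in (0 : ℝ)..t, N s) (Icc 0 τ) :=
      continuousOn_const.add (continuousOn_primitive_of_memLp_Ioc (integrableOn_Ioc_of_continuousOn_Icc hNc))
    have hcl : closure (Ico 0 τ) = Icc 0 τ := closure_Ico hτ.ne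
    intro t ht
    rw [← hcl] at ht c1 c2
    exact le_on_closure (fun x hx => key1 x hx.1 hx.2) c1 c2 ht
  have bn : ∀ {t}, 0 ≤ t → 0 ≤ μ * ∫ s in (0 : ℝ)..t, b s ^ 2 := fun h0 =>
    mul_nonneg hμ.le (intervalIntegral.integral_nonneg h0 fun s _ => sq_nonneg _)
  have gr := le_mul_exp_of_le_add_integral hNc zero_le_one (A := N 0 + D) (fun t ht => by
    have := key2 t ht
    have := bn ht.1
    linarith)
  simp only [one_mul] at gr
  refine ⟨gr t ht, ?_⟩
  -- The Grönwall bound is inserted into the integral in `key2`: `1 + (exp t - 1) = exp t`.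
  have n1 : ∫ s in (0 : ℝ)..t, N s ≤ ∫ s in (0 : ℝ)..t, (N 0 + D) * Real.exp s := by
    apply intervalIntegral.integral_mono_on ht.1 (iN ht)
    · exact (by fun_prop : Continuous fun s : ℝ => (N 0 + D) * Real.exp s).intervalIntegrable _ _
    · exact fun s hs => gr s ⟨hs.1, hs.2.trans ht.2⟩
  rw [intervalIntegral.integral_const_mul, integral_exp, Real.exp_zero] at n1
  have := key2 t ht
  have : 0 ≤ N t := by positivity
  linarith

end DampedWave

end WaveSystem

/-- The function equal to `f` up to time `s` and to `f'`, started at time `s`, afterwards. -/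
noncomputable def joinAt {E : Type*} (s : ℝ) (f f' : ℝ → E) : ℝ → E := fun t => if t ≤ s then f t else f' (t - s)

/-! ### Gluing two functions of time -/

section Join

variable {E : Type*} {s r t : ℝ} {f f' : ℝ → E}

theorem joinAt_of_le (h : t ≤ s) : joinAt s f f' t = f t := if_pos h

theorem joinAt_of_lt (h : s < t) : joinAt s f f' t = f' (t - s) := if_neg (not_le.2 h)

theorem joinAt_of_ge (h : s ≤ t) (h0 : f' 0 = f s) : joinAt s f f' t = f' (t - s) := by
  rcases h.eq_or_lt with rfl | h
  · rw [joinAt_of_le le_rfl, sub_self, h0]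
  · exact joinAt_of_lt h

variable [NormedAddCommGroup E]

theorem continuousOn_joinAt (hf : ContinuousOn f (Icc 0 s)) (hf' : ContinuousOn f' (Icc 0 r))
    (h0 : f' 0 = f s) : ContinuousOn (joinAt s f f') (Icc 0 (s + r)) := by
  have h1 : ContinuousOn (joinAt s f f') (Icc 0 s) := hf.congr fun t ht => joinAt_of_le ht.2
  have h2 : ContinuousOn (joinAt s f f') (Icc s (s + r)) :=
    (hf'.comp (f := fun t => t - s) (by fun_prop) fun t ht => ⟨by linarith [ht.1], by linarith [ht.2]⟩).congr
      fun t ht => joinAt_of_ge ht.1 h0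
  refine (h1.union_of_isClosed h2 isClosed_Icc isClosed_Icc).mono fun t ht => ?_
  rcases le_total t s with h | h
  · exact Or.inl ⟨ht.1, h⟩
  · exact Or.inr ⟨h, ht.2⟩

theorem memLp_joinAt (hs : 0 ≤ s) (hr : 0 ≤ r) (hf : MemLp f 2 (volume.restrict (Ioc 0 s)))
    (hf' : MemLp f' 2 (volume.restrict (Ioc 0 r))) :
    MemLp (joinAt s f f') 2 (volume.restrict (Ioc 0 (s + r))) := by
  have e : Ioc 0 (s + r) = Ioc 0 s ∪ Ioc s (s + r) := (Ioc_union_Ioc_eq_Ioc hs (by linarith)).symm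
  have m1 : MemLp (joinAt s f f') 2 (volume.restrict (Ioc 0 s)) := by
    refine (memLp_congr_ae ?_).1 hf
    exact (ae_restrict_iff' measurableSet_Ioc).2 (Eventually.of_forall fun t ht => (joinAt_of_le ht.2).symm)
  have m2 : MemLp (joinAt s f f') 2 (volume.restrict (Ioc s (s + r))) := by
    have mp : MeasurePreserving (fun t : ℝ => t - s) (volume.restrict (Ioc s (s + r))) (volume.restrict (Ioc 0 r)) := by
      have := (measurePreserving_sub_right volume s).restrict_preimage
        (s := Ioc 0 r) measurableSet_Ioc
      have e : (fun x => x - s) ⁻¹' Ioc 0 r = Ioc s (s + r) := by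
        ext t; constructor
        · intro ht; exact ⟨by linarith [ht.1], by linarith [ht.2]⟩
        · intro ht; exact ⟨by linarith [ht.1], by linarith [ht.2]⟩
      rwa [e] at this
    refine (memLp_congr_ae ?_).1 (hf'.comp_measurePreserving mp)
    exact (ae_restrict_iff' measurableSet_Ioc).2 (Eventually.of_forall fun t ht => (joinAt_of_lt ht.1).symm)
  have h1 : ∀ {A : Set ℝ}, MeasurableSet A → MemLp (joinAt s f f') 2 (volume.restrict A) →
      MemLp (A.indicator (joinAt s f f')) 2 (volume : Measure ℝ) := fun hA h => (memLp_indicator_iff_restrict hA).2 h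
  rw [← memLp_indicator_iff_restrict measurableSet_Ioc, e,
    indicator_union_of_disjoint (Ioc_disjoint_Ioc_of_le le_rfl)]
  exact (h1 measurableSet_Ioc m1).add (h1 measurableSet_Ioc m2)

variable [NormedSpace ℝ E]

theorem integral_joinAt_of_le (h0 : 0 ≤ t) (h : t ≤ s) :
    ∫ x in (0 : ℝ)..t, joinAt s f f' x = ∫ x in (0 : ℝ)..t, f x := by
  apply intervalIntegral.integral_congr
  intro x hx
  rw [uIcc_of_le h0] at hx
  exact joinAt_of_le (hx.2.trans h)

theorem integral_joinAt_of_ge (hs : 0 ≤ s) (h : s ≤ t) (htr : t ≤ s + r)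
    (hf : IntegrableOn f (Ioc 0 s)) (hf' : IntegrableOn f' (Ioc 0 r)) :
    ∫ x in (0 : ℝ)..t, joinAt s f f' x = (∫ x in (0 : ℝ)..s, f x) + ∫ x in (0 : ℝ)..t - s, f' x := by
  have c2 : ∀ x ∈ Ioc s t, f' (x - s) = joinAt s f f' x := fun x hx => (joinAt_of_lt hx.1).symm
  have i2 : IntervalIntegrable (joinAt s f f') volume s t := by
    have h1 : IntervalIntegrable f' volume 0 (t - s) :=
      intervalIntegrable_of_integrableOn_Ioc hf' ⟨le_rfl, by linarith⟩ ⟨by linarith, by linarith⟩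
    have h2 := h1.comp_sub_right s
    rw [zero_add, sub_add_cancel] at h2
    refine h2.congr ?_
    rw [uIoc_of_le h]
    exact fun x hx => c2 x hx
  have i1 : IntervalIntegrable (joinAt s f f') volume 0 s := by
    refine ((intervalIntegrable_iff_integrableOn_Ioc_of_le hs).2 hf).congr ?_
    rw [uIoc_of_le hs]
    exact fun x hx => (joinAt_of_le hx.2).symm
  rw [← intervalIntegral.integral_add_adjacent_intervals i1 i2, integral_joinAt_of_le hs le_rfl]
  congr 1
  have := intervalIntegral.integral_comp_sub_right (a := s) (b := t) f' s
  rw [sub_self] at this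
  rw [← this]
  apply intervalIntegral.integral_congr_ae
  refine Eventually.of_forall fun x hx => ?_
  rw [uIoc_of_le h] at hx
  exact (c2 x hx).symm

end Join

section Transfer

variable {E : Type*} {τ : ℝ} {f f' : ℝ → E}

theorem ae_eq_restrict_Ioc_of_eqOn_Icc (hf : ∀ t ∈ Icc 0 τ, f' t = f t) :
    f =ᵐ[volume.restrict (Ioc 0 τ)] f' :=
  (ae_restrict_iff' measurableSet_Ioc).2
    (Eventually.of_forall fun t ht => (hf t (Ioc_subset_Icc_self ht)).symm)

variable [NormedAddCommGroup E]

theorem integral_congr_of_eqOn_Icc [NormedSpace ℝ E] (hf : ∀ t ∈ Icc 0 τ, f' t = f t) {t : ℝ}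
    (ht : t ∈ Icc 0 τ) : ∫ x in (0 : ℝ)..t, f' x = ∫ x in (0 : ℝ)..t, f x :=
  intervalIntegral.integral_congr fun x hx => by
    rw [uIcc_of_le ht.1] at hx
    exact hf x ⟨hx.1, hx.2.trans ht.2⟩

end Transfer

/-! ### Restriction, difference and concatenation of solutions -/

namespace WaveSystem.DampedWave

variable {𝓗 : Type*} [NormedAddCommGroup 𝓗] [InnerProductSpace ℝ 𝓗]
variable {J : 𝓗 →L[ℝ] 𝓗} {e : 𝓗} {μ τ : ℝ} {G : ℝ → 𝓗} {h : ℝ → ℝ} {g k : ℝ → 𝓗} {b : ℝ → ℝ}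

theorem mono (S : DampedWave J e μ τ G h g k b) {τ' : ℝ} (hτ : τ' ≤ τ) :
    DampedWave J e μ τ' G h g k b where
  continuousOn_g := S.continuousOn_g.mono (Icc_subset_Icc_right hτ)
  continuousOn_k := S.continuousOn_k.mono (Icc_subset_Icc_right hτ)
  memLp_G := S.memLp_G.mono_measure (Measure.restrict_mono (Ioc_subset_Ioc_right hτ) le_rfl)
  memLp_h := S.memLp_h.mono_measure (Measure.restrict_mono (Ioc_subset_Ioc_right hτ) le_rfl)
  memLp_b := S.memLp_b.mono_measure (Measure.restrict_mono (Ioc_subset_Ioc_right hτ) le_rfl)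
  apply_g := fun t ht => S.apply_g t ⟨ht.1, ht.2.trans hτ⟩
  trace := fun t ht => S.trace t ⟨ht.1, ht.2.trans hτ⟩
  weak := fun φ t ht => S.weak φ t ⟨ht.1, ht.2.trans hτ⟩

theorem congr (S : DampedWave J e μ τ G h g k b) {G' : ℝ → 𝓗} {h' : ℝ → ℝ} {g' k' : ℝ → 𝓗}
    {b' : ℝ → ℝ} (hG : ∀ t ∈ Icc 0 τ, G' t = G t) (hh : ∀ t ∈ Icc 0 τ, h' t = h t)
    (hg : ∀ t ∈ Icc 0 τ, g' t = g t) (hk : ∀ t ∈ Icc 0 τ, k' t = k t)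
    (hb : ∀ t ∈ Icc 0 τ, b' t = b t) : DampedWave J e μ τ G' h' g' k' b' := by
  have m0 : ∀ {t}, t ∈ Icc 0 τ → (0 : ℝ) ∈ Icc 0 τ := fun ht => ⟨le_rfl, ht.1.trans ht.2⟩
  exact {
    continuousOn_g := S.continuousOn_g.congr hg
    continuousOn_k := S.continuousOn_k.congr hk
    memLp_G := (memLp_congr_ae (ae_eq_restrict_Ioc_of_eqOn_Icc hG)).1 S.memLp_G
    memLp_h := (memLp_congr_ae (ae_eq_restrict_Ioc_of_eqOn_Icc hh)).1 S.memLp_h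
    memLp_b := (memLp_congr_ae (ae_eq_restrict_Ioc_of_eqOn_Icc hb)).1 S.memLp_b
    apply_g := fun t ht => by rw [hg t ht, hg 0 (m0 ht), integral_congr_of_eqOn_Icc hk ht, S.apply_g t ht]
    trace := fun t ht => by rw [hg t ht, hg 0 (m0 ht), integral_congr_of_eqOn_Icc hb ht, S.trace t ht]
    weak := fun φ t ht => by
      rw [hg t ht, hg 0 (m0 ht), hk t ht, hk 0 (m0 ht), integral_congr_of_eqOn_Icc hg ht, integral_congr_of_eqOn_Icc hh ht, integral_congr_of_eqOn_Icc hG ht, S.weak φ t ht] }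

theorem sub (S : DampedWave J e μ τ G h g k b) {G' : ℝ → 𝓗} {h' : ℝ → ℝ} {g' k' : ℝ → 𝓗}
    {b' : ℝ → ℝ} (S' : DampedWave J e μ τ G' h' g' k' b') :
    DampedWave J e μ τ (fun t => G t - G' t) (fun t => h t - h' t) (fun t => g t - g' t)
      (fun t => k t - k' t) (fun t => b t - b' t) where
  continuousOn_g := S.continuousOn_g.sub S'.continuousOn_g
  continuousOn_k := S.continuousOn_k.sub S'.continuousOn_k
  memLp_G := S.memLp_G.sub S'.memLp_G
  memLp_h := S.memLp_h.sub S'.memLp_h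
  memLp_b := S.memLp_b.sub S'.memLp_b
  apply_g := fun t ht => by
    have m0 : (0 : ℝ) ∈ Icc 0 τ := ⟨le_rfl, ht.1.trans ht.2⟩
    rw [intervalIntegral.integral_sub (intervalIntegrable_of_integrableOn_Ioc S.integrableOn_k m0 ht)
      (intervalIntegrable_of_integrableOn_Ioc S'.integrableOn_k m0 ht), map_sub, map_sub,
      S.apply_g t ht, S'.apply_g t ht]
    abel
  trace := fun t ht => by
    have m0 : (0 : ℝ) ∈ Icc 0 τ := ⟨le_rfl, ht.1.trans ht.2⟩
    rw [intervalIntegral.integral_sub (intervalIntegrable_of_integrableOn_Ioc S.integrableOn_b m0 ht)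
      (intervalIntegrable_of_integrableOn_Ioc S'.integrableOn_b m0 ht), inner_sub_right, inner_sub_right,
      S.trace t ht, S'.trace t ht]
    ring
  weak := fun φ t ht => by
    have m0 : (0 : ℝ) ∈ Icc 0 τ := ⟨le_rfl, ht.1.trans ht.2⟩
    rw [intervalIntegral.integral_sub (intervalIntegrable_of_integrableOn_Ioc S.integrableOn_g m0 ht)
      (intervalIntegrable_of_integrableOn_Ioc S'.integrableOn_g m0 ht),
      intervalIntegral.integral_sub (intervalIntegrable_of_integrableOn_Ioc S.integrableOn_h m0 ht)
      (intervalIntegrable_of_integrableOn_Ioc S'.integrableOn_h m0 ht),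
      intervalIntegral.integral_sub (intervalIntegrable_of_integrableOn_Ioc S.integrableOn_G m0 ht)
      (intervalIntegrable_of_integrableOn_Ioc S'.integrableOn_G m0 ht)]
    simp only [inner_sub_right]
    linear_combination S.weak φ t ht - S'.weak φ t ht

/-- In integrated form the equations on the two intervals simply add up; the values of `g` and `k`
at the junction cancel. This is what makes the integrated form convenient for gluing. -/
theorem concat [CompleteSpace 𝓗] {s r : ℝ} (hs : 0 ≤ s) (hr : 0 ≤ r) (S : DampedWave J e μ s G h g k b)
    {G' : ℝ → 𝓗} {h' : ℝ → ℝ} {g' k' : ℝ → 𝓗} {b' : ℝ → ℝ}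
    (S' : DampedWave J e μ r G' h' g' k' b') (hg : g' 0 = g s) (hk : k' 0 = k s) :
    DampedWave J e μ (s + r) (joinAt s G G') (joinAt s h h') (joinAt s g g') (joinAt s k k')
      (joinAt s b b') where
  continuousOn_g := continuousOn_joinAt S.continuousOn_g S'.continuousOn_g hg
  continuousOn_k := continuousOn_joinAt S.continuousOn_k S'.continuousOn_k hk
  memLp_G := memLp_joinAt hs hr S.memLp_G S'.memLp_G
  memLp_h := memLp_joinAt hs hr S.memLp_h S'.memLp_h
  memLp_b := memLp_joinAt hs hr S.memLp_b S'.memLp_b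
  apply_g := fun t ht => by
    rw [joinAt_of_le hs]
    rcases le_total t s with h | h
    · rw [joinAt_of_le h, integral_joinAt_of_le ht.1 h, S.apply_g t ⟨ht.1, h⟩]
    · rw [joinAt_of_ge h hg, integral_joinAt_of_ge hs h ht.2 S.integrableOn_k S'.integrableOn_k,
        S'.apply_g (t - s) ⟨by linarith, by linarith [ht.2]⟩, hg, S.apply_g s ⟨hs, le_rfl⟩, add_assoc]
  trace := fun t ht => by
    rw [joinAt_of_le hs]
    rcases le_total t s with h | h
    · rw [joinAt_of_le h, integral_joinAt_of_le ht.1 h, S.trace t ⟨ht.1, h⟩]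
    · rw [joinAt_of_ge h hg, integral_joinAt_of_ge hs h ht.2 S.integrableOn_b S'.integrableOn_b,
        S'.trace (t - s) ⟨by linarith, by linarith [ht.2]⟩, hg, S.trace s ⟨hs, le_rfl⟩, add_assoc]
  weak := fun φ t ht => by
    rw [joinAt_of_le hs, joinAt_of_le hs]
    rcases le_total t s with h | h
    · rw [joinAt_of_le h, joinAt_of_le h, integral_joinAt_of_le ht.1 h, integral_joinAt_of_le ht.1 h,
        integral_joinAt_of_le ht.1 h, S.weak φ t ⟨ht.1, h⟩]
    · rw [joinAt_of_ge h hg, joinAt_of_ge h hk,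
        integral_joinAt_of_ge hs h ht.2 S.integrableOn_g S'.integrableOn_g,
        integral_joinAt_of_ge hs h ht.2 S.integrableOn_h S'.integrableOn_h,
        integral_joinAt_of_ge hs h ht.2 S.integrableOn_G S'.integrableOn_G]
      have h1 := S'.weak φ (t - s) ⟨by linarith, by linarith [ht.2]⟩
      have h2 := S.weak φ s ⟨hs, le_rfl⟩
      rw [hg, hk] at h1
      simp only [inner_add_right]
      linear_combination h1 + h2

end WaveSystem.DampedWave

/-! ### The linear problem with continuous sources -/

namespace WaveSystem

variable {𝓗 : Type*} [NormedAddCommGroup 𝓗] [InnerProductSpace ℝ 𝓗]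
variable {J : 𝓗 →L[ℝ] 𝓗} {e : 𝓗} {μ τ : ℝ} {G : ℝ → 𝓗} {h : ℝ → ℝ} {g k : ℝ → 𝓗} {b : ℝ → ℝ}

/-- The constant in the stability estimate for zero initial values. -/
noncomputable def stabConst (μ τ : ℝ) : ℝ := √(τ * (μ⁻¹ + 1) ^ 2 * Real.exp τ)

theorem stabConst_nonneg (μ τ : ℝ) : 0 ≤ stabConst μ τ := Real.sqrt_nonneg _

theorem tendsto_stabConst (μ : ℝ) : Tendsto (stabConst μ) (𝓝 0) (𝓝 0) := by
  have : Continuous (stabConst μ) := by unfold stabConst; fun_prop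
  simpa [stabConst] using this.tendsto 0

namespace DampedWave

/-- With zero initial values only the source integral, at most `τ (μ⁻¹ + 1) ε²`, survives in the
stability estimate. The bound for `∫ b²` costs a further factor `μ⁻¹`; the square `(μ⁻¹ + 1)²` in
`stabConst` covers both bounds. The constant tends to zero with `τ`, which later gives a
contraction. -/
theorem norm_le_of_source_le [CompleteSpace 𝓗] (S : DampedWave J e μ τ G h g k b) (hμ : 0 < μ) (hτ : 0 < τ)
    (hg0 : g 0 = 0) (hk0 : k 0 = 0) {ε : ℝ} (hε : 0 ≤ ε) (hG : ∀ t ∈ Icc 0 τ, ‖G t‖ ≤ ε)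
    (hh : ∀ t ∈ Icc 0 τ, |h t| ≤ ε) :
    (∀ t ∈ Icc 0 τ, ‖g t‖ ≤ stabConst μ τ * ε ∧ ‖k t‖ ≤ stabConst μ τ * ε) ∧
      ∫ s in (0 : ℝ)..τ, b s ^ 2 ≤ (stabConst μ τ * ε) ^ 2 := by
  have m0 : (0 : ℝ) ∈ Icc 0 τ := ⟨le_rfl, hτ.le⟩
  have mτ : τ ∈ Icc 0 τ := ⟨hτ.le, le_rfl⟩
  have D : ∫ s in (0 : ℝ)..τ, (μ⁻¹ * h s ^ 2 + ‖G s‖ ^ 2) ≤ τ * ((μ⁻¹ + 1) * ε ^ 2) := by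
    have i1 : IntervalIntegrable (fun s => μ⁻¹ * h s ^ 2 + ‖G s‖ ^ 2) volume 0 τ := by
      refine IntervalIntegrable.add (IntervalIntegrable.const_mul ?_ _) (intervalIntegrable_sq_of_memLp_Ioc S.memLp_G m0 mτ)
      simpa using intervalIntegrable_sq_of_memLp_Ioc S.memLp_h m0 mτ
    calc _ ≤ ∫ s in (0 : ℝ)..τ, (μ⁻¹ + 1) * ε ^ 2 := by
          apply intervalIntegral.integral_mono_on hτ.le i1 (by simp)
          intro s hs
          have h1 : h s ^ 2 ≤ ε ^ 2 := sq_le_sq' (abs_le.1 (hh s hs)).1 (abs_le.1 (hh s hs)).2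
          have h2 : ‖G s‖ ^ 2 ≤ ε ^ 2 := by have := hG s hs; gcongr
          have h3 : μ⁻¹ * h s ^ 2 ≤ μ⁻¹ * ε ^ 2 := by gcongr
          linarith
      _ = _ := by simp; ring
  have hc2 : stabConst μ τ ^ 2 = τ * (μ⁻¹ + 1) ^ 2 * Real.exp τ := Real.sq_sqrt (by positivity)
  have hμi : 0 < μ⁻¹ := inv_pos.2 hμ
  have bd : ∀ t ∈ Icc 0 τ, (‖k 0‖ ^ 2 + ‖g 0‖ ^ 2
      + ∫ s in (0 : ℝ)..τ, (μ⁻¹ * h s ^ 2 + ‖G s‖ ^ 2)) * Real.exp t ≤ τ * ((μ⁻¹ + 1) * ε ^ 2) * Real.exp τ := by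
    intro t ht
    rw [hg0, hk0, norm_zero]
    have := Real.exp_le_exp.2 ht.2
    have h0 : 0 ≤ ∫ s in (0 : ℝ)..τ, (μ⁻¹ * h s ^ 2 + ‖G s‖ ^ 2) :=
      intervalIntegral.integral_nonneg hτ.le fun s _ => by positivity
    simp only [ne_eq, OfNat.ofNat_ne_zero, not_false_eq_true, zero_pow, add_zero, zero_add]
    gcongr
  have q1 : τ * ((μ⁻¹ + 1) * ε ^ 2) * Real.exp τ ≤ (stabConst μ τ * ε) ^ 2 := by
    rw [mul_pow, hc2]
    have : (μ⁻¹ + 1) * (τ * ε ^ 2 * Real.exp τ) ≤ (μ⁻¹ + 1) ^ 2 * (τ * ε ^ 2 * Real.exp τ) := by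
      gcongr
      nlinarith
    linarith
  have q2 : μ⁻¹ * (τ * ((μ⁻¹ + 1) * ε ^ 2) * Real.exp τ) ≤ (stabConst μ τ * ε) ^ 2 := by
    rw [mul_pow, hc2]
    have : (μ⁻¹ * (μ⁻¹ + 1)) * (τ * ε ^ 2 * Real.exp τ) ≤ (μ⁻¹ + 1) ^ 2 * (τ * ε ^ 2 * Real.exp τ) := by
      gcongr
      nlinarith
    linarith
  have hcε : 0 ≤ stabConst μ τ * ε := mul_nonneg (stabConst_nonneg _ _) hε
  refine ⟨fun t ht => ?_, ?_⟩
  · have h1 := ((S.stability hμ hτ ht).1.trans (bd t ht)).trans q1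
    exact ⟨abs_le_of_sq_le_sq' (by nlinarith [sq_nonneg ‖k t‖]) hcε |>.2,
      abs_le_of_sq_le_sq' (by nlinarith [sq_nonneg ‖g t‖]) hcε |>.2⟩
  · have h1 := (S.stability hμ hτ mτ).2.trans (bd τ mτ)
    refine le_trans ?_ q2
    rw [inv_mul_eq_div, le_div_iff₀ hμ]
    linarith

end DampedWave

theorem tendsto_integral_of_forall_le {E : Type*} [NormedAddCommGroup E] [NormedSpace ℝ E] {F : ℕ → ℝ → E}
    {f : ℝ → E} {a : ℕ → ℝ} {t : ℝ} (ht : 0 ≤ t) (ha : Tendsto a atTop (𝓝 0))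
    (hF : ∀ n, IntervalIntegrable (F n) volume 0 t) (hf : IntervalIntegrable f volume 0 t)
    (hb : ∀ n, ∀ s ∈ Icc 0 t, ‖F n s - f s‖ ≤ a n) :
    Tendsto (fun n => ∫ s in (0 : ℝ)..t, F n s) atTop (𝓝 (∫ s in (0 : ℝ)..t, f s)) := by
  rw [tendsto_iff_norm_sub_tendsto_zero]
  have h1 : ∀ n, ‖(∫ s in (0 : ℝ)..t, F n s) - ∫ s in (0 : ℝ)..t, f s‖ ≤ a n * |t - 0| := by
    intro n
    rw [← intervalIntegral.integral_sub (hF n) hf]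
    apply intervalIntegral.norm_integral_le_of_norm_le_const
    intro s hs
    rw [uIoc_of_le ht] at hs
    exact hb n s ⟨hs.1.le, hs.2⟩
  exact squeeze_zero (fun _ => norm_nonneg _) h1 (by simpa using ha.mul_const |t - 0|)

theorem norm_toLp_sq_Ioc {f : ℝ → ℝ} (hτ : 0 ≤ τ) (hf : MemLp f 2 (volume.restrict (Ioc 0 τ))) :
    ‖hf.toLp f‖ ^ 2 = ∫ s in (0 : ℝ)..τ, f s ^ 2 := by
  rw [← real_inner_self_eq_norm_sq, L2.inner_def, intervalIntegral.integral_of_le hτ]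
  apply integral_congr_ae
  filter_upwards [hf.coeFn_toLp] with x hx
  rw [hx]
  simp [sq]

theorem exists_limit_of_forall_norm_sub_le {E : Type*} [NormedAddCommGroup E] [CompleteSpace E]
    {w : ℕ → E} {C : ℝ} {a : ℕ → ℝ} (ha : Tendsto a atTop (𝓝 0))
    (hw : ∀ m n, ‖w m - w n‖ ≤ C * (a m + a n)) :
    ∃ l, Tendsto w atTop (𝓝 l) ∧ ∀ n, ‖w n - l‖ ≤ C * a n := by
  have lim2 : Tendsto (fun p : ℕ × ℕ => C * (a p.1 + a p.2)) atTop (𝓝 0) := by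
    have h1 : Tendsto (fun p : ℕ × ℕ => a p.1) atTop (𝓝 0) := ha.comp (by rw [← prod_atTop_atTop_eq]; exact tendsto_fst)
    have h2 : Tendsto (fun p : ℕ × ℕ => a p.2) atTop (𝓝 0) := ha.comp (by rw [← prod_atTop_atTop_eq]; exact tendsto_snd)
    simpa using (h1.add h2).const_mul C
  have hc : CauchySeq w := by
    rw [Metric.cauchySeq_iff']
    intro ε hε
    have := (lim2.eventually_lt_const hε)
    rw [eventually_atTop] at this
    obtain ⟨⟨N1, N2⟩, hN⟩ := this
    refine ⟨max N1 N2, fun n hn => ?_⟩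
    rw [dist_eq_norm]
    exact (hw _ _).trans_lt (hN (n, max N1 N2) ⟨(le_max_left _ _).trans hn, le_max_right _ _⟩)
  obtain ⟨l, hl⟩ := cauchySeq_tendsto_of_complete hc
  refine ⟨l, hl, fun n => ?_⟩
  refine le_of_tendsto_of_tendsto ((tendsto_const_nhds.sub hl).norm) (b := atTop)
    (g := fun m => C * (a n + a m)) ?_ (Eventually.of_forall fun m => hw n m)
  simpa using (tendsto_const_nhds.add ha).const_mul C

/-- Solvability is stable under uniform convergence of the sources. -/
theorem exists_dampedWave_of_tendsto [CompleteSpace 𝓗] (hμ : 0 < μ) (hτ : 0 < τ) {g₀ k₀ : 𝓗}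
    (hG : ContinuousOn G (Icc 0 τ)) (hh : ContinuousOn h (Icc 0 τ)) {a : ℕ → ℝ}
    (ha : Tendsto a atTop (𝓝 0)) (ha0 : ∀ n, 0 ≤ a n)
    (H : ∀ n, ∃ Gn hn gn kn bn, DampedWave J e μ τ Gn hn gn kn bn ∧ gn 0 = g₀ ∧ kn 0 = k₀ ∧
      ∀ t ∈ Icc 0 τ, ‖Gn t - G t‖ ≤ a n ∧ |hn t - h t| ≤ a n) :
    ∃ g k b, DampedWave J e μ τ G h g k b ∧ g 0 = g₀ ∧ k 0 = k₀ := by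
  choose Gn hn gn kn bn S hg0 hk0 hGh using H
  have m0 : (0 : ℝ) ∈ Icc 0 τ := ⟨le_rfl, hτ.le⟩
  have mτ : τ ∈ Icc 0 τ := ⟨hτ.le, le_rfl⟩
  set C := stabConst μ τ with hC
  have hC0 : 0 ≤ C := stabConst_nonneg _ _
  -- Two approximate solutions share their initial values, so their difference is controlled by the
  -- difference of the sources alone.
  have diff : ∀ m n, (∀ t ∈ Icc 0 τ, ‖gn m t - gn n t‖ ≤ C * (a m + a n) ∧ ‖kn m t - kn n t‖ ≤ C * (a m + a n)) ∧
      ∫ s in (0 : ℝ)..τ, (bn m s - bn n s) ^ 2 ≤ (C * (a m + a n)) ^ 2 := by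
    intro m n
    refine ((S m).sub (S n)).norm_le_of_source_le hμ hτ (by simp [hg0]) (by simp [hk0]) (add_nonneg (ha0 m) (ha0 n)) ?_ ?_
    · intro t ht
      calc ‖Gn m t - Gn n t‖ = ‖(Gn m t - G t) - (Gn n t - G t)‖ := by congr 1; abel
        _ ≤ _ := (norm_sub_le _ _).trans (add_le_add (hGh m t ht).1 (hGh n t ht).1)
    · intro t ht
      calc |hn m t - hn n t| = |(hn m t - h t) - (hn n t - h t)| := by congr 1; ring
        _ ≤ _ := (abs_sub _ _).trans (add_le_add (hGh m t ht).2 (hGh n t ht).2)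
  have hgl : ∀ t, ∃ l, t ∈ Icc 0 τ → Tendsto (fun n => gn n t) atTop (𝓝 l) ∧ ∀ n, ‖gn n t - l‖ ≤ C * a n := by
    intro t
    by_cases ht : t ∈ Icc 0 τ
    · obtain ⟨l, hl⟩ := exists_limit_of_forall_norm_sub_le (w := fun n => gn n t) ha fun m n => ((diff m n).1 t ht).1
      exact ⟨l, fun _ => hl⟩
    · exact ⟨0, fun h => absurd h ht⟩
  have hkl : ∀ t, ∃ l, t ∈ Icc 0 τ → Tendsto (fun n => kn n t) atTop (𝓝 l) ∧ ∀ n, ‖kn n t - l‖ ≤ C * a n := by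
    intro t
    by_cases ht : t ∈ Icc 0 τ
    · obtain ⟨l, hl⟩ := exists_limit_of_forall_norm_sub_le (w := fun n => kn n t) ha fun m n => ((diff m n).1 t ht).2
      exact ⟨l, fun _ => hl⟩
    · exact ⟨0, fun h => absurd h ht⟩
  choose g hg using hgl
  choose k hk using hkl
  have hCa : Tendsto (fun n => C * a n) atTop (𝓝 0) := by simpa using ha.const_mul C
  have unif : ∀ {F : ℕ → ℝ → 𝓗} {f : ℝ → 𝓗}, (∀ n, ContinuousOn (F n) (Icc 0 τ)) →
      (∀ t ∈ Icc 0 τ, ∀ n, ‖F n t - f t‖ ≤ C * a n) → ContinuousOn f (Icc 0 τ) := by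
    intro F f hF hb
    refine TendstoUniformlyOn.continuousOn (F := F) (p := atTop) ?_ (Frequently.of_forall hF)
    rw [Metric.tendstoUniformlyOn_iff]
    intro ε hε
    filter_upwards [hCa.eventually_lt_const hε] with n hn t ht
    rw [dist_comm, dist_eq_norm]
    exact (hb t ht n).trans_lt hn
  have cg : ContinuousOn g (Icc 0 τ) := unif (fun n => (S n).continuousOn_g) fun t ht => (hg t ht).2
  have ck : ContinuousOn k (Icc 0 τ) := unif (fun n => (S n).continuousOn_k) fun t ht => (hk t ht).2
  -- For the trace derivatives there is no pointwise bound; they are Cauchy in `L²(0,τ)` only, which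
  -- is enough for their primitives to converge.
  obtain ⟨B, -, hB⟩ : ∃ B : Lp ℝ 2 (volume.restrict (Ioc 0 τ)), Tendsto (fun n => (S n).memLp_b.toLp (bn n)) atTop (𝓝 B) ∧
      ∀ n, ‖(S n).memLp_b.toLp (bn n) - B‖ ≤ C * a n := by
    have hw : ∀ m n, ‖(S m).memLp_b.toLp (bn m) - (S n).memLp_b.toLp (bn n)‖ ≤ C * (a m + a n) := by
      intro m n
      rw [← MemLp.toLp_sub]
      refine abs_le_of_sq_le_sq' ?_ (mul_nonneg hC0 (add_nonneg (ha0 m) (ha0 n))) |>.2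
      rw [norm_toLp_sq_Ioc hτ.le]
      exact (diff m n).2
    exact exists_limit_of_forall_norm_sub_le ha hw
  have hBm : MemLp B 2 (volume.restrict (Ioc 0 τ)) := Lp.memLp B
  have bsq : ∀ n, ∫ s in (0 : ℝ)..τ, (bn n s - B s) ^ 2 ≤ (C * a n) ^ 2 := by
    intro n
    have h1 := norm_toLp_sq_Ioc hτ.le ((S n).memLp_b.sub hBm)
    rw [(S n).memLp_b.toLp_sub hBm, Lp.toLp_coeFn] at h1
    simp only [Pi.sub_apply] at h1
    rw [← h1]
    have := hB n
    gcongr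
  have blim : ∀ t ∈ Icc 0 τ, Tendsto (fun n => ∫ s in (0 : ℝ)..t, bn n s) atTop (𝓝 (∫ s in (0 : ℝ)..t, B s)) := by
    intro t ht
    rw [tendsto_iff_norm_sub_tendsto_zero]
    have h1 : ∀ n, ‖(∫ s in (0 : ℝ)..t, bn n s) - ∫ s in (0 : ℝ)..t, B s‖ ≤ √τ * (C * a n) := by
      intro n
      have hd := (S n).memLp_b.sub hBm
      have h2 := norm_intervalIntegral_sq_le ht.1 (intervalIntegrable_of_memLp_Ioc hd m0 ht)
        (intervalIntegrable_sq_of_memLp_Ioc hd m0 ht)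
      simp only [Pi.sub_apply, Real.norm_eq_abs, sq_abs] at h2
      rw [← intervalIntegral.integral_sub (intervalIntegrable_of_memLp_Ioc (S n).memLp_b m0 ht)
        (intervalIntegrable_of_memLp_Ioc hBm m0 ht), Real.norm_eq_abs]
      apply abs_le_of_sq_le_sq
      · rw [mul_pow, Real.sq_sqrt hτ.le]
        refine h2.trans ?_
        rw [sub_zero]
        have h3 : ∫ s in (0 : ℝ)..t, (bn n s - B s) ^ 2 ≤ ∫ s in (0 : ℝ)..τ, (bn n s - B s) ^ 2 := by
          apply intervalIntegral.integral_mono_interval le_rfl ht.1 ht.2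
          · exact Eventually.of_forall fun s => sq_nonneg _
          · simpa using intervalIntegrable_sq_of_memLp_Ioc hd m0 mτ
        have h4 : 0 ≤ ∫ s in (0 : ℝ)..t, (bn n s - B s) ^ 2 :=
          intervalIntegral.integral_nonneg ht.1 fun s _ => sq_nonneg _
        exact mul_le_mul ht.2 (h3.trans (bsq n)) h4 hτ.le
      · exact mul_nonneg (Real.sqrt_nonneg _) (mul_nonneg hC0 (ha0 n))
    exact squeeze_zero (fun _ => norm_nonneg _) h1 (by simpa using hCa.const_mul √τ)
  have glim : ∀ t ∈ Icc 0 τ, Tendsto (fun n => ∫ s in (0 : ℝ)..t, gn n s) atTop (𝓝 (∫ s in (0 : ℝ)..t, g s)) := fun t ht =>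
    tendsto_integral_of_forall_le ht.1 hCa (fun n => intervalIntegrable_of_integrableOn_Ioc (S n).integrableOn_g m0 ht)
      (intervalIntegrable_of_integrableOn_Ioc (integrableOn_Ioc_of_continuousOn_Icc cg) m0 ht)
      fun n s hs => (hg s ⟨hs.1, hs.2.trans ht.2⟩).2 n
  have klim : ∀ t ∈ Icc 0 τ, Tendsto (fun n => ∫ s in (0 : ℝ)..t, kn n s) atTop (𝓝 (∫ s in (0 : ℝ)..t, k s)) := fun t ht =>
    tendsto_integral_of_forall_le ht.1 hCa (fun n => intervalIntegrable_of_integrableOn_Ioc (S n).integrableOn_k m0 ht)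
      (intervalIntegrable_of_integrableOn_Ioc (integrableOn_Ioc_of_continuousOn_Icc ck) m0 ht)
      fun n s hs => (hk s ⟨hs.1, hs.2.trans ht.2⟩).2 n
  have Glim : ∀ t ∈ Icc 0 τ, Tendsto (fun n => ∫ s in (0 : ℝ)..t, Gn n s) atTop (𝓝 (∫ s in (0 : ℝ)..t, G s)) := fun t ht =>
    tendsto_integral_of_forall_le ht.1 ha (fun n => intervalIntegrable_of_integrableOn_Ioc (S n).integrableOn_G m0 ht)
      (intervalIntegrable_of_integrableOn_Ioc (integrableOn_Ioc_of_continuousOn_Icc hG) m0 ht)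
      fun n s hs => (hGh n s ⟨hs.1, hs.2.trans ht.2⟩).1
  have hlim : ∀ t ∈ Icc 0 τ, Tendsto (fun n => ∫ s in (0 : ℝ)..t, hn n s) atTop (𝓝 (∫ s in (0 : ℝ)..t, h s)) := fun t ht =>
    tendsto_integral_of_forall_le ht.1 ha (fun n => intervalIntegrable_of_integrableOn_Ioc (S n).integrableOn_h m0 ht)
      (intervalIntegrable_of_integrableOn_Ioc (integrableOn_Ioc_of_continuousOn_Icc hh) m0 ht)
      fun n s hs => (hGh n s ⟨hs.1, hs.2.trans ht.2⟩).2
  refine ⟨g, k, B, ⟨cg, ck, memLp_two_of_continuousOn_Icc hG, memLp_two_of_continuousOn_Icc hh, hBm, ?_, ?_, ?_⟩, ?_, ?_⟩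
  · intro t ht
    refine tendsto_nhds_unique ((J.continuous.tendsto _).comp (hg t ht).1) ?_
    refine (((J.continuous.tendsto _).comp (hg 0 m0).1).add (klim t ht)).congr fun n => ?_
    exact ((S n).apply_g t ht).symm
  · intro t ht
    refine tendsto_nhds_unique (tendsto_const_nhds.inner (hg t ht).1) ?_
    refine ((tendsto_const_nhds.inner (hg 0 m0).1).add (blim t ht)).congr fun n => ?_
    exact ((S n).trace t ht).symm
  · intro φ t ht
    have c : ∀ x : 𝓗, Tendsto (fun _ : ℕ => x) atTop (𝓝 x) := fun x => tendsto_const_nhds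
    have A := (((c (J φ)).inner (hk t ht).1 (𝕜 := ℝ)).add ((c φ).inner (glim t ht) (𝕜 := ℝ))).add
      ((((c e).inner (hg t ht).1 (𝕜 := ℝ)).const_mul μ).mul_const (inner ℝ e φ))
    refine tendsto_nhds_unique A ?_
    have A' := ((((c (J φ)).inner (hk 0 m0).1 (𝕜 := ℝ)).add
      ((((c e).inner (hg 0 m0).1 (𝕜 := ℝ)).const_mul μ).mul_const (inner ℝ e φ))).add
      ((hlim t ht).mul_const (inner ℝ e φ))).add ((c (J φ)).inner (Glim t ht) (𝕜 := ℝ))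
    exact A'.congr fun n => ((S n).weak φ t ht).symm
  · exact tendsto_nhds_unique (hg 0 m0).1 (by simp [hg0])
  · exact tendsto_nhds_unique (hk 0 m0).1 (by simp [hk0])

/-- The homogeneous problem is solvable on `[0,1]` for all initial values. -/
def HomogeneousSolvable (J : 𝓗 →L[ℝ] 𝓗) (e : 𝓗) (μ : ℝ) : Prop :=
  ∀ g₀ k₀ : 𝓗, ∃ g k b, DampedWave J e μ 1 (fun _ => 0) (fun _ => 0) g k b ∧ g 0 = g₀ ∧ k 0 = k₀

/-- Constant sources are reduced to the homogeneous problem by subtracting the stationary solution. -/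
theorem HomogeneousSolvable.exists_of_const [CompleteSpace 𝓗] (H : HomogeneousSolvable J e μ) (hτ : τ ≤ 1) (g₀ k₀ G₀ : 𝓗)
    (h₀ : ℝ) : ∃ g k b, DampedWave J e μ τ (fun _ => G₀) (fun _ => h₀) g k b ∧ g 0 = g₀ ∧ k 0 = k₀ := by
  -- The stationary solution `g = z`, `k = 0`, `b = 0` for the constant sources.
  obtain ⟨z, hzφ⟩ : ∃ z : 𝓗, ∀ φ, inner ℝ φ z = h₀ * inner ℝ e φ + inner ℝ (J φ) G₀ :=
    ⟨h₀ • e + (ContinuousLinearMap.adjoint J) G₀, fun φ => by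
      rw [inner_add_right, inner_smul_right, ContinuousLinearMap.adjoint_inner_right, real_inner_comm]⟩
  obtain ⟨g, k, b, S1, hg0, hk0⟩ := H (g₀ - z) k₀
  have S := S1.mono hτ
  refine ⟨fun t => g t + z, k, b, ⟨S.continuousOn_g.add continuousOn_const, S.continuousOn_k,
    memLp_two_of_continuousOn_Icc continuousOn_const, memLp_two_of_continuousOn_Icc continuousOn_const, S.memLp_b, ?_, ?_, ?_⟩,
    by simp [hg0], hk0⟩
  · intro t ht
    rw [map_add, map_add, S.apply_g t ht]; abel
  · intro t ht
    rw [inner_add_right, inner_add_right, S.trace t ht]; ring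
  · intro φ t ht
    have m0 : (0 : ℝ) ∈ Icc 0 τ := ⟨le_rfl, ht.1.trans ht.2⟩
    have h1 := S.weak φ t ht
    rw [intervalIntegral.integral_add (intervalIntegrable_of_integrableOn_Ioc S.integrableOn_g m0 ht) (by simp)]
    simp only [intervalIntegral.integral_const, sub_zero, smul_zero, inner_zero_right, add_zero,
      inner_add_right, inner_smul_right, hzφ, smul_eq_mul] at h1 ⊢
    linear_combination h1

theorem DampedWave.trivial [CompleteSpace 𝓗] (g₀ k₀ : 𝓗) (G : ℝ → 𝓗) (h : ℝ → ℝ) :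
    DampedWave J e μ 0 G h (fun _ => g₀) (fun _ => k₀) (fun _ => 0) where
  continuousOn_g := continuousOn_const
  continuousOn_k := continuousOn_const
  memLp_G := by simp
  memLp_h := by simp
  memLp_b := by simp
  apply_g := fun t ht => by simp [le_antisymm ht.2 ht.1]
  trace := fun t ht => by simp
  weak := fun φ t ht => by simp [le_antisymm ht.2 ht.1]

/-- On each interval of length `η` the sources are frozen at the left end point, the problem with
constant sources is solved, and the pieces are concatenated. The oscillation of the sources over one
interval is the error. -/
theorem HomogeneousSolvable.exists_approx [CompleteSpace 𝓗] (H : HomogeneousSolvable J e μ) {η ε : ℝ} (hη : 0 < η) (hη1 : η ≤ 1)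
    (hε : 0 ≤ ε) (g₀ k₀ : 𝓗) (n : ℕ)
    (hosc : ∀ s ∈ Icc 0 (n * η), ∀ t ∈ Icc 0 (n * η), |s - t| ≤ η → ‖G s - G t‖ ≤ ε ∧ |h s - h t| ≤ ε) :
    ∃ G' h' g k b, DampedWave J e μ (n * η) G' h' g k b ∧ g 0 = g₀ ∧ k 0 = k₀ ∧
      ∀ t ∈ Icc 0 (n * η), ‖G' t - G t‖ ≤ ε ∧ |h' t - h t| ≤ ε := by
  induction n with
  | zero =>
    refine ⟨G, h, fun _ => g₀, fun _ => k₀, fun _ => 0, ?_, rfl, rfl, fun t _ => by simpa using hε⟩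
    simpa using DampedWave.trivial g₀ k₀ G h
  | succ n ih =>
    have hn : (0 : ℝ) ≤ n * η := by positivity
    have hle : (n : ℝ) * η ≤ (n + 1 : ℕ) * η := by push_cast; linarith
    obtain ⟨G', h', g, k, b, S, hg0, hk0, hb⟩ := ih fun s hs t ht hst =>
      hosc s ⟨hs.1, hs.2.trans hle⟩ t ⟨ht.1, ht.2.trans hle⟩ hst
    obtain ⟨g', k', b', S', hg', hk'⟩ := H.exists_of_const hη1 (g (n * η)) (k (n * η)) (G (n * η)) (h (n * η))
    have e1 : ((n + 1 : ℕ) : ℝ) * η = n * η + η := by push_cast; ring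
    rw [e1] at hosc ⊢
    refine ⟨_, _, _, _, _, S.concat hn hη.le S' hg' hk', ?_, ?_, ?_⟩
    · rw [joinAt_of_le hn, hg0]
    · rw [joinAt_of_le hn, hk0]
    · intro t ht
      rcases le_or_gt t (n * η) with h1 | h1
      · rw [joinAt_of_le h1, joinAt_of_le h1]
        exact hb t ⟨ht.1, h1⟩
      · rw [joinAt_of_lt h1, joinAt_of_lt h1]
        exact hosc _ ⟨hn, by linarith⟩ t ht (by rw [abs_le]; constructor <;> linarith [ht.2])

/-- The linear problem is solvable for continuous sources. -/
theorem HomogeneousSolvable.exists_of_continuousOn [CompleteSpace 𝓗] (H : HomogeneousSolvable J e μ) (hμ : 0 < μ) (hτ : 0 < τ)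
    (hG : ContinuousOn G (Icc 0 τ)) (hh : ContinuousOn h (Icc 0 τ)) (g₀ k₀ : 𝓗) :
    ∃ g k b, DampedWave J e μ τ G h g k b ∧ g 0 = g₀ ∧ k 0 = k₀ := by
  refine exists_dampedWave_of_tendsto (a := fun n : ℕ => 1 / ((n : ℝ) + 1)) hμ hτ hG hh
    tendsto_one_div_add_atTop_nhds_zero_nat (fun n => by positivity) fun m => ?_
  set ε : ℝ := 1 / ((m : ℝ) + 1) with hε
  have hεpos : 0 < ε := by positivity
  have uG := isCompact_Icc.uniformContinuousOn_of_continuous hG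
  have uh := isCompact_Icc.uniformContinuousOn_of_continuous hh
  rw [Metric.uniformContinuousOn_iff_le] at uG uh
  obtain ⟨δ1, hδ1, h1⟩ := uG ε hεpos
  obtain ⟨δ2, hδ2, h2⟩ := uh ε hεpos
  -- The step `τ / n` must be at most 1, where the homogeneous problem is solvable, and below both
  -- moduli of continuity.
  obtain ⟨n, hn⟩ := exists_nat_gt (τ / min 1 (min δ1 δ2))
  have hmin : 0 < min 1 (min δ1 δ2) := by positivity
  have hnpos : (0 : ℝ) < n := lt_of_le_of_lt (by positivity) hn
  have hη : τ / n < min 1 (min δ1 δ2) := by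
    rw [div_lt_iff₀ hmin] at hn
    rw [div_lt_iff₀ hnpos]; linarith
  have e1 : (n : ℝ) * (τ / n) = τ := by field_simp
  have := H.exists_approx (G := G) (h := h) (η := τ / n) (ε := ε) (by positivity) (hη.le.trans (min_le_left _ _)) hεpos.le g₀ k₀ n
  rw [e1] at this
  refine this fun s hs t ht hst => ?_
  rw [← dist_eq_norm, ← Real.dist_eq]
  rw [← Real.dist_eq] at hst
  exact ⟨h1 s hs t ht (hst.trans (hη.le.trans ((min_le_right _ _).trans (min_le_left _ _)))),
    h2 s hs t ht (hst.trans (hη.le.trans ((min_le_right _ _).trans (min_le_right _ _))))⟩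

end WaveSystem

/-! ### Coupled systems: uniqueness, and local existence for Lipschitz sources -/

namespace WaveSystem

variable {𝓗 : Type*} [NormedAddCommGroup 𝓗] [InnerProductSpace ℝ 𝓗]

/-- Solutions `x = ((g₁, k₁), (g₂, k₂))` of two damped wave equations, coupled by the sources
`Φ₁ x` and `Φ₂ x` (interior and boundary part). -/
structure CoupledWave (J : 𝓗 →L[ℝ] 𝓗) (e : 𝓗) (μ₁ μ₂ : ℝ)
    (Φ₁ Φ₂ : (𝓗 × 𝓗) × (𝓗 × 𝓗) → 𝓗 × ℝ) (τ : ℝ) (x : ℝ → (𝓗 × 𝓗) × (𝓗 × 𝓗)) (b₁ b₂ : ℝ → ℝ) :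
    Prop where
  fst : DampedWave J e μ₁ τ (fun t => (Φ₁ (x t)).1) (fun t => (Φ₁ (x t)).2) (fun t => (x t).1.1)
    (fun t => (x t).1.2) b₁
  snd : DampedWave J e μ₂ τ (fun t => (Φ₂ (x t)).1) (fun t => (Φ₂ (x t)).2) (fun t => (x t).2.1)
    (fun t => (x t).2.2) b₂

variable {J : 𝓗 →L[ℝ] 𝓗} {e : 𝓗} {μ₁ μ₂ τ : ℝ} {Φ₁ Φ₂ : (𝓗 × 𝓗) × (𝓗 × 𝓗) → 𝓗 × ℝ}
  {x : ℝ → (𝓗 × 𝓗) × (𝓗 × 𝓗)} {b₁ b₂ : ℝ → ℝ}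

namespace CoupledWave

theorem continuousOn (S : CoupledWave J e μ₁ μ₂ Φ₁ Φ₂ τ x b₁ b₂) : ContinuousOn x (Icc 0 τ) :=
  (S.fst.continuousOn_g.prodMk S.fst.continuousOn_k).prodMk (S.snd.continuousOn_g.prodMk S.snd.continuousOn_k)

theorem mono (S : CoupledWave J e μ₁ μ₂ Φ₁ Φ₂ τ x b₁ b₂) {τ' : ℝ} (h : τ' ≤ τ) :
    CoupledWave J e μ₁ μ₂ Φ₁ Φ₂ τ' x b₁ b₂ := ⟨S.fst.mono h, S.snd.mono h⟩

theorem congr_sources (S : CoupledWave J e μ₁ μ₂ Φ₁ Φ₂ τ x b₁ b₂) {Φ₁' Φ₂' : (𝓗 × 𝓗) × (𝓗 × 𝓗) → 𝓗 × ℝ}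
    (h₁ : ∀ t ∈ Icc 0 τ, Φ₁' (x t) = Φ₁ (x t)) (h₂ : ∀ t ∈ Icc 0 τ, Φ₂' (x t) = Φ₂ (x t)) :
    CoupledWave J e μ₁ μ₂ Φ₁' Φ₂' τ x b₁ b₂ where
  fst := S.fst.congr (fun t ht => by rw [h₁ t ht]) (fun t ht => by rw [h₁ t ht]) (fun _ _ => rfl)
    (fun _ _ => rfl) (fun _ _ => rfl)
  snd := S.snd.congr (fun t ht => by rw [h₂ t ht]) (fun t ht => by rw [h₂ t ht]) (fun _ _ => rfl)
    (fun _ _ => rfl) (fun _ _ => rfl)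

variable [CompleteSpace 𝓗]

theorem concat {s r : ℝ} (hs : 0 ≤ s) (hr : 0 ≤ r) (S : CoupledWave J e μ₁ μ₂ Φ₁ Φ₂ s x b₁ b₂)
    {x' : ℝ → (𝓗 × 𝓗) × (𝓗 × 𝓗)} {b₁' b₂' : ℝ → ℝ} (S' : CoupledWave J e μ₁ μ₂ Φ₁ Φ₂ r x' b₁' b₂')
    (h : x' 0 = x s) :
    CoupledWave J e μ₁ μ₂ Φ₁ Φ₂ (s + r) (joinAt s x x') (joinAt s b₁ b₁') (joinAt s b₂ b₂') := by
  refine ⟨(S.fst.concat hs hr S'.fst (by simp [h]) (by simp [h])).congr ?_ ?_ ?_ ?_ (fun _ _ => rfl),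
    (S.snd.concat hs hr S'.snd (by simp [h]) (by simp [h])).congr ?_ ?_ ?_ ?_ (fun _ _ => rfl)⟩
  all_goals
    intro t _
    unfold joinAt
    split_ifs <;> rfl

/-- The difference solves linear problems with zero initial values and sources of size at most `L ‖x
- x'‖`, so stability and Grönwall give zero. The Lipschitz bound is needed only along the two
trajectories, so that locally Lipschitz sources are covered. -/
theorem eqOn (hμ₁ : 0 < μ₁) (hμ₂ : 0 < μ₂) (S : CoupledWave J e μ₁ μ₂ Φ₁ Φ₂ τ x b₁ b₂)
    {x' : ℝ → (𝓗 × 𝓗) × (𝓗 × 𝓗)} {b₁' b₂' : ℝ → ℝ} (S' : CoupledWave J e μ₁ μ₂ Φ₁ Φ₂ τ x' b₁' b₂')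
    (h0 : x 0 = x' 0) {L : ℝ}
    (h₁ : ∀ t ∈ Icc 0 τ, ‖Φ₁ (x t) - Φ₁ (x' t)‖ ≤ L * ‖x t - x' t‖)
    (h₂ : ∀ t ∈ Icc 0 τ, ‖Φ₂ (x t) - Φ₂ (x' t)‖ ≤ L * ‖x t - x' t‖) :
    ∀ t ∈ Icc 0 τ, x t = x' t := by
  set N₁ : ℝ → ℝ := fun t => ‖(x t).1.2 - (x' t).1.2‖ ^ 2 + ‖(x t).1.1 - (x' t).1.1‖ ^ 2 with hN₁
  set N₂ : ℝ → ℝ := fun t => ‖(x t).2.2 - (x' t).2.2‖ ^ 2 + ‖(x t).2.1 - (x' t).2.1‖ ^ 2 with hN₂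
  set N : ℝ → ℝ := fun t => N₁ t + N₂ t with hN
  have c1 : ContinuousOn N₁ (Icc 0 τ) := (((S.fst.continuousOn_k.sub S'.fst.continuousOn_k).norm).pow 2).add
    (((S.fst.continuousOn_g.sub S'.fst.continuousOn_g).norm).pow 2)
  have c2 : ContinuousOn N₂ (Icc 0 τ) := (((S.snd.continuousOn_k.sub S'.snd.continuousOn_k).norm).pow 2).add
    (((S.snd.continuousOn_g.sub S'.snd.continuousOn_g).norm).pow 2)
  have hNc : ContinuousOn N (Icc 0 τ) := c1.add c2
  have hxN : ∀ t, ‖x t - x' t‖ ^ 2 ≤ N t := by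
    intro t
    have a1 : ‖x t - x' t‖ = max (max ‖(x t).1.1 - (x' t).1.1‖ ‖(x t).1.2 - (x' t).1.2‖)
      (max ‖(x t).2.1 - (x' t).2.1‖ ‖(x t).2.2 - (x' t).2.2‖) := rfl
    have q1 := sq_nonneg ‖(x t).1.1 - (x' t).1.1‖
    have q2 := sq_nonneg ‖(x t).1.2 - (x' t).1.2‖
    have q3 := sq_nonneg ‖(x t).2.1 - (x' t).2.1‖
    have q4 := sq_nonneg ‖(x t).2.2 - (x' t).2.2‖
    rw [a1]
    simp only [hN, hN₁, hN₂]
    rcases max_cases (max ‖(x t).1.1 - (x' t).1.1‖ ‖(x t).1.2 - (x' t).1.2‖)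
      (max ‖(x t).2.1 - (x' t).2.1‖ ‖(x t).2.2 - (x' t).2.2‖) with ⟨h, -⟩ | ⟨h, -⟩ <;> rw [h]
    · rcases max_cases ‖(x t).1.1 - (x' t).1.1‖ ‖(x t).1.2 - (x' t).1.2‖ with ⟨h, -⟩ | ⟨h, -⟩ <;> rw [h] <;> linarith
    · rcases max_cases ‖(x t).2.1 - (x' t).2.1‖ ‖(x t).2.2 - (x' t).2.2‖ with ⟨h, -⟩ | ⟨h, -⟩ <;> rw [h] <;> linarith
  have iN : ∀ t ∈ Icc 0 τ, IntervalIntegrable N volume 0 t := fun t ht =>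
    intervalIntegrable_of_integrableOn_Ioc (integrableOn_Ioc_of_continuousOn_Icc hNc) ⟨le_rfl, ht.1.trans ht.2⟩ ht
  have bound : ∀ {μ : ℝ} (_ : 0 < μ) {Φ : (𝓗 × 𝓗) × (𝓗 × 𝓗) → 𝓗 × ℝ}
      (_ : ∀ t ∈ Icc 0 τ, ‖Φ (x t) - Φ (x' t)‖ ≤ L * ‖x t - x' t‖) {g k : ℝ → 𝓗} {b : ℝ → ℝ} {t : ℝ} (_ : t ∈ Icc 0 τ)
      (_ : DampedWave J e μ τ (fun t => (Φ (x t)).1 - (Φ (x' t)).1) (fun t => (Φ (x t)).2 - (Φ (x' t)).2) g k b)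
      (_ : g 0 = 0) (_ : k 0 = 0), ‖k t‖ ^ 2 + ‖g t‖ ^ 2
        ≤ ((μ⁻¹ + 1) * L ^ 2 * Real.exp τ) * ∫ s in (0 : ℝ)..t, N s := by
    intro μ hμ Φ hΦ g k b t ht D hg hk
    rcases ht.1.eq_or_lt with rfl | hpos
    · simp [hg, hk]
    -- Stability is applied on `[0,t]` instead of `[0,τ]`, so that only the past of `t` enters, as
    -- Grönwall's inequality requires.
    have st := ((D.mono ht.2).stability hμ hpos ⟨hpos.le, le_rfl⟩).1
    have ie : IntervalIntegrable (fun s => μ⁻¹ * ((Φ (x s)).2 - (Φ (x' s)).2) ^ 2 + ‖(Φ (x s)).1 - (Φ (x' s)).1‖ ^ 2) volume 0 t := by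
      refine IntervalIntegrable.add (IntervalIntegrable.const_mul ?_ _)
        (intervalIntegrable_sq_of_memLp_Ioc D.memLp_G ⟨le_rfl, ht.1.trans ht.2⟩ ht)
      simpa using intervalIntegrable_sq_of_memLp_Ioc D.memLp_h ⟨le_rfl, ht.1.trans ht.2⟩ ht
    have le1 : ∫ s in (0 : ℝ)..t, (μ⁻¹ * ((Φ (x s)).2 - (Φ (x' s)).2) ^ 2 + ‖(Φ (x s)).1 - (Φ (x' s)).1‖ ^ 2)
        ≤ ∫ s in (0 : ℝ)..t, (μ⁻¹ + 1) * L ^ 2 * N s := by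
      apply intervalIntegral.integral_mono_on ht.1 ie ((iN t ht).const_mul _)
      intro s hs
      have hb := hΦ s ⟨hs.1, hs.2.trans ht.2⟩
      have p1 : ‖(Φ (x s)).1 - (Φ (x' s)).1‖ ≤ L * ‖x s - x' s‖ := (norm_fst_le _).trans hb
      have p2 : ‖(Φ (x s)).2 - (Φ (x' s)).2‖ ≤ L * ‖x s - x' s‖ := (norm_snd_le _).trans hb
      have p3 : (L * ‖x s - x' s‖) ^ 2 ≤ L ^ 2 * N s := by
        rw [mul_pow]; exact mul_le_mul_of_nonneg_left (hxN s) (sq_nonneg _)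
      have p4 : ‖(Φ (x s)).1 - (Φ (x' s)).1‖ ^ 2 ≤ L ^ 2 * N s := le_trans (by gcongr) p3
      have p5 : ((Φ (x s)).2 - (Φ (x' s)).2) ^ 2 ≤ L ^ 2 * N s := by
        rw [← sq_abs, ← Real.norm_eq_abs]; exact le_trans (by gcongr) p3
      have p6 : μ⁻¹ * ((Φ (x s)).2 - (Φ (x' s)).2) ^ 2 ≤ μ⁻¹ * (L ^ 2 * N s) := by gcongr
      linarith
    rw [intervalIntegral.integral_const_mul] at le1
    have nn : 0 ≤ ∫ s in (0 : ℝ)..t, N s := intervalIntegral.integral_nonneg ht.1 fun s _ => by positivity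
    simp only [hg, hk, norm_zero, ne_eq, OfNat.ofNat_ne_zero, not_false_eq_true, zero_pow, add_zero, zero_add] at st
    have hexp : Real.exp t ≤ Real.exp τ := Real.exp_le_exp.2 ht.2
    calc _ ≤ _ := st
      _ ≤ ((μ⁻¹ + 1) * L ^ 2 * ∫ s in (0 : ℝ)..t, N s) * Real.exp τ := by
          gcongr
      _ = _ := by ring
  set A := ((μ₁⁻¹ + 1) * L ^ 2 * Real.exp τ) + ((μ₂⁻¹ + 1) * L ^ 2 * Real.exp τ) with hA
  have gr := le_mul_exp_of_le_add_integral hNc (A := 0) (C := A) (by positivity) (fun t ht => by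
    have b1 := bound hμ₁ h₁ ht (S.fst.sub S'.fst) (by simp [h0]) (by simp [h0])
    have b2 := bound hμ₂ h₂ ht (S.snd.sub S'.snd) (by simp [h0]) (by simp [h0])
    simp only [hN, hN₁, hN₂] at b1 b2 ⊢
    rw [hA]
    linarith)
  intro t ht
  have h3 := gr t ht
  rw [zero_mul] at h3
  have h4 : ‖x t - x' t‖ ^ 2 ≤ 0 := (hxN t).trans h3
  have h5 : ‖x t - x' t‖ = 0 := by nlinarith [norm_nonneg (x t - x' t)]
  exact sub_eq_zero.1 (norm_eq_zero.1 h5)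

end CoupledWave

/-- Local solvability for globally Lipschitz sources, with a uniform existence time. -/
theorem exists_coupledWave [CompleteSpace 𝓗] (hμ₁ : 0 < μ₁) (hμ₂ : 0 < μ₂)
    (H₁ : HomogeneousSolvable J e μ₁) (H₂ : HomogeneousSolvable J e μ₂)
    {L : NNReal} (hΦ₁ : LipschitzWith L Φ₁) (hΦ₂ : LipschitzWith L Φ₂) :
    ∃ δ₀ > 0, ∀ δ, 0 < δ → δ ≤ δ₀ → ∀ x₀, ∃ x b₁ b₂, CoupledWave J e μ₁ μ₂ Φ₁ Φ₂ δ x b₁ b₂ ∧ x 0 = x₀ := by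
  -- The smallness of `δ` makes the solution map a contraction with factor `1/2`, independently of
  -- the initial state.
  have hs : ∀ μ, ∀ᶠ δ in 𝓝 (0 : ℝ), stabConst μ δ * L < 1 / 2 := fun μ => by
    have := (tendsto_stabConst μ).mul_const (L : ℝ)
    rw [zero_mul] at this
    exact this.eventually_lt_const (by norm_num)
  obtain ⟨δ₀, hδ₀, hball⟩ := Metric.eventually_nhds_iff.1 ((hs μ₁).and (hs μ₂))
  refine ⟨δ₀ / 2, by positivity, fun δ hδ hδle x₀ => ?_⟩
  obtain ⟨hc1, hc2⟩ := hball (y := δ) (by rw [Real.dist_eq, sub_zero, abs_of_pos hδ]; linarith)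
  let X := (𝓗 × 𝓗) × (𝓗 × 𝓗)
  let ext : C(Icc (0 : ℝ) δ, X) → ℝ → X := fun ξ => IccExtend hδ.le ξ
  have hext : ∀ ξ, Continuous (ext ξ) := fun ξ => ξ.continuous.Icc_extend'
  have sol₁ : ∀ ξ : C(Icc (0 : ℝ) δ, X), ∃ g k b, DampedWave J e μ₁ δ (fun t => (Φ₁ (ext ξ t)).1) (fun t => (Φ₁ (ext ξ t)).2) g k b ∧
      g 0 = x₀.1.1 ∧ k 0 = x₀.1.2 := fun ξ =>
    H₁.exists_of_continuousOn hμ₁ hδ (continuous_fst.comp (hΦ₁.continuous.comp (hext ξ))).continuousOn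
      (continuous_snd.comp (hΦ₁.continuous.comp (hext ξ))).continuousOn _ _
  have sol₂ : ∀ ξ : C(Icc (0 : ℝ) δ, X), ∃ g k b, DampedWave J e μ₂ δ (fun t => (Φ₂ (ext ξ t)).1) (fun t => (Φ₂ (ext ξ t)).2) g k b ∧
      g 0 = x₀.2.1 ∧ k 0 = x₀.2.2 := fun ξ =>
    H₂.exists_of_continuousOn hμ₂ hδ (continuous_fst.comp (hΦ₂.continuous.comp (hext ξ))).continuousOn
      (continuous_snd.comp (hΦ₂.continuous.comp (hext ξ))).continuousOn _ _
  choose g₁ k₁ b₁ S₁ hg₁ hk₁ using sol₁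
  choose g₂ k₂ b₂ S₂ hg₂ hk₂ using sol₂
  let y : C(Icc (0 : ℝ) δ, X) → ℝ → X := fun ξ t => ((g₁ ξ t, k₁ ξ t), (g₂ ξ t, k₂ ξ t))
  have hy : ∀ ξ, ContinuousOn (y ξ) (Icc 0 δ) := fun ξ =>
    ((S₁ ξ).continuousOn_g.prodMk (S₁ ξ).continuousOn_k).prodMk ((S₂ ξ).continuousOn_g.prodMk (S₂ ξ).continuousOn_k)
  -- `T ξ` solves the linear problem whose sources are evaluated along `ξ`; its fixed point is the
  -- solution sought.
  let T : C(Icc (0 : ℝ) δ, X) → C(Icc (0 : ℝ) δ, X) := fun ξ => ⟨fun t => y ξ t, (hy ξ).domRestrict⟩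
  have close : ∀ ξ ξ' t, ‖ext ξ t - ext ξ' t‖ ≤ dist ξ ξ' := fun ξ ξ' t => by
    rw [← dist_eq_norm]; exact ContinuousMap.dist_apply_le_dist _
  have src : ∀ {Φ : X → 𝓗 × ℝ}, LipschitzWith L Φ → ∀ ξ ξ' t, ‖Φ (ext ξ t) - Φ (ext ξ' t)‖ ≤ L * dist ξ ξ' := by
    intro Φ hΦ ξ ξ' t
    rw [← dist_eq_norm]
    refine (hΦ.dist_le_mul _ _).trans ?_
    have := close ξ ξ' t
    rw [← dist_eq_norm] at this
    gcongr
  have hT : ContractingWith (1 / 2 : NNReal) T := by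
    refine ⟨by rw [← NNReal.coe_lt_coe]; norm_num, LipschitzWith.of_dist_le_mul fun ξ ξ' => ?_⟩
    have hd : (0 : ℝ) ≤ L * dist ξ ξ' := by positivity
    have d1 := (((S₁ ξ).sub (S₁ ξ')).norm_le_of_source_le hμ₁ hδ (by simp [hg₁]) (by simp [hk₁]) hd
      (fun t _ => (norm_fst_le _).trans (src hΦ₁ ξ ξ' t)) (fun t _ => (norm_snd_le _).trans (src hΦ₁ ξ ξ' t))).1
    have d2 := (((S₂ ξ).sub (S₂ ξ')).norm_le_of_source_le hμ₂ hδ (by simp [hg₂]) (by simp [hk₂]) hd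
      (fun t _ => (norm_fst_le _).trans (src hΦ₂ ξ ξ' t)) (fun t _ => (norm_snd_le _).trans (src hΦ₂ ξ ξ' t))).1
    have q1 : stabConst μ₁ δ * (L * dist ξ ξ') ≤ (1 / 2 : ℝ) * dist ξ ξ' := by
      rw [← mul_assoc]; gcongr
    have q2 : stabConst μ₂ δ * (L * dist ξ ξ') ≤ (1 / 2 : ℝ) * dist ξ ξ' := by
      rw [← mul_assoc]; gcongr
    rw [ContinuousMap.dist_le (by positivity)]
    rintro ⟨t, ht⟩
    rw [dist_eq_norm]
    have r1 := d1 t ht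
    have r2 := d2 t ht
    push_cast
    exact max_le (max_le (r1.1.trans q1) (r1.2.trans q1)) (max_le (r2.1.trans q2) (r2.2.trans q2))
  set ξ := hT.fixedPoint T with hξ
  have hfix : T ξ = ξ := hT.fixedPoint_isFixedPt
  have hxy : ∀ t ∈ Icc 0 δ, y ξ t = ext ξ t := fun t ht => by
    show _ = IccExtend hδ.le ξ t
    rw [IccExtend_of_mem hδ.le _ ht]
    exact congrArg (fun ζ : C(Icc (0 : ℝ) δ, X) => ζ ⟨t, ht⟩) hfix
  refine ⟨y ξ, b₁ ξ, b₂ ξ, ⟨(S₁ ξ).congr ?_ ?_ (fun _ _ => rfl) (fun _ _ => rfl) (fun _ _ => rfl),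
    (S₂ ξ).congr ?_ ?_ (fun _ _ => rfl) (fun _ _ => rfl) (fun _ _ => rfl)⟩, ?_⟩
  · intro t ht; rw [hxy t ht]
  · intro t ht; rw [hxy t ht]
  · intro t ht; rw [hxy t ht]
  · intro t ht; rw [hxy t ht]
  · simp only [y, hg₁, hg₂, hk₁, hk₂]

end WaveSystem

/-! ### Primitives and the Volterra operator on `L²(0,1)` -/

namespace WaveSystem

instance isProbabilityMeasure_restrict_Ioo : IsProbabilityMeasure (volume.restrict (Ioo (0 : ℝ) 1)) :=
  ⟨by simp⟩

/-- The indicator function of `(0,x]` as an element of `L²(0,1)`. -/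
noncomputable def chi (x : ℝ) : L2 := indicatorConstLp 2 (s := Iic x) measurableSet_Iic (measure_ne_top _ _) 1

/-- The primitive of an `L²` function on `(0,1)` that vanishes at `0`. -/
noncomputable def prim (g : L2) (x : ℝ) : ℝ := inner ℝ (chi x) g

theorem integral_Ioo_eq_intervalIntegral (f : ℝ → ℝ) :
    ∫ x in Ioo (0 : ℝ) 1, f x = ∫ x in (0 : ℝ)..1, f x := by
  rw [intervalIntegral.integral_of_le zero_le_one, integral_Ioc_eq_integral_Ioo]

theorem L2.inner_eq (f g : L2) : inner ℝ f g = ∫ x in Ioo (0 : ℝ) 1, f x * g x := by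
  rw [MeasureTheory.L2.inner_def]
  simp [mul_comm]

theorem L2.inner_eq_of_ae {f g : L2} {f' g' : ℝ → ℝ} (hf : f =ᵐ[volume.restrict (Ioo (0 : ℝ) 1)] f')
    (hg : g =ᵐ[volume.restrict (Ioo (0 : ℝ) 1)] g') :
    inner ℝ f g = ∫ x in Ioo (0 : ℝ) 1, f' x * g' x := by
  rw [L2.inner_eq]
  apply integral_congr_ae
  filter_upwards [hf, hg] with x h1 h2
  rw [h1, h2]

theorem L2.integrableOn_Ioc (g : L2) : IntegrableOn g (Ioc 0 1) := by
  rw [integrableOn_Ioc_iff_integrableOn_Ioo]; exact L2.integrableOn g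

theorem L2.intervalIntegrable (g : L2) {a b : ℝ} (ha : a ∈ Icc (0 : ℝ) 1) (hb : b ∈ Icc (0 : ℝ) 1) :
    IntervalIntegrable g volume a b := intervalIntegrable_of_integrableOn_Ioc g.integrableOn_Ioc ha hb

theorem prim_eq (g : L2) {x : ℝ} (hx : x ∈ Icc (0 : ℝ) 1) : prim g x = ∫ y in (0 : ℝ)..x, g y := by
  rw [prim, chi, MeasureTheory.L2.inner_indicatorConstLp_one, Measure.restrict_restrict measurableSet_Iic,
    intervalIntegral.integral_of_le hx.1]
  apply setIntegral_congr_set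
  -- The measure lives on the open interval, so for `x = 1` the end point is missing; it is a null
  -- set.
  have h2 : (Ioc (0 : ℝ) x \ ({1} : Set ℝ) : Set ℝ) =ᵐ[volume] (Ioc 0 x : Set ℝ) := by
    refine sdiff_null_ae_eq_self ?_
    simp
  have h3 : Iic x ∩ Ioo 0 1 = Ioc (0 : ℝ) x \ {1} := by
    ext y
    simp only [mem_inter_iff, mem_Iic, mem_Ioo, Set.mem_sdiff, mem_Ioc, mem_singleton_iff]
    constructor
    · rintro ⟨h, h1, h2⟩; exact ⟨⟨h1, h⟩, h2.ne⟩
    · rintro ⟨⟨h1, h⟩, h2⟩; exact ⟨h, h1, lt_of_le_of_ne (h.trans hx.2) h2⟩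
  rw [h3]
  exact h2

theorem prim_zero (g : L2) : prim g 0 = 0 := by
  rw [prim_eq g ⟨le_rfl, zero_le_one⟩, intervalIntegral.integral_same]

theorem norm_chi_le (x : ℝ) : ‖chi x‖ ≤ 1 := by
  rw [chi, norm_indicatorConstLp (by simp) (by simp)]
  simp only [norm_one, one_mul]
  apply Real.rpow_le_one measureReal_nonneg measureReal_le_one (by simp)

theorem abs_prim_le (g : L2) (x : ℝ) : |prim g x| ≤ ‖g‖ :=
  (abs_real_inner_le_norm _ _).trans (mul_le_of_le_one_left (norm_nonneg _) (norm_chi_le x))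

theorem prim_add (g g' : L2) (x : ℝ) : prim (g + g') x = prim g x + prim g' x := inner_add_right _ _ _

theorem prim_sub (g g' : L2) (x : ℝ) : prim (g - g') x = prim g x - prim g' x := inner_sub_right _ _ _

theorem prim_smul (c : ℝ) (g : L2) (x : ℝ) : prim (c • g) x = c * prim g x := inner_smul_right _ _ _

theorem continuousOn_prim (g : L2) : ContinuousOn (prim g) (Icc 0 1) :=
  (continuousOn_primitive_of_memLp_Ioc g.integrableOn_Ioc).congr fun _ hx => prim_eq g hx

theorem memLp_restrict_Ioo_of_continuousOn {f : ℝ → ℝ} (hf : ContinuousOn f (Icc 0 1)) :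
    MemLp f 2 (volume.restrict (Ioo (0 : ℝ) 1)) := by
  have := memLp_two_of_continuousOn_Icc hf
  rwa [← restrict_Ioo_eq_restrict_Ioc] at this

theorem memLp_prim (g : L2) : MemLp (prim g) 2 (volume.restrict (Ioo (0 : ℝ) 1)) :=
  memLp_restrict_Ioo_of_continuousOn (continuousOn_prim g)

theorem L2.norm_le_of_ae {f : L2} {f' : ℝ → ℝ} {C : ℝ} (hf : f =ᵐ[volume.restrict (Ioo (0 : ℝ) 1)] f')
    (hC : 0 ≤ C) (h : ∀ x ∈ Ioo (0 : ℝ) 1, |f' x| ≤ C) : ‖f‖ ≤ C := by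
  have h1 : ∀ᵐ x ∂(volume.restrict (Ioo (0 : ℝ) 1)), ‖f x‖ ≤ C := by
    filter_upwards [hf, ae_restrict_mem measurableSet_Ioo] with x hx hm
    rw [hx]; exact h x hm
  have h2 := Lp.norm_le_of_ae_bound hC h1
  simpa [measureUnivNNReal] using h2

/-- The Volterra operator on `L²(0,1)`. -/
noncomputable def volterra : L2 →L[ℝ] L2 :=
  LinearMap.mkContinuous
    { toFun := fun g => (memLp_prim g).toLp (prim g)
      map_add' := fun g g' => by
        rw [← MemLp.toLp_add]
        congr 1; ext x; exact prim_add g g' x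
      map_smul' := fun c g => by
        rw [RingHom.id_apply, ← MemLp.toLp_const_smul]
        congr 1; ext x; exact prim_smul c g x } 1 fun g => by
    rw [one_mul]
    exact L2.norm_le_of_ae (MemLp.coeFn_toLp (memLp_prim g)) (norm_nonneg g) fun x _ => abs_prim_le g x

theorem volterra_ae (g : L2) : volterra g =ᵐ[volume.restrict (Ioo (0 : ℝ) 1)] prim g :=
  MemLp.coeFn_toLp (memLp_prim g)

theorem inner_volterra_right (φ g : L2) :
    inner ℝ φ (volterra g) = ∫ x in Ioo (0 : ℝ) 1, φ x * prim g x :=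
  L2.inner_eq_of_ae EventuallyEq.rfl (volterra_ae g)

/-- Integration by parts for primitives. -/
theorem inner_volterra_left (φ w : L2) :
    inner ℝ (volterra φ) w = prim φ 1 * prim w 1 - inner ℝ φ (volterra w) := by
  have m0 : (0 : ℝ) ∈ Icc (0 : ℝ) 1 := ⟨le_rfl, zero_le_one⟩
  have m1 : (1 : ℝ) ∈ Icc (0 : ℝ) 1 := ⟨zero_le_one, le_rfl⟩
  have ac : ∀ g : L2, AbsolutelyContinuousOnInterval (fun x => ∫ y in (0 : ℝ)..x, g y) 0 1 := fun g =>
    (g.intervalIntegrable m0 m1).absolutelyContinuousOnInterval_intervalIntegral (by simp)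
  have der : ∀ g : L2, ∀ᵐ x, x ∈ uIcc (0 : ℝ) 1 → deriv (fun x => ∫ y in (0 : ℝ)..x, g y) x = g x := by
    intro g
    filter_upwards [(g.intervalIntegrable m0 m1).ae_hasDerivAt_integral] with x hx h
    exact (hx h 0 (by simp)).deriv
  have ip := (ac φ).integral_deriv_mul_eq_sub (ac w)
  rw [← prim_eq φ m1, ← prim_eq w m1, intervalIntegral.integral_same, zero_mul, sub_zero] at ip
  rw [← ip, real_inner_comm, inner_volterra_right, inner_volterra_right, eq_sub_iff_add_eq,
    integral_Ioo_eq_intervalIntegral, integral_Ioo_eq_intervalIntegral,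
    ← intervalIntegral.integral_add]
  · apply intervalIntegral.integral_congr_ae
    filter_upwards [der φ, der w] with x h1 h2 hx
    have hx' := uIoc_subset_uIcc hx
    rw [h1 hx', h2 hx']
    rw [uIcc_of_le zero_le_one] at hx'
    rw [prim_eq φ hx', prim_eq w hx']
    ring
  all_goals
    rw [intervalIntegrable_iff_integrableOn_Ioo_of_le zero_le_one]
    exact MemLp.integrable_mul (Lp.memLp _) (memLp_prim _)

end WaveSystem

/-! ### Travelling waves and d'Alembert's formula -/

namespace WaveSystem

theorem measurePreserving_const_add_mul {σ : ℝ} (hσ : σ = 1 ∨ σ = -1) (t : ℝ) :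
    MeasurePreserving (fun x : ℝ => t + σ * x) volume volume := by
  rcases hσ with rfl | rfl
  · simpa using measurePreserving_add_left volume t
  · simpa [sub_eq_add_neg] using Measure.measurePreserving_sub_left volume t

/-- The travelling wave with profile `ψ`, restricted to `(0,1)`, is continuous in `L²`. -/
theorem exists_travelling {ψ : ℝ → ℝ} (hψ : MemLp ψ 2 volume) {σ : ℝ} (hσ : σ = 1 ∨ σ = -1) :
    ∃ w : ℝ → L2, Continuous w ∧
      ∀ t, w t =ᵐ[volume.restrict (Ioo (0 : ℝ) 1)] fun x => ψ (t + σ * x) := by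
  let F : ℝ → C(ℝ, ℝ) := fun t => ⟨fun x => t + σ * x, by fun_prop⟩
  have hF : Continuous F := ContinuousMap.continuous_of_continuous_uncurry _ (by
    show Continuous fun p : ℝ × ℝ => p.1 + σ * p.2
    fun_prop)
  have hmp : ∀ t, MeasurePreserving (F t) volume volume := fun t => measurePreserving_const_add_mul hσ t
  have hc : Continuous fun t => Lp.compMeasurePreserving (F t) (hmp t) (hψ.toLp ψ) :=
    Continuous.compMeasurePreservingLp continuous_const hF hmp (by simp)
  refine ⟨fun t => LpToLpRestrictCLM ℝ ℝ ℝ volume 2 (Ioo 0 1) (Lp.compMeasurePreserving (F t) (hmp t) (hψ.toLp ψ)),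
    (ContinuousLinearMap.continuous _).comp hc, fun t => ?_⟩
  refine (LpToLpRestrictCLM_coeFn ℝ _ _).trans (ae_restrict_of_ae ?_)
  rw [Lp.toLp_compMeasurePreserving]
  exact MemLp.coeFn_toLp _

/-- Fubini needs joint integrability of `φ(x) ψ(s + σx)`. The shear `(x, s) ↦ (x, s + σx)` preserves
the product measure, so it follows from that of `φ(x) ψ(s)`. -/
theorem integral_travelling_fubini {ψ : ℝ → ℝ} (hψ : Integrable ψ volume) (σ : ℝ)
    (φ : L2) (a t : ℝ) :
    ∫ s in a..t, ∫ x in Ioo (0 : ℝ) 1, φ x * ψ (s + σ * x)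
      = ∫ x in Ioo (0 : ℝ) 1, φ x * ∫ s in a..t, ψ (s + σ * x) := by
  have h1 : Integrable (fun p : ℝ × ℝ => φ p.1 * ψ p.2) ((volume.restrict (Ioo (0 : ℝ) 1)).prod volume) :=
    (L2.integrableOn φ).mul_prod hψ
  have mp : MeasurePreserving (fun p : ℝ × ℝ => (p.1, p.2 + σ * p.1))
      ((volume.restrict (Ioo (0 : ℝ) 1)).prod volume) ((volume.restrict (Ioo (0 : ℝ) 1)).prod volume) := by
    refine (MeasurePreserving.id _).skew_product (g := fun x s => s + σ * x) (by fun_prop)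
      (Eventually.of_forall fun x => (measurePreserving_add_right volume (σ * x)).map_eq)
  have h2 := mp.integrable_comp_of_integrable h1
  have h3 : Integrable (Function.uncurry fun (s x : ℝ) => φ x * ψ (s + σ * x))
      ((volume.restrict (uIoc a t)).prod (volume.restrict (Ioo (0 : ℝ) 1))) := by
    have := h2.swap
    refine this.mono_measure ?_
    exact Measure.prod_mono Measure.restrict_le_self le_rfl
  rw [MeasureTheory.intervalIntegral_integral_swap h3]
  simp_rw [intervalIntegral.integral_const_mul]

theorem integral_comp_add_mul {ψ : ℝ → ℝ} (hψ : Integrable ψ volume) {σ : ℝ} (hσ : σ = 1 ∨ σ = -1) (t x : ℝ) :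
    (∫ y in (0 : ℝ)..x, ψ (t + σ * y))
      = σ * ((∫ y in (0 : ℝ)..t + σ * x, ψ y) - ∫ y in (0 : ℝ)..t, ψ y) := by
  have hi : ∀ a b, IntervalIntegrable ψ volume a b := fun a b => hψ.intervalIntegrable
  rcases hσ with rfl | rfl
  · simp only [one_mul]
    rw [intervalIntegral.integral_comp_add_left, add_zero, intervalIntegral.integral_interval_sub_left (hi _ _) (hi _ _)]
  · simp only [neg_mul, one_mul, ← sub_eq_add_neg]
    rw [intervalIntegral.integral_comp_sub_left, sub_zero, intervalIntegral.integral_interval_sub_left (hi _ _) (hi _ _),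
      intervalIntegral.integral_symm]

theorem integral_comp_add_right_eq {ψ : ℝ → ℝ} (hψ : Integrable ψ volume) (t c : ℝ) :
    (∫ s in (0 : ℝ)..t, ψ (s + c)) = (∫ y in (0 : ℝ)..t + c, ψ y) - ∫ y in (0 : ℝ)..c, ψ y := by
  have hi : ∀ a b, IntervalIntegrable ψ volume a b := fun a b => hψ.intervalIntegrable
  rw [intervalIntegral.integral_comp_add_right, zero_add,
    intervalIntegral.integral_interval_sub_left (hi _ _) (hi _ _)]

/-- D'Alembert's formula: a profile `ψ` yields a solution of the wave equation on `(0,1)` in first order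
form; the boundary condition at `1` becomes a relation between the values `ψ(t+1)` and `ψ(t-1)`. -/
theorem exists_dalembert {ψ : ℝ → ℝ} (hψ : MemLp ψ 2 volume) (hψ1 : Integrable ψ volume) {μ : ℝ}
    (hrel : ∀ᵐ t, t ∈ Ioc (0 : ℝ) 1 → (1 + μ) * ψ (t + 1) + (1 - μ) * ψ (t - 1) = 0) :
    ∃ g k : ℝ → L2, DampedWave volterra (chi 1) μ 1 (fun _ => 0) (fun _ => 0) g k
        (fun t => ψ (t + 1) - ψ (t - 1)) ∧
      (∀ t, g t =ᵐ[volume.restrict (Ioo (0 : ℝ) 1)] fun x => ψ (t + x) + ψ (t - x)) ∧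
      ∀ t, k t =ᵐ[volume.restrict (Ioo (0 : ℝ) 1)] fun x => ψ (t + x) - ψ (t - x) := by
  obtain ⟨p, hpc, hp⟩ := exists_travelling hψ (σ := 1) (Or.inl rfl)
  obtain ⟨q, hqc, hq⟩ := exists_travelling hψ (σ := -1) (Or.inr rfl)
  simp only [one_mul, neg_mul, ← sub_eq_add_neg] at hp hq
  have m0 : (0 : ℝ) ∈ Icc (0 : ℝ) 1 := ⟨le_rfl, zero_le_one⟩
  have m1 : (1 : ℝ) ∈ Icc (0 : ℝ) 1 := ⟨zero_le_one, le_rfl⟩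
  -- The equations to verify contain only integrals of the two waves, so all of them become
  -- identities between values of the continuous function `Ψ`.
  set Ψ : ℝ → ℝ := fun y => ∫ s in (0 : ℝ)..y, ψ s with hΨ
  have hΨc : Continuous Ψ := intervalIntegral.continuous_primitive (fun a b => hψ1.intervalIntegrable) 0
  have primae : ∀ {w : L2} {f : ℝ → ℝ}, w =ᵐ[volume.restrict (Ioo (0 : ℝ) 1)] f → ∀ x ∈ Icc (0 : ℝ) 1,
      prim w x = ∫ y in (0 : ℝ)..x, f y := by
    intro w f hwf x hx
    rw [prim_eq w hx]
    apply intervalIntegral.integral_congr_ae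
    have h1 := (ae_restrict_iff' measurableSet_Ioo).1 hwf
    have h2 : ∀ᵐ y : ℝ, y ≠ 1 := by simp [ae_iff]
    filter_upwards [h1, h2] with y hy hy1 hyx
    rw [uIoc_of_le hx.1] at hyx
    exact hy ⟨hyx.1, lt_of_le_of_ne (hyx.2.trans hx.2) hy1⟩
  have pp : ∀ t, ∀ x ∈ Icc (0 : ℝ) 1, prim (p t) x = Ψ (t + x) - Ψ t := fun t x hx => by
    rw [primae (hp t) x hx]
    simpa using integral_comp_add_mul hψ1 (σ := 1) (Or.inl rfl) t x
  have pq : ∀ t, ∀ x ∈ Icc (0 : ℝ) 1, prim (q t) x = Ψ t - Ψ (t - x) := fun t x hx => by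
    rw [primae (hq t) x hx]
    have := integral_comp_add_mul hψ1 (σ := -1) (Or.inr rfl) t x
    simp only [neg_mul, one_mul, ← sub_eq_add_neg] at this
    rw [this]; ring
  have ii : ∀ {f : ℝ → ℝ}, Continuous f → ∀ φ : L2, Integrable (fun x => φ x * f x) (volume.restrict (Ioo (0 : ℝ) 1)) :=
    fun hf φ => MemLp.integrable_mul (Lp.memLp φ) (memLp_restrict_Ioo_of_continuousOn hf.continuousOn)
  have Jp : ∀ t (φ : L2), inner ℝ φ (volterra (p t)) = ∫ x in Ioo (0 : ℝ) 1, φ x * (Ψ (t + x) - Ψ t) := fun t φ => by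
    rw [inner_volterra_right]
    exact setIntegral_congr_fun measurableSet_Ioo fun x hx => by
      rw [pp t x (Ioo_subset_Icc_self hx)]
  have Jq : ∀ t (φ : L2), inner ℝ φ (volterra (q t)) = ∫ x in Ioo (0 : ℝ) 1, φ x * (Ψ t - Ψ (t - x)) := fun t φ => by
    rw [inner_volterra_right]
    exact setIntegral_congr_fun measurableSet_Ioo fun x hx => by
      rw [pq t x (Ioo_subset_Icc_self hx)]
  have intw : ∀ {w : ℝ → L2}, Continuous w → ∀ t (φ : L2), inner ℝ φ (∫ s in (0 : ℝ)..t, w s) = ∫ s in (0 : ℝ)..t, inner ℝ φ (w s) := by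
    intro w hw t φ
    exact ((innerSL ℝ φ).intervalIntegral_comp_comm (hw.intervalIntegrable 0 t)).symm
  have Ip : ∀ t (φ : L2), inner ℝ φ (∫ s in (0 : ℝ)..t, p s) = ∫ x in Ioo (0 : ℝ) 1, φ x * (Ψ (t + x) - Ψ x) := by
    intro t φ
    rw [intw hpc]
    have := integral_travelling_fubini hψ1 1 φ 0 t
    simp only [one_mul] at this
    simp_rw [fun s => L2.inner_eq_of_ae (EventuallyEq.refl _ φ) (hp s)]
    rw [this]
    simp_rw [integral_comp_add_right_eq hψ1]
    rfl
  have Iq : ∀ t (φ : L2), inner ℝ φ (∫ s in (0 : ℝ)..t, q s) = ∫ x in Ioo (0 : ℝ) 1, φ x * (Ψ (t - x) - Ψ (-x)) := by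
    intro t φ
    rw [intw hqc]
    have := integral_travelling_fubini hψ1 (-1) φ 0 t
    simp only [neg_mul, one_mul] at this
    simp_rw [fun s => L2.inner_eq_of_ae (EventuallyEq.refl _ φ) (hq s), sub_eq_add_neg]
    rw [this]
    simp_rw [integral_comp_add_right_eq hψ1]
    rfl
  have hcomp : ∀ c, MemLp (fun t => ψ (t + c)) 2 (volume : Measure ℝ) := fun c =>
    hψ.comp_measurePreserving (measurePreserving_add_right volume c)
  have hcompi : ∀ c a b, IntervalIntegrable (fun t => ψ (t + c)) volume a b := fun c a b =>
    (hψ1.comp_add_right c).intervalIntegrable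
  have gae : ∀ t, ((p t + q t : L2) : ℝ → ℝ) =ᵐ[volume.restrict (Ioo (0 : ℝ) 1)] fun x => ψ (t + x) + ψ (t - x) := fun t => by
    filter_upwards [Lp.coeFn_add (p t) (q t), hp t, hq t] with x h1 h2 h3
    rw [h1, Pi.add_apply, h2, h3]
  have kae : ∀ t, ((p t - q t : L2) : ℝ → ℝ) =ᵐ[volume.restrict (Ioo (0 : ℝ) 1)] fun x => ψ (t + x) - ψ (t - x) := fun t => by
    filter_upwards [Lp.coeFn_sub (p t) (q t), hp t, hq t] with x h1 h2 h3
    rw [h1, Pi.sub_apply, h2, h3]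
  have tr : ∀ t, inner ℝ (chi 1) (p t + q t) = Ψ (t + 1) - Ψ (t - 1) := fun t => by
    show prim _ 1 = _
    rw [prim_add, pp t 1 m1, pq t 1 m1]; ring
  have Ib : ∀ c t, (∫ s in (0 : ℝ)..t, ψ (s + c)) = Ψ (t + c) - Ψ c := fun c t => integral_comp_add_right_eq hψ1 t c
  have sub' : ∀ {φ : L2} {f f' : ℝ → ℝ}, Continuous f → Continuous f' → (∫ x in Ioo (0 : ℝ) 1, φ x * f x) - (∫ x in Ioo (0 : ℝ) 1, φ x * f' x)
      = ∫ x in Ioo (0 : ℝ) 1, φ x * (f x - f' x) := @fun φ _ _ hf hf' => by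
    rw [← integral_sub (ii hf φ) (ii hf' φ)]; congr 1; ext x; ring
  have add' : ∀ {φ : L2} {f f' : ℝ → ℝ}, Continuous f → Continuous f' → (∫ x in Ioo (0 : ℝ) 1, φ x * f x) + (∫ x in Ioo (0 : ℝ) 1, φ x * f' x)
      = ∫ x in Ioo (0 : ℝ) 1, φ x * (f x + f' x) := @fun φ _ _ hf hf' => by
    rw [← integral_add (ii hf φ) (ii hf' φ)]; congr 1; ext x; ring
  refine ⟨fun t => p t + q t, fun t => p t - q t, ⟨(hpc.add hqc).continuousOn, (hpc.sub hqc).continuousOn,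
    by simp, by simp, ?_, ?_, ?_, ?_⟩, gae, kae⟩
  · exact (hcomp 1).restrict _ |>.sub ((hcomp (-1)).restrict _)
  · intro t ht
    refine ext_inner_left ℝ fun φ => ?_
    rw [intervalIntegral.integral_sub (hpc.intervalIntegrable 0 t) (hqc.intervalIntegrable 0 t), map_add, map_add]
    simp only [inner_add_right, inner_sub_right, Jp, Jq, Ip, Iq]
    rw [add' (by fun_prop) (by fun_prop), add' (by fun_prop) (by fun_prop), sub' (by fun_prop) (by fun_prop),
      add' (by fun_prop) (by fun_prop)]
    congr 1; ext x
    rw [zero_add, zero_sub]; ring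
  · intro t ht
    rw [tr, tr, intervalIntegral.integral_sub (hcompi 1 0 t) (by simpa [sub_eq_add_neg] using hcompi (-1) 0 t), Ib]
    have := Ib (-1) t
    simp only [← sub_eq_add_neg] at this
    rw [this, zero_add, zero_sub]; ring
  · intro φ t ht
    -- The boundary condition `g + μ k = 0` at `x = 1`, integrated in time.
    have rel : (1 + μ) * (Ψ (t + 1) - Ψ 1) + (1 - μ) * (Ψ (t - 1) - Ψ (-1)) = 0 := by
      have e2 := Ib (-1) t
      simp only [← sub_eq_add_neg] at e2
      rw [← Ib 1 t, ← e2, ← intervalIntegral.integral_const_mul, ← intervalIntegral.integral_const_mul,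
        ← intervalIntegral.integral_add ((hcompi 1 0 t).const_mul _) ((by simpa [sub_eq_add_neg] using hcompi (-1) 0 t : IntervalIntegrable (fun t => ψ (t - 1)) volume 0 t).const_mul _)]
      apply intervalIntegral.integral_zero_ae
      filter_upwards [hrel] with s hs hst
      rw [uIoc_of_le ht.1] at hst
      exact hs ⟨hst.1, hst.2.trans ht.2⟩
    rw [intervalIntegral.integral_add (hpc.intervalIntegrable 0 t) (hqc.intervalIntegrable 0 t), inner_volterra_left,
      inner_volterra_left, tr, tr]
    simp only [map_sub, inner_add_right, inner_sub_right, Jp, Jq, Ip, Iq, prim_sub, pp _ 1 m1, pq _ 1 m1]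
    have e : inner ℝ (chi 1) φ = prim φ 1 := rfl
    rw [e]
    -- After integration by parts the interior integrals cancel up to multiples of `prim φ 1`;
    -- together with the boundary terms these add up to a multiple of `rel`.
    have key : (∫ x in Ioo (0 : ℝ) 1, φ x * (Ψ (t + x) - Ψ x)) + (∫ x in Ioo (0 : ℝ) 1, φ x * (Ψ (t - x) - Ψ (-x)))
        - ((∫ x in Ioo (0 : ℝ) 1, φ x * (Ψ (t + x) - Ψ t)) - ∫ x in Ioo (0 : ℝ) 1, φ x * (Ψ t - Ψ (t - x)))
        = 2 * Ψ t * prim φ 1 - ((∫ x in Ioo (0 : ℝ) 1, φ x * (Ψ (0 + x) - Ψ 0)) - ∫ x in Ioo (0 : ℝ) 1, φ x * (Ψ 0 - Ψ (0 - x)))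
          - 2 * Ψ 0 * prim φ 1 := by
      have e3 : ∀ c : ℝ, c * prim φ 1 = ∫ x in Ioo (0 : ℝ) 1, φ x * c := fun c => by
        rw [prim_eq φ m1, ← integral_Ioo_eq_intervalIntegral, integral_mul_const, mul_comm]
      rw [e3, e3, add' (by fun_prop) (by fun_prop), sub' (by fun_prop) (by fun_prop), sub' (by fun_prop) (by fun_prop),
        sub' (by fun_prop) (by fun_prop), sub' (by fun_prop) (by fun_prop), sub' (by fun_prop) (by fun_prop)]
      congr 1; ext x
      rw [zero_add, zero_sub]; ring
    simp only [intervalIntegral.integral_zero, inner_zero_right, zero_mul, add_zero]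
    simp only [zero_add, zero_sub] at key ⊢
    linear_combination key + (prim φ 1) * rel

end WaveSystem

/-! ### Solvability of the homogeneous problem; weak derivatives and primitives -/

namespace WaveSystem

/-- In `g = ψ(t+x) + ψ(t-x)`, `k = ψ(t+x) - ψ(t-x)` the initial values prescribe `ψ` on `(-1,1)`:
`ψ(x) = (g₀ + k₀)(x)/2` and `ψ(-x) = (g₀ - k₀)(x)/2` for `0 < x < 1`. For `0 < t < 1` the boundary
relation then defines `ψ(t+1) = -κ ψ(t-1)`, which is the reflected wave on `(1,2)`. This suffices
for times in `[0,1]`. -/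
theorem homogeneousSolvable_volterra {μ : ℝ} (hμ : 0 < μ) : HomogeneousSolvable volterra (chi 1) μ := by
  intro g₀ k₀
  have ext : ∀ w : L2, MemLp (indicator (Ioo (0 : ℝ) 1) w) 2 volume ∧ Integrable (indicator (Ioo (0 : ℝ) 1) w) volume :=
    fun w => ⟨(memLp_indicator_iff_restrict measurableSet_Ioo).2 (Lp.memLp w),
      (integrable_indicator_iff measurableSet_Ioo).2 (L2.integrableOn w)⟩
  set a : ℝ → ℝ := indicator (Ioo (0 : ℝ) 1) ((1 / 2 : ℝ) • (g₀ + k₀) : L2) with ha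
  set c : ℝ → ℝ := indicator (Ioo (0 : ℝ) 1) ((1 / 2 : ℝ) • (g₀ - k₀) : L2) with hc
  have a0 : ∀ x, x ∉ Ioo (0 : ℝ) 1 → a x = 0 := fun x hx => indicator_of_notMem hx _
  have c0 : ∀ x, x ∉ Ioo (0 : ℝ) 1 → c x = 0 := fun x hx => indicator_of_notMem hx _
  set κ := (1 - μ) / (1 + μ) with hκ
  have m1 : MeasurePreserving (fun x : ℝ => -x) volume volume := Measure.measurePreserving_neg volume
  have m2 : MeasurePreserving (fun x : ℝ => 2 - x) volume volume := Measure.measurePreserving_sub_left volume 2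
  obtain ⟨g, k, hD, hg, hk⟩ := exists_dalembert (ψ := fun x => a x + c (-x) - κ * c (2 - x)) (μ := μ)
    (((ext _).1.add ((ext _).1.comp_measurePreserving m1)).sub (((ext _).1.comp_measurePreserving m2).const_mul κ))
    (((ext _).2.add (m1.integrable_comp_of_integrable (ext _).2)).sub
      ((m2.integrable_comp_of_integrable (ext _).2).const_mul κ)) (by
      refine Eventually.of_forall fun t ht => ?_
      rw [a0 (t + 1) (fun h => by linarith [h.2, ht.1]), c0 (-(t + 1)) (fun h => by linarith [h.1, ht.1]),
        a0 (t - 1) (fun h => by linarith [h.1, ht.2]), c0 (2 - (t - 1)) (fun h => by linarith [h.2, ht.2]), hκ]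
      have e1 : 2 - (t + 1) = 1 - t := by ring
      have e2 : -(t - 1) = 1 - t := by ring
      rw [e1, e2]
      field_simp
      ring)
  refine ⟨g, k, _, hD, ?_, ?_⟩
  · apply Lp.ext
    filter_upwards [hg 0, ae_restrict_mem measurableSet_Ioo, Lp.coeFn_smul (1 / 2 : ℝ) (g₀ + k₀), Lp.coeFn_smul (1 / 2 : ℝ) (g₀ - k₀),
      Lp.coeFn_add g₀ k₀, Lp.coeFn_sub g₀ k₀] with x hx hm h1 h2 h3 h4
    rw [hx, a0 (0 - x) (fun h => by linarith [h.1, hm.1]), c0 (-(0 + x)) (fun h => by linarith [h.1, hm.1]),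
      c0 (2 - (0 + x)) (fun h => by linarith [h.2, hm.2]), c0 (2 - (0 - x)) (fun h => by linarith [h.2, hm.1]),
      zero_add, zero_sub, neg_neg, ha, hc, indicator_of_mem hm, indicator_of_mem hm, h1, h2, Pi.smul_apply, Pi.smul_apply, h3, h4,
      Pi.add_apply, Pi.sub_apply]
    simp only [smul_eq_mul]; ring
  · apply Lp.ext
    filter_upwards [hk 0, ae_restrict_mem measurableSet_Ioo, Lp.coeFn_smul (1 / 2 : ℝ) (g₀ + k₀), Lp.coeFn_smul (1 / 2 : ℝ) (g₀ - k₀),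
      Lp.coeFn_add g₀ k₀, Lp.coeFn_sub g₀ k₀] with x hx hm h1 h2 h3 h4
    rw [hx, a0 (0 - x) (fun h => by linarith [h.1, hm.1]), c0 (-(0 + x)) (fun h => by linarith [h.1, hm.1]),
      c0 (2 - (0 + x)) (fun h => by linarith [h.2, hm.2]), c0 (2 - (0 - x)) (fun h => by linarith [h.2, hm.1]),
      zero_add, zero_sub, neg_neg, ha, hc, indicator_of_mem hm, indicator_of_mem hm, h1, h2, Pi.smul_apply, Pi.smul_apply, h3, h4,
      Pi.add_apply, Pi.sub_apply]
    simp only [smul_eq_mul]; ring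

/-- Two functions that are continuous on `[a,b]` and agree almost everywhere agree. -/
theorem eqOn_Icc_of_ae_eq {f g : ℝ → ℝ} {a b : ℝ} (hab : a < b) (hf : ContinuousOn f (Icc a b))
    (hg : ContinuousOn g (Icc a b)) (h : ∀ᵐ x ∂(volume.restrict (Ioo a b)), f x = g x) : EqOn f g (Icc a b) :=
  Measure.eqOn_Icc_of_ae_eq volume hab.ne (by
    rw [← restrict_Ioo_eq_restrict_Icc]; exact h) hf hg

/-- The fundamental theorem of calculus for weak derivatives on `(0,1)`. -/
theorem HasWeakDerivOn.ae_eq_const_add_integral {w g : ℝ → ℝ} (hw : ∀ η : ℝ → ℝ, ContDiff ℝ ∞ η → HasCompactSupport η →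
      tsupport η ⊆ Ioo 0 1 → ∫ x in Ioo (0 : ℝ) 1, w x * deriv η x = -∫ x in Ioo (0 : ℝ) 1, g x * η x)
    (hwi : IntegrableOn w (Ioo 0 1)) (hgi : IntegrableOn g (Ioo 0 1)) :
    ∃ c : ℝ, ∀ᵐ x ∂(volume.restrict (Ioo (0 : ℝ) 1)), w x = c + ∫ t in (0 : ℝ)..x, g t := by
  have hgI : IntervalIntegrable g volume 0 1 :=
    (intervalIntegrable_iff_integrableOn_Ioo_of_le zero_le_one).2 hgi
  set G : ℝ → ℝ := fun x => ∫ t in (0 : ℝ)..x, g t with hGdef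
  have hG : AbsolutelyContinuousOnInterval G 0 1 :=
    hgI.absolutelyContinuousOnInterval_intervalIntegral (by simp)
  have hGc : ContinuousOn G (Icc 0 1) := by simpa using hG.continuousOn
  have hGi : IntegrableOn G (Ioo 0 1) := (hGc.integrableOn_Icc).mono_set Ioo_subset_Icc_self
  obtain ⟨c, hc⟩ := ae_const_of_integral_deriv_zero (h := fun x => w x - G x) (hwi.sub hGi) (by
    intro η h1 h2 h3
    have h1' : ContDiff ℝ ∞ (deriv η) := (contDiff_infty_iff_deriv.1 h1).2
    obtain ⟨C, hC⟩ := h2.deriv.exists_bound_of_continuous h1'.continuous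
    have e0 : η 0 = 0 := image_eq_zero_of_notMem_tsupport fun h => by simpa using h3 h
    have e1 : η 1 = 0 := image_eq_zero_of_notMem_tsupport fun h => by simpa using h3 h
    have parts := hG.integral_mul_deriv_eq_deriv_mul
      (h1.of_le (by norm_num : (1 : WithTop ℕ∞) ≤ ∞)).contDiffOn.absolutelyContinuousOnInterval
    have e2 : ∫ x in (0 : ℝ)..1, deriv G x * η x = ∫ x in (0 : ℝ)..1, g x * η x := by
      apply intervalIntegral.integral_congr_ae
      filter_upwards [hgI.ae_hasDerivAt_integral] with x hx h
      rw [(hx (uIoc_subset_uIcc h) 0 (by simp)).deriv]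
    rw [e0, e1, e2, ← integral_Ioo_eq_intervalIntegral, ← integral_Ioo_eq_intervalIntegral] at parts
    simp_rw [sub_mul]
    rw [integral_sub (hwi.mul_bdd h1'.continuous.aestronglyMeasurable (Eventually.of_forall hC))
      (hGi.mul_bdd h1'.continuous.aestronglyMeasurable (Eventually.of_forall hC)), hw η h1 h2 h3, parts]
    ring)
  exact ⟨c, by filter_upwards [hc] with x hx; linarith⟩

theorem HasWeakDerivOn.mono {w g : ℝ → ℝ} {U U' : Set ℝ} (h : HasWeakDerivOn w g U) (hU : U' ⊆ U) :
    HasWeakDerivOn w g U' := by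
  refine ⟨h.1.mono_set hU, h.2.mono_set hU, fun η h1 h2 h3 => ?_⟩
  have e : ∀ {k f : ℝ → ℝ}, tsupport f ⊆ U' → ∫ x in U', k x * f x = ∫ x in U, k x * f x := by
    intro k f hf
    rw [setIntegral_eq_integral_of_forall_compl_eq_zero, setIntegral_eq_integral_of_forall_compl_eq_zero]
    · intro x hx
      rw [image_eq_zero_of_notMem_tsupport fun h' => hx (hU (hf h')), mul_zero]
    · intro x hx
      rw [image_eq_zero_of_notMem_tsupport fun h' => hx (hf h'), mul_zero]
  rw [e ((tsupport_deriv_subset).trans h3), e h3]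
  exact h.3 η h1 h2 (h3.trans hU)

/-- The fundamental theorem of calculus for weak derivatives of continuous functions on `(0,τ)`. -/
theorem HasWeakDerivOn.eq_add_integral {w g : ℝ → ℝ} {τ : ℝ} (hτ : 0 < τ) (h : HasWeakDerivOn w g (Ioo 0 τ))
    (hw : ContinuousOn w (Icc 0 τ)) (hg : IntegrableOn g (Ioc 0 τ)) {t : ℝ} (ht : t ∈ Icc 0 τ) :
    w t = w 0 + ∫ s in (0 : ℝ)..t, g s := by
  -- Scaling by `τ` reduces the claim to the unit interval.
  have hcomp : ∀ f : ℝ → ℝ, ∫ x in Ioo (0 : ℝ) τ, f x = τ * ∫ x in Ioo (0 : ℝ) 1, f (τ * x) := by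
    intro f
    rw [integral_Ioo_eq_intervalIntegral, ← integral_Ioc_eq_integral_Ioo, ← intervalIntegral.integral_of_le hτ.le,
      intervalIntegral.integral_comp_mul_left _ hτ.ne', smul_eq_mul, mul_one, mul_zero]
    field_simp
  have hmaps : MapsTo (fun x => τ * x) (Icc 0 1) (Icc 0 τ) := fun x hx =>
    ⟨mul_nonneg hτ.le hx.1, mul_le_of_le_one_right hτ.le hx.2⟩
  have hgI : IntervalIntegrable g volume 0 τ := (intervalIntegrable_iff_integrableOn_Ioc_of_le hτ.le).2 hg
  have hwc : ContinuousOn (fun x => w (τ * x)) (Icc 0 1) := hw.comp (by fun_prop) hmaps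
  have hgi : IntervalIntegrable (fun x => τ * g (τ * x)) volume 0 1 := by
    have := (hgI.comp_mul_left (c := τ)).const_mul τ
    simpa [hτ.ne'] using this
  obtain ⟨c, hc⟩ := HasWeakDerivOn.ae_eq_const_add_integral (w := fun x => w (τ * x)) (g := fun x => τ * g (τ * x)) (by
    intro η h1 h2 h3
    have hτ' : τ⁻¹ ≠ 0 := inv_ne_zero hτ.ne'
    have e := h.3 (fun x => η (τ⁻¹ * x)) (by fun_prop) (h2.comp_homeomorph (Homeomorph.mulLeft₀ τ⁻¹ hτ')) (by
      refine (tsupport_comp_subset_preimage η (f := fun x => τ⁻¹ * x) (by fun_prop)).trans fun x hx => ?_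
      have := h3 hx
      constructor
      · exact (pos_iff_pos_of_mul_pos this.1).1 (inv_pos.2 hτ)
      · have := this.2
        rwa [inv_mul_lt_iff₀ hτ, mul_one] at this)
    rw [hcomp, hcomp] at e
    have d : ∀ x, deriv (fun x => η (τ⁻¹ * x)) x = τ⁻¹ * deriv η (τ⁻¹ * x) := fun x => by
      rw [deriv_comp_mul_left, smul_eq_mul]
    simp only [d, inv_mul_cancel_left₀ hτ.ne'] at e
    rw [← mul_neg, mul_right_inj' hτ.ne'] at e
    have e1 : ∀ x, w (τ * x) * (τ⁻¹ * deriv η x) = τ⁻¹ * (w (τ * x) * deriv η x) := fun x => by ring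
    have e2 : ∀ x, τ * g (τ * x) * η x = τ * (g (τ * x) * η x) := fun x => by ring
    simp_rw [e1, integral_const_mul] at e
    simp_rw [e2, integral_const_mul]
    rw [inv_mul_eq_iff_eq_mul₀ hτ.ne'] at e
    rw [e]; ring)
    (hwc.integrableOn_Icc.mono_set Ioo_subset_Icc_self)
    ((intervalIntegrable_iff_integrableOn_Ioo_of_le zero_le_one).1 hgi)
  have key : EqOn (fun x => w (τ * x)) (fun x => c + ∫ t in (0 : ℝ)..x, τ * g (τ * t)) (Icc 0 1) := by
    refine eqOn_Icc_of_ae_eq one_pos hwc (continuousOn_const.add ?_) hc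
    have := intervalIntegral.continuousOn_primitive_interval' hgi (a := 0) (by simp)
    simpa using this
  have k0 := key ⟨le_rfl, zero_le_one⟩
  have kt := key (x := τ⁻¹ * t) ⟨mul_nonneg (inv_nonneg.2 hτ.le) ht.1, by
    rw [inv_mul_le_iff₀ hτ, mul_one]; exact ht.2⟩
  simp only [mul_zero, intervalIntegral.integral_same, add_zero, mul_inv_cancel_left₀ hτ.ne'] at k0 kt
  rw [kt, k0, intervalIntegral.integral_const_mul, intervalIntegral.integral_comp_mul_left _ hτ.ne', mul_inv_cancel_left₀ hτ.ne',
    mul_zero, smul_eq_mul, mul_inv_cancel_left₀ hτ.ne']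

/-- A primitive of a locally integrable function has this function as its weak derivative. -/
theorem HasWeakDerivOn.of_eq_add_integral {w g : ℝ → ℝ} {τ : ℝ} (hg : IntegrableOn g (Ioc 0 τ))
    (hw : ∀ t ∈ Icc 0 τ, w t = w 0 + ∫ s in (0 : ℝ)..t, g s) : HasWeakDerivOn w g (Ioo 0 τ) := by
  rcases le_or_gt τ 0 with hτ | hτ
  · rw [Ioo_eq_empty (not_lt.2 hτ)]
    exact ⟨fun x hx => hx.elim, fun x hx => hx.elim, fun η _ _ _ => by simp⟩
  have hgI : IntervalIntegrable g volume 0 τ := (intervalIntegrable_iff_integrableOn_Ioc_of_le hτ.le).2 hg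
  have hG : AbsolutelyContinuousOnInterval (fun x => ∫ t in (0 : ℝ)..x, g t) 0 τ :=
    hgI.absolutelyContinuousOnInterval_intervalIntegral (by simp)
  have hGc : ContinuousOn (fun x => ∫ t in (0 : ℝ)..x, g t) (Icc 0 τ) := by simpa [hτ.le] using hG.continuousOn
  have hwc : ContinuousOn w (Icc 0 τ) := (continuousOn_const.add hGc).congr hw
  have eqI : ∀ k : ℝ → ℝ, ∫ x in Ioo (0 : ℝ) τ, k x = ∫ x in (0 : ℝ)..τ, k x := fun k => by
    rw [intervalIntegral.integral_of_le hτ.le, integral_Ioc_eq_integral_Ioo]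
  refine ⟨(hwc.integrableOn_Icc.mono_set Ioo_subset_Icc_self).locallyIntegrableOn,
    (hg.mono_set Ioo_subset_Ioc_self).locallyIntegrableOn, fun η h1 h2 h3 => ?_⟩
  have h1' : ContDiff ℝ ∞ (deriv η) := (contDiff_infty_iff_deriv.1 h1).2
  have e0 : η 0 = 0 := image_eq_zero_of_notMem_tsupport fun h => by simpa using h3 h
  have e1 : η τ = 0 := image_eq_zero_of_notMem_tsupport fun h => by simpa using h3 h
  have parts := hG.integral_mul_deriv_eq_deriv_mul
    (h1.of_le (by norm_num : (1 : WithTop ℕ∞) ≤ ∞)).contDiffOn.absolutelyContinuousOnInterval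
  have e2 : ∫ x in (0 : ℝ)..τ, deriv (fun x => ∫ t in (0 : ℝ)..x, g t) x * η x = ∫ x in (0 : ℝ)..τ, g x * η x := by
    apply intervalIntegral.integral_congr_ae
    filter_upwards [hgI.ae_hasDerivAt_integral] with x hx h
    rw [(hx (uIoc_subset_uIcc h) 0 (by simp)).deriv]
  have e3 : ∫ x in (0 : ℝ)..τ, deriv η x = 0 := by
    rw [intervalIntegral.integral_deriv_eq_sub (fun x _ => h1.differentiable (by simp) x) (h1'.continuous.intervalIntegrable _ _), e0, e1, sub_zero]
  rw [e0, e1, e2] at parts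
  rw [eqI, eqI]
  have e4 : ∫ x in (0 : ℝ)..τ, w x * deriv η x
      = ∫ x in (0 : ℝ)..τ, (w 0 * deriv η x + (∫ t in (0 : ℝ)..x, g t) * deriv η x) := by
    apply intervalIntegral.integral_congr
    intro x hx
    rw [uIcc_of_le hτ.le] at hx
    simp only
    rw [hw x hx]; ring
  rw [e4, intervalIntegral.integral_add, intervalIntegral.integral_const_mul, e3, parts]
  · ring
  · exact (h1'.continuous.intervalIntegrable _ _).const_mul _
  · exact ((by rw [uIcc_of_le hτ.le]; exact hGc.mul h1'.continuous.continuousOn : ContinuousOn _ (uIcc 0 τ))).intervalIntegrable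

end WaveSystem

/-! ### `H¹` functions as primitives, and the reflection `x ↦ 1 - x` -/

namespace WaveSystem

theorem measurePreserving_one_sub :
    MeasurePreserving (fun x : ℝ => 1 - x) (volume.restrict (Ioo (0 : ℝ) 1)) (volume.restrict (Ioo (0 : ℝ) 1)) := by
  have h := (Measure.measurePreserving_sub_left volume (1 : ℝ)).restrict_preimage (measurableSet_Ioo (a := (0 : ℝ)) (b := 1))
  have e : (fun x : ℝ => 1 - x) ⁻¹' Ioo 0 1 = Ioo 0 1 := by
    ext x; simp only [mem_preimage, mem_Ioo]; constructor <;> rintro ⟨h1, h2⟩ <;> constructor <;> linarith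
  rwa [e] at h

/-- The reflection `f ↦ f(1 - ·)` of `L²(0,1)`. -/
noncomputable def reflect : L2 →ₗᵢ[ℝ] L2 := Lp.compMeasurePreservingₗᵢ ℝ _ measurePreserving_one_sub

theorem reflect_ae (f : L2) : reflect f =ᵐ[volume.restrict (Ioo (0 : ℝ) 1)] fun x => f (1 - x) :=
  Lp.coeFn_compMeasurePreserving f measurePreserving_one_sub

theorem reflect_ae_of_ae {f : L2} {f' : ℝ → ℝ} (h : f =ᵐ[volume.restrict (Ioo (0 : ℝ) 1)] f') :
    reflect f =ᵐ[volume.restrict (Ioo (0 : ℝ) 1)] fun x => f' (1 - x) :=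
  (reflect_ae f).trans (measurePreserving_one_sub.quasiMeasurePreserving.ae_eq_comp h)

theorem reflect_reflect (f : L2) : reflect (reflect f) = f := by
  apply Lp.ext
  filter_upwards [reflect_ae_of_ae (reflect_ae f)] with x hx
  rw [hx, sub_sub_cancel]

theorem inner_reflect_reflect (f g : L2) : inner ℝ (reflect f) (reflect g) = inner ℝ f g :=
  reflect.inner_map_map f g

theorem integral_one_sub (f : ℝ → ℝ) : ∫ x in Ioo (0 : ℝ) 1, f (1 - x) = ∫ x in Ioo (0 : ℝ) 1, f x := by
  rw [integral_Ioo_eq_intervalIntegral, integral_Ioo_eq_intervalIntegral, intervalIntegral.integral_comp_sub_left]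
  simp

theorem H1.continuous_toL2 : Continuous H1.toL2 :=
  (WithLp.continuous_fst 2 L2 L2).comp continuous_subtype_val

theorem H1.continuous_dx : Continuous H1.dx :=
  (WithLp.continuous_snd 2 L2 L2).comp continuous_subtype_val

theorem H1.norm_sq (w : H1) : ‖w‖ ^ 2 = ‖w.toL2‖ ^ 2 + ‖w.dx‖ ^ 2 :=
  WithLp.prod_norm_sq_eq_of_L2 (w : WithLp 2 (L2 × L2))

theorem H1.norm_dx_le (w : H1) : ‖w.dx‖ ≤ ‖w‖ := by
  have := w.norm_sq
  exact abs_le_of_sq_le_sq' (by nlinarith [sq_nonneg ‖w.toL2‖]) (norm_nonneg _) |>.2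

theorem H1.ext' {w z : H1} (h : w.toL2 = z.toL2) (h' : w.dx = z.dx) : w = z := by
  apply Subtype.ext
  apply (WithLp.equiv 2 (L2 × L2)).injective
  exact Prod.ext h h'

theorem H1.rep_eqOn {w : H1} {c : ℝ → ℝ} (hc : ContinuousOn c (Icc 0 1))
    (h : w.toL2 =ᵐ[volume.restrict (Ioo (0 : ℝ) 1)] c) : EqOn w.rep c (Icc 0 1) :=
  eqOn_Icc_of_ae_eq one_pos w.continuousOn_rep hc (w.toL2_ae_eq_rep.symm.trans h)

theorem H1.rep_eq (w : H1) {x : ℝ} (hx : x ∈ Icc (0 : ℝ) 1) : w.rep x = w.rep 0 + prim w.dx x := by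
  obtain ⟨c, hc⟩ := HasWeakDerivOn.ae_eq_const_add_integral (w := w.toL2) (g := w.dx) w.2.integral_eq
    (L2.integrableOn _) (L2.integrableOn _)
  have key : EqOn w.rep (fun x => c + prim w.dx x) (Icc 0 1) := by
    refine H1.rep_eqOn (continuousOn_const.add (continuousOn_prim _)) ?_
    filter_upwards [hc, ae_restrict_mem measurableSet_Ioo] with y hy hm
    rw [hy, prim_eq _ (Ioo_subset_Icc_self hm)]
  have k0 := key ⟨le_rfl, zero_le_one⟩
  simp only [prim_zero, add_zero] at k0
  rw [key hx, k0]

theorem H1.rep_of_mem_V {w : H1} (hw : w ∈ V 0) {x : ℝ} (hx : x ∈ Icc (0 : ℝ) 1) : w.rep x = prim w.dx x := by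
  rw [w.rep_eq hx, show w.rep 0 = 0 from hw, zero_add]

/-- This is what identifies `V 0` with `L²` through the derivative; `lift` is the inverse. -/
theorem H1.toL2_of_mem_V {w : H1} (hw : w ∈ V 0) : w.toL2 = volterra w.dx := by
  apply Lp.ext
  filter_upwards [w.toL2_ae_eq_rep, volterra_ae w.dx, ae_restrict_mem measurableSet_Ioo] with x h1 h2 h3
  rw [h1, h2, H1.rep_of_mem_V hw (Ioo_subset_Icc_self h3)]

/-- The element of `H¹` with derivative `g` that vanishes at `0`. -/
noncomputable def lift (g : L2) : H1 := ⟨WithLp.toLp 2 (volterra g, g), by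
  refine ⟨(L2.integrableOn _).locallyIntegrableOn, (L2.integrableOn _).locallyIntegrableOn, fun η h1 h2 h3 => ?_⟩
  have h := HasWeakDerivOn.of_eq_add_integral (w := prim g) (τ := 1) g.integrableOn_Ioc fun t ht => by
    rw [prim_zero, zero_add, prim_eq g ht]
  refine Eq.trans (integral_congr_ae ?_) (h.integral_eq η h1 h2 h3)
  filter_upwards [volterra_ae g] with x hx
  show volterra g x * _ = _
  rw [hx]⟩

theorem lift_toL2 (g : L2) : (lift g).toL2 = volterra g := rfl

theorem lift_dx (g : L2) : (lift g).dx = g := rfl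

theorem lift_rep (g : L2) {x : ℝ} (hx : x ∈ Icc (0 : ℝ) 1) : (lift g).rep x = prim g x :=
  H1.rep_eqOn (w := lift g) (continuousOn_prim g) (volterra_ae g) hx

theorem lift_mem_V (g : L2) : lift g ∈ V 0 := by
  show (lift g).rep 0 = 0
  rw [lift_rep g ⟨le_rfl, zero_le_one⟩, prim_zero]

theorem lift_dx_of_mem_V {w : H1} (hw : w ∈ V 0) : lift w.dx = w :=
  H1.ext' (by rw [lift_toL2, H1.toL2_of_mem_V hw]) rfl

theorem continuous_lift : Continuous lift :=
  Continuous.subtype_mk ((WithLp.prod_continuous_toLp 2 L2 L2).comp (volterra.continuous.prodMk continuous_id)) _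

/-- The reflection `w ↦ w(1 - ·)` of `H¹(0,1)`. -/
noncomputable def H1.reflect (w : H1) : H1 := ⟨WithLp.toLp 2 (WaveSystem.reflect w.toL2, -WaveSystem.reflect w.dx), by
  refine ⟨(L2.integrableOn _).locallyIntegrableOn, (L2.integrableOn _).locallyIntegrableOn, fun η h1 h2 h3 => ?_⟩
  have h := w.2.integral_eq (fun x => η (1 - x)) (by fun_prop)
    (h2.comp_homeomorph (Homeomorph.subLeft 1)) (by
      refine (tsupport_comp_subset_preimage η (f := fun x : ℝ => 1 - x) (by fun_prop)).trans fun x hx => ?_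
      have := h3 hx
      exact ⟨by linarith [this.2], by linarith [this.1]⟩)
  rw [← integral_one_sub, ← integral_one_sub fun x => w.1.snd x * _] at h
  simp only [deriv_comp_const_sub, sub_sub_cancel] at h
  have e1 : ∫ x in Ioo (0 : ℝ) 1, WaveSystem.reflect w.toL2 x * deriv η x
      = ∫ x in Ioo (0 : ℝ) 1, w.1.fst (1 - x) * deriv η x := by
    apply integral_congr_ae
    filter_upwards [reflect_ae w.toL2] with x hx
    rw [hx]; rfl
  have e2 : ∫ x in Ioo (0 : ℝ) 1, (-WaveSystem.reflect w.dx : L2) x * η x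
      = -∫ x in Ioo (0 : ℝ) 1, w.1.snd (1 - x) * η x := by
    rw [← integral_neg]
    apply integral_congr_ae
    filter_upwards [reflect_ae w.dx, Lp.coeFn_neg (WaveSystem.reflect w.dx)] with x hx hx'
    rw [hx', Pi.neg_apply, hx, neg_mul]; rfl
  show ∫ x in Ioo (0 : ℝ) 1, WaveSystem.reflect w.toL2 x * deriv η x = -∫ x in Ioo (0 : ℝ) 1, (-WaveSystem.reflect w.dx : L2) x * η x
  rw [e1, e2]
  simp only [mul_neg, integral_neg] at h
  linarith⟩

theorem H1.reflect_toL2 (w : H1) : w.reflect.toL2 = WaveSystem.reflect w.toL2 := rfl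

theorem H1.reflect_dx (w : H1) : w.reflect.dx = -WaveSystem.reflect w.dx := rfl

theorem H1.reflect_reflect (w : H1) : w.reflect.reflect = w :=
  H1.ext' (WaveSystem.reflect_reflect _) (by
    rw [H1.reflect_dx, H1.reflect_dx, map_neg, neg_neg, WaveSystem.reflect_reflect])

theorem H1.continuous_reflect : Continuous H1.reflect :=
  Continuous.subtype_mk ((WithLp.prod_continuous_toLp 2 L2 L2).comp
    ((WaveSystem.reflect.continuous.comp H1.continuous_toL2).prodMk (WaveSystem.reflect.continuous.comp H1.continuous_dx).neg)) _

theorem H1.reflect_rep (w : H1) {x : ℝ} (hx : x ∈ Icc (0 : ℝ) 1) : w.reflect.rep x = w.rep (1 - x) := by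
  refine H1.rep_eqOn (c := fun x => w.rep (1 - x)) (w.continuousOn_rep.comp (by fun_prop) fun x hx => ⟨by linarith [hx.2], by linarith [hx.1]⟩)
    ?_ hx
  rw [H1.reflect_toL2]
  exact reflect_ae_of_ae w.toL2_ae_eq_rep

theorem H1.reflect_mem_V {w : H1} {a : ℝ} (ha : a ∈ Icc (0 : ℝ) 1) (hw : w ∈ V a) : w.reflect ∈ V (1 - a) := by
  show w.reflect.rep (1 - a) = 0
  rw [H1.reflect_rep w ⟨by linarith [ha.2], by linarith [ha.1]⟩, sub_sub_cancel]; exact hw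

/-- Test functions are reflected as well, and in `⟨w_x, φ_x⟩` the sign changes twice; the time
derivative of the trace is the same function. Thus `v`, which vanishes at 1, is reduced to the case
of `u`. -/
theorem IsWeakComponent.reflect {lam mu K p a c : ℝ} {S : ℝ → ℝ → ℝ} {T : EReal} {w : ℝ → H1} {w' : ℝ → L2}
    (ha : a ∈ Icc (0 : ℝ) 1) (hc : c ∈ Icc (0 : ℝ) 1)
    (h : IsWeakComponent lam mu K p a c S T w w') :
    IsWeakComponent lam mu K p (1 - a) (1 - c) (fun t x => S t (1 - x)) T (fun t => (w t).reflect)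
      (fun t => WaveSystem.reflect (w' t)) := by
  have one_sub_mem : ∀ {x : ℝ}, x ∈ Icc (0 : ℝ) 1 → 1 - x ∈ Icc (0 : ℝ) 1 := fun hx => ⟨by linarith [hx.2], by linarith [hx.1]⟩
  refine ⟨fun t ht => H1.reflect_mem_V ha (h.dirichlet t ht), H1.continuous_reflect.comp_continuousOn h.continuousOn,
    fun t ht => ?_, WaveSystem.reflect.continuous.comp_continuousOn h.continuousOn_deriv, ?_⟩
  · exact WaveSystem.reflect.toContinuousLinearMap.hasFDerivAt.comp_hasDerivWithinAt t (h.hasDerivWithinAt t ht)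
  obtain ⟨b, hb, hφ⟩ := h.weak_form
  have tr : ∀ t, (w t).reflect.rep (1 - c) = (w t).rep c := fun t => by
    rw [H1.reflect_rep _ (one_sub_mem hc), sub_sub_cancel]
  refine ⟨b, fun τ h0 h1 => by simp only [tr]; exact hb τ h0 h1, fun φ hφV => ?_⟩
  have hR : φ.reflect ∈ V a := by
    have := H1.reflect_mem_V (one_sub_mem ha) hφV
    rwa [sub_sub_cancel] at this
  have key := hφ φ.reflect hR
  have e1 : ∀ f : L2, inner ℝ f φ.reflect.toL2 = inner ℝ (WaveSystem.reflect f) φ.toL2 := fun f => by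
    rw [← inner_reflect_reflect, H1.reflect_toL2, WaveSystem.reflect_reflect]
  have e2 : ∀ f : L2, inner ℝ f φ.reflect.dx = inner ℝ (-WaveSystem.reflect f) φ.dx := fun f => by
    rw [← inner_reflect_reflect, H1.reflect_dx, map_neg, WaveSystem.reflect_reflect, inner_neg_right, inner_neg_left]
  have e3 : ∀ t, ∫ x in Ioo (0 : ℝ) 1, S t x * φ.reflect.rep x = ∫ x in Ioo (0 : ℝ) 1, S t (1 - x) * φ.rep x := fun t => by
    rw [← integral_one_sub]
    refine setIntegral_congr_fun measurableSet_Ioo fun x hx => ?_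
    rw [H1.reflect_rep _ (one_sub_mem (Ioo_subset_Icc_self hx)), sub_sub_cancel]
  simp only [e1, e2, e3, H1.reflect_rep _ hc] at key
  simp only [tr, H1.reflect_dx]
  exact key

theorem IsWeakComponent.congr_source {lam mu K p a c : ℝ} {S S' : ℝ → ℝ → ℝ} {T : EReal} {w : ℝ → H1} {w' : ℝ → L2}
    (h : IsWeakComponent lam mu K p a c S T w w') (hS : ∀ t, ∀ x ∈ Icc (0 : ℝ) 1, S' t x = S t x) :
    IsWeakComponent lam mu K p a c S' T w w' := by
  obtain ⟨b, hb, hφ⟩ := h.weak_form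
  refine ⟨h.1, h.2, h.3, h.4, b, hb, fun φ hφV => ?_⟩
  have e : ∀ t, ∫ x in Ioo (0 : ℝ) 1, S' t x * φ.rep x = ∫ x in Ioo (0 : ℝ) 1, S t x * φ.rep x := fun t =>
    setIntegral_congr_fun measurableSet_Ioo fun x hx => by
      rw [hS t x (Ioo_subset_Icc_self hx)]
  simp only [e]
  exact hφ φ hφV

end WaveSystem

/-! ### Weak solutions of one equation in first order form -/

namespace WaveSystem

theorem continuous_Psi {p : ℝ} (hp : 2 < p) : Continuous (Psi p) :=
  (continuous_abs.rpow_const fun _ => Or.inr (by linarith)).mul continuous_id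

theorem timeIco_coe (T : ℝ) : timeIco (T : EReal) = Ico 0 T := by
  ext t; simp [timeIco]

theorem timeIoo_coe (T : ℝ) : timeIoo (T : EReal) = Ioo 0 T := by
  ext t; simp [timeIoo]

theorem Icc_subset_timeIco {T : EReal} {τ : ℝ} (hτ : (τ : EReal) < T) : Icc 0 τ ⊆ timeIco T :=
  fun _ ht => ⟨ht.1, (EReal.coe_le_coe_iff.2 ht.2).trans_lt hτ⟩

theorem Ioo_subset_timeIoo {T : EReal} {τ : ℝ} (hτ : (τ : EReal) < T) : Ioo 0 τ ⊆ timeIoo T :=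
  fun _ ht => ⟨ht.1, (EReal.coe_lt_coe_iff.2 ht.2).trans hτ⟩

theorem continuousOn_Psi_prim {p τ : ℝ} (hp : 2 < p) (K : ℝ) {g : ℝ → L2} (hg : ContinuousOn g (Icc 0 τ)) :
    ContinuousOn (fun t => K * Psi p (prim (g t) 1)) (Icc 0 τ) :=
  continuousOn_const.mul ((continuous_Psi hp).comp_continuousOn (continuousOn_const.inner hg))

section

variable {τ mu : ℝ} {h b : ℝ → ℝ} {𝒮 g k : ℝ → L2}

theorem integrableOn_weak_source (hh : ContinuousOn h (Icc 0 τ))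
    (h𝒮 : ContinuousOn 𝒮 (Icc 0 τ)) (hg : ContinuousOn g (Icc 0 τ)) (hk : ContinuousOn k (Icc 0 τ))
    (hb : IntegrableOn b (Ioc 0 τ)) (lam E : ℝ) (ϕ φ : L2) :
    IntegrableOn (fun s => h s * E + inner ℝ (𝒮 s) φ - inner ℝ (g s) ϕ - lam * inner ℝ (k s) φ - mu * b s * E) (Ioc 0 τ) :=
  (integrableOn_Ioc_of_continuousOn_Icc ((((hh.mul continuousOn_const).add (h𝒮.inner continuousOn_const)).sub
    (hg.inner continuousOn_const)).sub (continuousOn_const.mul (hk.inner continuousOn_const)))).sub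
    ((hb.const_mul mu).mul_const E)

theorem integral_weak_source (hh : ContinuousOn h (Icc 0 τ))
    (h𝒮 : ContinuousOn 𝒮 (Icc 0 τ)) (hg : ContinuousOn g (Icc 0 τ)) (hk : ContinuousOn k (Icc 0 τ))
    (hb : IntegrableOn b (Ioc 0 τ)) (lam E : ℝ) (ϕ φ : L2) {t : ℝ} (ht : t ∈ Icc 0 τ) :
    ∫ s in (0 : ℝ)..t, (h s * E + inner ℝ (𝒮 s) φ - inner ℝ (g s) ϕ - lam * inner ℝ (k s) φ - mu * b s * E)
      = (∫ s in (0 : ℝ)..t, h s) * E + inner ℝ φ (∫ s in (0 : ℝ)..t, (𝒮 s - lam • k s)) - inner ℝ ϕ (∫ s in (0 : ℝ)..t, g s)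
        - mu * (∫ s in (0 : ℝ)..t, b s) * E := by
  have m0 : (0 : ℝ) ∈ Icc 0 τ := ⟨le_rfl, ht.1.trans ht.2⟩
  have I : ∀ {f : ℝ → ℝ}, ContinuousOn f (Icc 0 τ) → IntervalIntegrable f volume 0 t := fun hf =>
    intervalIntegrable_of_integrableOn_Ioc (integrableOn_Ioc_of_continuousOn_Icc hf) m0 ht
  have I' : ∀ {f : ℝ → L2}, ContinuousOn f (Icc 0 τ) → IntervalIntegrable f volume 0 t := fun hf =>
    intervalIntegrable_of_integrableOn_Ioc (integrableOn_Ioc_of_continuousOn_Icc hf) m0 ht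
  have Ib : IntervalIntegrable b volume 0 t := intervalIntegrable_of_integrableOn_Ioc hb m0 ht
  have sw : ∀ {f : ℝ → L2} (z : L2), ContinuousOn f (Icc 0 τ) → inner ℝ z (∫ s in (0 : ℝ)..t, f s) = ∫ s in (0 : ℝ)..t, inner ℝ (f s) z := by
    intro f z hf
    simp_rw [real_inner_comm]
    exact ((innerSL ℝ z).intervalIntegral_comp_comm (I' hf)).symm
  have e : ∫ s in (0 : ℝ)..t, (𝒮 s - lam • k s) = (∫ s in (0 : ℝ)..t, 𝒮 s) - lam • ∫ s in (0 : ℝ)..t, k s := by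
    rw [← intervalIntegral.integral_smul]
    exact intervalIntegral.integral_sub (I' h𝒮) (I' (hk.const_smul lam))
  rw [intervalIntegral.integral_sub, intervalIntegral.integral_sub, intervalIntegral.integral_sub, intervalIntegral.integral_add,
    intervalIntegral.integral_mul_const, intervalIntegral.integral_mul_const, intervalIntegral.integral_const_mul,
    intervalIntegral.integral_const_mul, e, inner_sub_right, inner_smul_right, sw φ h𝒮, sw φ hk, sw ϕ hg]
  · ring
  · exact I (hh.mul continuousOn_const)
  · exact I (h𝒮.inner continuousOn_const)
  · exact I ((hh.mul continuousOn_const).add (h𝒮.inner continuousOn_const))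
  · exact I (hg.inner continuousOn_const)
  · exact I (((hh.mul continuousOn_const).add (h𝒮.inner continuousOn_const)).sub (hg.inner continuousOn_const))
  · exact I (continuousOn_const.mul (hk.inner continuousOn_const))
  · exact I ((((hh.mul continuousOn_const).add (h𝒮.inner continuousOn_const)).sub (hg.inner continuousOn_const)).sub (continuousOn_const.mul (hk.inner continuousOn_const)))
  · exact (Ib.const_mul mu).mul_const E

end

theorem integral_mul_rep_eq_inner {f : L2} {S : ℝ → ℝ} (hf : f =ᵐ[volume.restrict (Ioo (0 : ℝ) 1)] S) (φ : H1) :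
    ∫ x in Ioo (0 : ℝ) 1, S x * φ.rep x = inner ℝ f φ.toL2 :=
  (L2.inner_eq_of_ae hf φ.toL2_ae_eq_rep).symm

/-- Every test function is the primitive `lift ϕ` of its derivative, which turns the pairings in the
weak form into `L²` pairings with `ϕ` and `volterra ϕ`. Since `⟨w_t, φ⟩` and the trace are
continuous in time, their distributional derivatives can be integrated from 0 to `t`. -/
theorem IsWeakComponent.dampedWave {lam mu K p : ℝ} {S : ℝ → ℝ → ℝ} {T : EReal} {w : ℝ → H1} {w' : ℝ → L2}
    (h : IsWeakComponent lam mu K p 0 1 S T w w') (hp : 2 < p) {𝒮 : ℝ → L2} (h𝒮 : ContinuousOn 𝒮 (timeIco T))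
    (hS : ∀ t ∈ timeIco T, 𝒮 t =ᵐ[volume.restrict (Ioo (0 : ℝ) 1)] S t) :
    ∃ b : ℝ → ℝ, ∀ τ : ℝ, 0 < τ → (τ : EReal) < T →
      DampedWave volterra (chi 1) mu τ (fun t => 𝒮 t - lam • w' t) (fun t => K * Psi p (prim (w t).dx 1))
        (fun t => (w t).dx) w' b := by
  obtain ⟨b, hb, hφ⟩ := h.weak_form
  refine ⟨b, fun τ h0 hτ => ?_⟩
  have hsub := Icc_subset_timeIco hτ
  have hg : ContinuousOn (fun t => (w t).dx) (Icc 0 τ) := H1.continuous_dx.comp_continuousOn (h.continuousOn.mono hsub)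
  have hk : ContinuousOn w' (Icc 0 τ) := h.continuousOn_deriv.mono hsub
  have h𝒮' := h𝒮.mono hsub
  have hh := continuousOn_Psi_prim hp K hg
  have hb2 : MemLp b 2 (volume.restrict (Ioc 0 τ)) := by
    have := (hb τ h0 hτ).memLp_deriv
    rwa [restrict_Ioo_eq_restrict_Ioc] at this
  have hbi : IntegrableOn b (Ioc 0 τ) := hb2.integrable one_le_two
  have m1 : (1 : ℝ) ∈ Icc (0 : ℝ) 1 := ⟨zero_le_one, le_rfl⟩
  have rep1 : ∀ t ∈ Icc 0 τ, (w t).rep 1 = prim (w t).dx 1 := fun t ht => H1.rep_of_mem_V (h.dirichlet t (hsub ht)) m1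
  have trace : ∀ t ∈ Icc 0 τ, prim (w t).dx 1 = prim (w 0).dx 1 + ∫ s in (0 : ℝ)..t, b s := fun t ht => by
    rw [← rep1 t ht, ← rep1 0 ⟨le_rfl, h0.le⟩]
    refine HasWeakDerivOn.eq_add_integral h0 (hb τ h0 hτ).hasWeakDerivOn ?_ hbi ht
    exact ContinuousOn.congr (continuousOn_const.inner hg) rep1
  refine ⟨hg, hk, memLp_two_of_continuousOn_Icc (h𝒮'.sub (hk.const_smul lam)), memLp_two_of_continuousOn_Icc hh, hb2, ?_, trace, ?_⟩
  · intro t ht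
    rw [← H1.toL2_of_mem_V (h.dirichlet t (hsub ht)), ← H1.toL2_of_mem_V (h.dirichlet 0 (hsub ⟨le_rfl, h0.le⟩))]
    have hd : ∀ s ∈ Ioo 0 t, HasDerivAt (fun s => (w s).toL2) (w' s) s := fun s hs =>
      (h.hasDerivWithinAt s (hsub ⟨hs.1.le, hs.2.le.trans ht.2⟩)).hasDerivAt
        (mem_of_superset (Icc_mem_nhds hs.1 (hs.2.trans_le ht.2)) hsub)
    have := intervalIntegral.integral_eq_sub_of_hasDerivAt_of_le ht.1
      (H1.continuous_toL2.comp_continuousOn (h.continuousOn.mono ((Icc_subset_Icc_right ht.2).trans hsub))) hd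
      (intervalIntegrable_of_integrableOn_Ioc (integrableOn_Ioc_of_continuousOn_Icc hk) ⟨le_rfl, h0.le⟩ ht)
    rw [this]; simp
  · intro ϕ t ht
    have hR := hφ (lift ϕ) (lift_mem_V ϕ)
    simp only [lift_rep ϕ m1, lift_dx, lift_toL2] at hR
    have hcongr : ∀ s ∈ Icc 0 τ, K * Psi p ((w s).rep 1) * prim ϕ 1 + (∫ x in Ioo (0 : ℝ) 1, S s x * (lift ϕ).rep x)
        - inner ℝ (w s).dx ϕ - lam * inner ℝ (w' s) (volterra ϕ) - mu * b s * prim ϕ 1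
        = K * Psi p (prim (w s).dx 1) * prim ϕ 1 + inner ℝ (𝒮 s) (volterra ϕ) - inner ℝ (w s).dx ϕ
          - lam * inner ℝ (w' s) (volterra ϕ) - mu * b s * prim ϕ 1 := fun s hs => by
      rw [rep1 s hs, integral_mul_rep_eq_inner (hS s (hsub hs)), lift_toL2]
    have hint := integrableOn_weak_source (mu := mu) hh h𝒮' hg hk hbi lam (prim ϕ 1) ϕ (volterra ϕ)
    have ftc := HasWeakDerivOn.eq_add_integral h0 (hR.mono (Ioo_subset_timeIoo hτ)) (hk.inner continuousOn_const)
      (hint.congr_fun (fun s hs => (hcongr s (Ioc_subset_Icc_self hs)).symm) measurableSet_Ioc) ht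
    rw [intervalIntegral.integral_congr (g := fun s => K * Psi p (prim (w s).dx 1) * prim ϕ 1 + inner ℝ (𝒮 s) (volterra ϕ) - inner ℝ (w s).dx ϕ
          - lam * inner ℝ (w' s) (volterra ϕ) - mu * b s * prim ϕ 1) (fun s hs => hcongr s (by
            rw [uIcc_of_le ht.1] at hs; exact ⟨hs.1, hs.2.trans ht.2⟩)),
      integral_weak_source hh h𝒮' hg hk hbi lam (prim ϕ 1) ϕ (volterra ϕ) ht, real_inner_comm, real_inner_comm (volterra ϕ) (w' 0)] at ftc
    rw [ftc]
    show _ + mu * prim (w t).dx 1 * prim ϕ 1 = _ + mu * prim (w 0).dx 1 * prim ϕ 1 + _ * prim ϕ 1 + _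
    rw [trace t ht]
    ring

/-- The converse: a function given as a primitive in time has its integrand as weak derivative. It
is needed to recognise the continued solution as a weak solution. -/
theorem IsWeakComponent.of_dampedWave {lam mu K p : ℝ} {S : ℝ → ℝ → ℝ} {T : ℝ} {g k : ℝ → L2} {b : ℝ → ℝ}
    (hp : 2 < p) {𝒮 : ℝ → L2} (h𝒮 : ContinuousOn 𝒮 (Icc 0 T))
    (hS : ∀ t ∈ Icc 0 T, 𝒮 t =ᵐ[volume.restrict (Ioo (0 : ℝ) 1)] S t)
    (D : DampedWave volterra (chi 1) mu T (fun t => 𝒮 t - lam • k t) (fun t => K * Psi p (prim (g t) 1)) g k b) :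
    IsWeakComponent lam mu K p 0 1 S T (fun t => lift (g t)) k := by
  have hg := D.continuousOn_g
  have hk := D.continuousOn_k
  have hh := continuousOn_Psi_prim hp K hg
  have m1 : (1 : ℝ) ∈ Icc (0 : ℝ) 1 := ⟨zero_le_one, le_rfl⟩
  refine ⟨fun t _ => lift_mem_V _, ?_, ?_, ?_, ?_⟩
  · rw [timeIco_coe]
    exact continuous_lift.comp_continuousOn (hg.mono Ico_subset_Icc_self)
  · rw [timeIco_coe]
    intro t ht
    have e : ∀ s ∈ Ico 0 T, (lift (g s)).toL2 = volterra (g 0) + ∫ r in (0 : ℝ)..s, k r := fun s hs => by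
      rw [lift_toL2]; exact D.apply_g s (Ico_subset_Icc_self hs)
    refine HasDerivWithinAt.congr ?_ e (e t ht)
    refine HasDerivWithinAt.const_add _ ?_
    rcases ht.1.eq_or_lt with h0 | h0
    · subst h0
      exact (hasDerivWithinAt_integral_Ici hk ht).mono Ico_subset_Ici_self
    · exact (hasDerivAt_integral_of_continuousOn hk ⟨h0, ht.2⟩).hasDerivWithinAt
  · rw [timeIco_coe]; exact hk.mono Ico_subset_Icc_self
  refine ⟨b, fun τ h0 hτ => ?_, fun φ hφ => ?_⟩
  · have hτ' : τ ≤ T := (EReal.coe_lt_coe_iff.1 hτ).le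
    simp only [lift_rep _ m1]
    have hc : ContinuousOn (fun t => prim (g t) 1) (Icc 0 τ) := continuousOn_const.inner (hg.mono (Icc_subset_Icc_right hτ'))
    have hbτ : MemLp b 2 (volume.restrict (Ioc 0 τ)) := D.memLp_b.mono_measure (Measure.restrict_mono (Ioc_subset_Ioc_right hτ') le_rfl)
    refine ⟨?_, ?_, ?_⟩
    · rw [restrict_Ioo_eq_restrict_Ioc]; exact memLp_two_of_continuousOn_Icc hc
    · rw [restrict_Ioo_eq_restrict_Ioc]; exact hbτ
    · exact HasWeakDerivOn.of_eq_add_integral (hbτ.integrable one_le_two) fun t ht => D.trace t ⟨ht.1, ht.2.trans hτ'⟩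
  · obtain ⟨ϕ, rfl⟩ : ∃ ϕ, lift ϕ = φ := ⟨φ.dx, lift_dx_of_mem_V hφ⟩
    simp only [lift_rep _ m1, lift_dx]
    rw [timeIoo_coe]
    have hcongr : ∀ s ∈ Icc 0 T, K * Psi p (prim (g s) 1) * prim ϕ 1 + (∫ x in Ioo (0 : ℝ) 1, S s x * (lift ϕ).rep x)
        - inner ℝ (g s) ϕ - lam * inner ℝ (k s) (lift ϕ).toL2 - mu * b s * prim ϕ 1
        = K * Psi p (prim (g s) 1) * prim ϕ 1 + inner ℝ (𝒮 s) (volterra ϕ) - inner ℝ (g s) ϕ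
          - lam * inner ℝ (k s) (volterra ϕ) - mu * b s * prim ϕ 1 := fun s hs => by
      rw [integral_mul_rep_eq_inner (hS s hs), lift_toL2]
    have hbi := D.integrableOn_b
    have hint := integrableOn_weak_source (mu := mu) hh h𝒮 hg hk hbi lam (prim ϕ 1) ϕ (volterra ϕ)
    refine HasWeakDerivOn.of_eq_add_integral
      (hint.congr_fun (fun s hs => (hcongr s (Ioc_subset_Icc_self hs)).symm) measurableSet_Ioc) fun t ht => ?_
    rw [intervalIntegral.integral_congr (g := fun s => K * Psi p (prim (g s) 1) * prim ϕ 1 + inner ℝ (𝒮 s) (volterra ϕ) - inner ℝ (g s) ϕ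
          - lam * inner ℝ (k s) (volterra ϕ) - mu * b s * prim ϕ 1) (fun s hs => hcongr s (by
            rw [uIcc_of_le ht.1] at hs; exact ⟨hs.1, hs.2.trans ht.2⟩)),
      integral_weak_source hh h𝒮 hg hk hbi lam (prim ϕ 1) ϕ (volterra ϕ) ht, lift_toL2, real_inner_comm, real_inner_comm (volterra ϕ) (k 0)]
    have hw := D.weak ϕ t ht
    have htr : prim (g t) 1 = prim (g 0) 1 + ∫ s in (0 : ℝ)..t, b s := D.trace t ht
    change _ + mu * prim (g t) 1 * prim ϕ 1 = _ + mu * prim (g 0) 1 * prim ϕ 1 + _ * prim ϕ 1 + _ at hw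
    rw [htr] at hw
    linear_combination hw

end WaveSystem

/-! ### Sources as operators on the state, and their truncation -/

namespace WaveSystem

theorem memLp_comp_prim (f : C(ℝ × ℝ, ℝ)) (g₁ g₂ : L2) :
    MemLp (fun x => f (prim g₁ x, prim g₂ (1 - x))) 2 (volume.restrict (Ioo (0 : ℝ) 1)) :=
  memLp_restrict_Ioo_of_continuousOn (f.continuous.comp_continuousOn
    ((continuousOn_prim g₁).prodMk ((continuousOn_prim g₂).comp (by fun_prop)
      fun x hx => ⟨by linarith [hx.2], by linarith [hx.1]⟩)))

/-- The superposition operator of `f`, in terms of derivatives: the second function is reflected. -/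
noncomputable def nemytskii (f : C(ℝ × ℝ, ℝ)) (g₁ g₂ : L2) : L2 := (memLp_comp_prim f g₁ g₂).toLp _

theorem nemytskii_ae (f : C(ℝ × ℝ, ℝ)) (g₁ g₂ : L2) :
    nemytskii f g₁ g₂ =ᵐ[volume.restrict (Ioo (0 : ℝ) 1)] fun x => f (prim g₁ x, prim g₂ (1 - x)) :=
  MemLp.coeFn_toLp _

theorem norm_prim_pair_le (x : (L2 × L2) × (L2 × L2)) (y z : ℝ) : ‖(prim x.1.1 y, prim x.2.1 z)‖ ≤ ‖x‖ :=
  max_le ((abs_prim_le _ _).trans ((norm_fst_le x.1).trans (norm_fst_le x)))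
    ((abs_prim_le _ _).trans ((norm_fst_le x.2).trans (norm_snd_le x)))

/-- Interior and boundary source acting on the first component of the state
`((g₁, k₁), (g₂, k₂))`. -/
noncomputable def source (lam : ℝ) (ψ : ℝ → ℝ) (f : C(ℝ × ℝ, ℝ)) (x : (L2 × L2) × (L2 × L2)) : L2 × ℝ :=
  (nemytskii f x.1.1 x.2.1 - lam • x.1.2, ψ (prim x.1.1 1))

/-- In one dimension `|prim g x| ≤ ‖g‖`, so a bound for the state is a uniform bound for the
functions, and the local Lipschitz constant of `f` applies pointwise. -/
theorem norm_nemytskii_sub_le {f : C(ℝ × ℝ, ℝ)} {L : NNReal} {R : ℝ} (hf : LipschitzOnWith L f (Metric.closedBall 0 R))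
    {x x' : (L2 × L2) × (L2 × L2)} (hx : ‖x‖ ≤ R) (hx' : ‖x'‖ ≤ R) :
    ‖nemytskii f x.1.1 x.2.1 - nemytskii f x'.1.1 x'.2.1‖ ≤ L * ‖x - x'‖ := by
  refine L2.norm_le_of_ae (f' := fun y => f (prim x.1.1 y, prim x.2.1 (1 - y)) - f (prim x'.1.1 y, prim x'.2.1 (1 - y)))
    ?_ (by positivity) fun y _ => ?_
  · filter_upwards [Lp.coeFn_sub (nemytskii f x.1.1 x.2.1) (nemytskii f x'.1.1 x'.2.1), nemytskii_ae f x.1.1 x.2.1,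
      nemytskii_ae f x'.1.1 x'.2.1] with y h1 h2 h3
    rw [h1, Pi.sub_apply, h2, h3]
  · have h := hf.dist_le_mul (prim x.1.1 y, prim x.2.1 (1 - y)) (by simpa using (norm_prim_pair_le x _ _).trans hx)
      (prim x'.1.1 y, prim x'.2.1 (1 - y)) (by simpa using (norm_prim_pair_le x' _ _).trans hx')
    rw [dist_eq_norm, dist_eq_norm, Prod.mk_sub_mk, ← prim_sub, ← prim_sub] at h
    exact h.trans (mul_le_mul_of_nonneg_left (norm_prim_pair_le (x - x') _ _) L.2)

theorem norm_source_sub_le {lam : ℝ} {ψ : ℝ → ℝ} {f : C(ℝ × ℝ, ℝ)} {L : NNReal} {R : ℝ}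
    (hf : LipschitzOnWith L f (Metric.closedBall 0 R)) (hψ : LipschitzOnWith L ψ (Metric.closedBall 0 R))
    {x x' : (L2 × L2) × (L2 × L2)} (hx : ‖x‖ ≤ R) (hx' : ‖x'‖ ≤ R) :
    ‖source lam ψ f x - source lam ψ f x'‖ ≤ (L + ‖lam‖) * ‖x - x'‖ := by
  refine max_le ?_ ?_
  · have e : (source lam ψ f x - source lam ψ f x').1
        = (nemytskii f x.1.1 x.2.1 - nemytskii f x'.1.1 x'.2.1) - lam • (x.1.2 - x'.1.2) := by
      simp only [source, Prod.fst_sub]; rw [smul_sub]; abel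
    rw [e, add_mul]
    refine (norm_sub_le _ _).trans (add_le_add (norm_nemytskii_sub_le hf hx hx') ?_)
    rw [norm_smul]
    exact mul_le_mul_of_nonneg_left ((norm_snd_le (x - x').1).trans (norm_fst_le (x - x'))) (norm_nonneg _)
  · have h1 : ∀ z : (L2 × L2) × (L2 × L2), |prim z.1.1 1| ≤ ‖z‖ := fun z =>
      (abs_prim_le _ _).trans ((norm_fst_le z.1).trans (norm_fst_le z))
    have h := hψ.dist_le_mul (prim x.1.1 1) (by simpa using (h1 x).trans hx) (prim x'.1.1 1) (by simpa using (h1 x').trans hx')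
    rw [dist_eq_norm, dist_eq_norm, ← prim_sub] at h
    refine h.trans ?_
    have h2 : ‖prim (x.1.1 - x'.1.1) 1‖ ≤ ‖x - x'‖ := h1 (x - x')
    calc L * ‖prim (x.1.1 - x'.1.1) 1‖ ≤ L * ‖x - x'‖ := mul_le_mul_of_nonneg_left h2 L.2
      _ ≤ _ := mul_le_mul_of_nonneg_right (by linarith [norm_nonneg lam]) (norm_nonneg _)

theorem continuous_nemytskii {f : C(ℝ × ℝ, ℝ)} (hf : ∀ R, ∃ L, LipschitzOnWith L f (Metric.closedBall 0 R)) :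
    Continuous fun x : (L2 × L2) × (L2 × L2) => nemytskii f x.1.1 x.2.1 := by
  rw [continuous_iff_continuousAt]
  intro x
  obtain ⟨L, hL⟩ := hf (‖x‖ + 1)
  have hLip : LipschitzOnWith L (fun x : (L2 × L2) × (L2 × L2) => nemytskii f x.1.1 x.2.1) (Metric.closedBall 0 (‖x‖ + 1)) :=
    LipschitzOnWith.of_dist_le_mul fun y hy z hz => by
      rw [dist_eq_norm, dist_eq_norm]
      exact norm_nemytskii_sub_le hL (by simpa using hy) (by simpa using hz)
  exact hLip.continuousOn.continuousAt (Metric.closedBall_mem_nhds_of_mem (by simp))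

/-- Truncation of a real number to `[-R, R]`. -/
noncomputable def clip (R x : ℝ) : ℝ := max (-R) (min R x)

theorem clip_eq {R x : ℝ} (h : |x| ≤ R) : clip R x = x := by
  rw [clip, min_eq_right (abs_le.1 h).2, max_eq_right (abs_le.1 h).1]

theorem abs_clip_le {R : ℝ} (hR : 0 ≤ R) (x : ℝ) : |clip R x| ≤ R :=
  abs_le.2 ⟨le_max_left _ _, max_le (by linarith) (min_le_left _ _)⟩

theorem lipschitzWith_clip (R : ℝ) : LipschitzWith 1 (clip R) :=
  (LipschitzWith.id.const_min R).const_max (-R)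

/-- Truncation in both variables. -/
noncomputable def clipPair (R : ℝ) : C(ℝ × ℝ, ℝ × ℝ) :=
  ⟨fun z => (clip R z.1, clip R z.2), ((lipschitzWith_clip R).continuous.comp continuous_fst).prodMk
    ((lipschitzWith_clip R).continuous.comp continuous_snd)⟩

theorem lipschitzWith_clipPair (R : ℝ) : LipschitzWith 1 (clipPair R) := by
  have := ((lipschitzWith_clip R).comp LipschitzWith.prod_fst).prodMk ((lipschitzWith_clip R).comp LipschitzWith.prod_snd)
  rw [mul_one, max_self] at this
  exact this

theorem lipschitzWith_comp_clipPair {f : C(ℝ × ℝ, ℝ)} {L : NNReal} {R : ℝ} (hR : 0 ≤ R)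
    (hf : LipschitzOnWith L f (Metric.closedBall 0 R)) : LipschitzWith L (f.comp (clipPair R)) := by
  have h := hf.comp (lipschitzWith_clipPair R).lipschitzOnWith (s := univ) (fun z _ => by
    rw [mem_closedBall_zero_iff]
    exact max_le (abs_clip_le hR _) (abs_clip_le hR _))
  rw [mul_one, lipschitzOnWith_univ] at h
  exact h

theorem lipschitzWith_comp_clip {ψ : ℝ → ℝ} {L : NNReal} {R : ℝ} (hR : 0 ≤ R)
    (hψ : LipschitzOnWith L ψ (Metric.closedBall 0 R)) : LipschitzWith L (ψ ∘ clip R) := by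
  have h := hψ.comp (lipschitzWith_clip R).lipschitzOnWith (s := univ) (fun z _ => by
    rw [mem_closedBall_zero_iff]
    exact abs_clip_le hR _)
  rwa [mul_one, lipschitzOnWith_univ] at h

theorem lipschitzWith_source {lam : ℝ} {ψ : ℝ → ℝ} {f : C(ℝ × ℝ, ℝ)} {L : NNReal} (hf : LipschitzWith L f)
    (hψ : LipschitzWith L ψ) : LipschitzWith (L + ‖lam‖₊) (source lam ψ f) :=
  LipschitzWith.of_dist_le_mul fun x y => by
    rw [dist_eq_norm, dist_eq_norm]
    exact norm_source_sub_le (R := max ‖x‖ ‖y‖) hf.lipschitzOnWith hψ.lipschitzOnWith (le_max_left _ _) (le_max_right _ _)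

/-- For a state of norm at most `R` all point values lie within `[-R, R]`, where truncation does
nothing. -/
theorem source_clip {lam R : ℝ} {ψ : ℝ → ℝ} {f : C(ℝ × ℝ, ℝ)} {x : (L2 × L2) × (L2 × L2)} (hx : ‖x‖ ≤ R) :
    source lam (ψ ∘ clip R) (f.comp (clipPair R)) x = source lam ψ f x := by
  have hf : nemytskii (f.comp (clipPair R)) x.1.1 x.2.1 = nemytskii f x.1.1 x.2.1 := by
    apply Lp.ext
    filter_upwards [nemytskii_ae (f.comp (clipPair R)) x.1.1 x.2.1, nemytskii_ae f x.1.1 x.2.1] with y h1 h2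
    have h := (norm_prim_pair_le x y (1 - y)).trans hx
    rw [h1, h2, ContinuousMap.comp_apply]
    congr 1
    exact Prod.ext (clip_eq ((norm_fst_le _).trans h)) (clip_eq ((norm_snd_le _).trans h))
  rw [source, source, hf, Function.comp, clip_eq ((norm_fst_le _).trans ((norm_prim_pair_le x 1 1).trans hx))]

theorem hasDerivAt_Psi {p : ℝ} (hp : 2 < p) (z : ℝ) : HasDerivAt (Psi p) ((p - 1) * |z| ^ (p - 2)) z := by
  have hpos : ∀ {z : ℝ}, 0 < z → HasDerivAt (Psi p) ((p - 1) * |z| ^ (p - 2)) z := by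
    intro z hz
    have h := Real.hasDerivAt_rpow_const (x := z) (p := p - 1) (Or.inl hz.ne')
    have e : p - 1 - 1 = p - 2 := by ring
    rw [e] at h
    rw [abs_of_pos hz]
    refine h.congr_of_eventuallyEq ?_
    filter_upwards [lt_mem_nhds hz] with y hy
    rw [Psi, abs_of_pos hy, ← Real.rpow_add_one hy.ne']
    congr 1; ring
  rcases lt_trichotomy z 0 with hz | rfl | hz
  · have h := ((hpos (neg_pos.2 hz)).scomp z (hasDerivAt_neg z)).neg
    have e : (fun y => -(Psi p ∘ Neg.neg) y) = Psi p := by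
      ext y; simp [Psi]
    simp only [smul_eq_mul, neg_mul, one_mul, neg_neg, abs_neg] at h
    rw [← e]
    exact h
  · have e : (p - 1) * |(0 : ℝ)| ^ (p - 2) = 0 := by
      rw [abs_zero, Real.zero_rpow (by linarith), mul_zero]
    rw [e, hasDerivAt_iff_tendsto_slope_zero]
    have hc : Continuous fun t : ℝ => |t| ^ (p - 2) := continuous_abs.rpow_const fun _ => Or.inr (by linarith)
    have h := hc.tendsto 0
    simp only [abs_zero, Real.zero_rpow (by linarith : p - 2 ≠ 0)] at h
    refine (h.mono_left nhdsWithin_le_nhds).congr' ?_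
    filter_upwards [self_mem_nhdsWithin] with t ht
    have ht : t ≠ 0 := ht
    simp only [Psi, zero_add, mul_zero, sub_zero, smul_eq_mul]
    field_simp
  · exact hpos hz

theorem exists_lipschitzOnWith_mul_Psi {p : ℝ} (hp : 2 < p) (K R : ℝ) :
    ∃ L, LipschitzOnWith L (fun z => K * Psi p z) (Metric.closedBall 0 R) := by
  refine ⟨(|K| * ((p - 1) * |R| ^ (p - 2))).toNNReal,
    Convex.lipschitzOnWith_of_nnnorm_hasDerivWithin_le (convex_closedBall 0 R)
      (fun z _ => ((hasDerivAt_Psi hp z).const_mul K).hasDerivWithinAt) fun z hz => ?_⟩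
  rw [mem_closedBall_zero_iff] at hz
  rw [← NNReal.coe_le_coe]
  rw [coe_nnnorm, Real.coe_toNNReal _ (mul_nonneg (abs_nonneg _) (mul_nonneg (by linarith) (by positivity)))]
  rw [norm_mul, norm_mul, Real.norm_eq_abs, Real.norm_eq_abs, Real.norm_eq_abs, abs_of_pos (by linarith : 0 < p - 1),
    abs_of_nonneg (by positivity : 0 ≤ |z| ^ (p - 2))]
  exact mul_le_mul_of_nonneg_left (mul_le_mul_of_nonneg_left (Real.rpow_le_rpow (abs_nonneg z) (hz.trans (le_abs_self R))
    (by linarith)) (by linarith)) (abs_nonneg K)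

end WaveSystem

/-! ### Local existence on a time that depends only on the size of the state -/

namespace WaveSystem

theorem DampedWave.sq_add_sq_le {𝓗 : Type*} [NormedAddCommGroup 𝓗] [InnerProductSpace ℝ 𝓗] [CompleteSpace 𝓗]
    {J : 𝓗 →L[ℝ] 𝓗} {e : 𝓗} {μ τ : ℝ} {G : ℝ → 𝓗} {h : ℝ → ℝ} {g k : ℝ → 𝓗} {b : ℝ → ℝ}
    (S : DampedWave J e μ τ G h g k b) (hμ : 0 < μ) (hτ : 0 < τ) (hτ1 : τ ≤ 1) {M R : ℝ} (hg0 : ‖g 0‖ ≤ R) (hk0 : ‖k 0‖ ≤ R)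
    (hG : ∀ t ∈ Icc 0 τ, ‖G t‖ ≤ M) (hh : ∀ t ∈ Icc 0 τ, |h t| ≤ M) {t : ℝ} (ht : t ∈ Icc 0 τ) :
    ‖k t‖ ^ 2 + ‖g t‖ ^ 2 ≤ 3 * (2 * R ^ 2 + τ * ((μ⁻¹ + 1) * M ^ 2)) := by
  have m0 : (0 : ℝ) ∈ Icc 0 τ := ⟨le_rfl, hτ.le⟩
  have mτ : τ ∈ Icc 0 τ := ⟨hτ.le, le_rfl⟩
  have D : ∫ s in (0 : ℝ)..τ, (μ⁻¹ * h s ^ 2 + ‖G s‖ ^ 2) ≤ τ * ((μ⁻¹ + 1) * M ^ 2) := by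
    have i1 : IntervalIntegrable (fun s => μ⁻¹ * h s ^ 2 + ‖G s‖ ^ 2) volume 0 τ := by
      refine IntervalIntegrable.add (IntervalIntegrable.const_mul ?_ _) (intervalIntegrable_sq_of_memLp_Ioc S.memLp_G m0 mτ)
      simpa using intervalIntegrable_sq_of_memLp_Ioc S.memLp_h m0 mτ
    calc _ ≤ ∫ s in (0 : ℝ)..τ, (μ⁻¹ + 1) * M ^ 2 := by
          refine intervalIntegral.integral_mono_on hτ.le i1 (by simp) fun s hs => ?_
          have h1 : h s ^ 2 ≤ M ^ 2 := by rw [← sq_abs]; exact pow_le_pow_left₀ (abs_nonneg _) (hh s hs) 2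
          have h2 := pow_le_pow_left₀ (norm_nonneg _) (hG s hs) 2
          nlinarith [mul_le_mul_of_nonneg_left h1 (inv_pos.2 hμ).le]
      _ = _ := by simp; ring
  have hst := (S.stability hμ hτ ht).1
  have he : Real.exp t ≤ 3 := by
    have := Real.exp_le_exp.2 (ht.2.trans hτ1)
    linarith [Real.exp_one_lt_d9]
  have h1 := pow_le_pow_left₀ (norm_nonneg _) hg0 2
  have h2 := pow_le_pow_left₀ (norm_nonneg _) hk0 2
  have hD0 : 0 ≤ ∫ s in (0 : ℝ)..τ, (μ⁻¹ * h s ^ 2 + ‖G s‖ ^ 2) :=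
    intervalIntegral.integral_nonneg hτ.le fun s _ => by positivity
  refine hst.trans ?_
  have h3 := mul_le_mul_of_nonneg_left he (by positivity : 0 ≤ ‖k 0‖ ^ 2 + ‖g 0‖ ^ 2 + ∫ s in (0 : ℝ)..τ, (μ⁻¹ * h s ^ 2 + ‖G s‖ ^ 2))
  linarith

/-- A short-time bound for a coupled system whose sources grow at most linearly. -/
theorem CoupledWave.norm_le {𝓗 : Type*} [NormedAddCommGroup 𝓗] [InnerProductSpace ℝ 𝓗] [CompleteSpace 𝓗]
    {J : 𝓗 →L[ℝ] 𝓗} {e : 𝓗} {μ₁ μ₂ δ : ℝ} {Φ₁ Φ₂ : (𝓗 × 𝓗) × (𝓗 × 𝓗) → 𝓗 × ℝ} {x : ℝ → (𝓗 × 𝓗) × (𝓗 × 𝓗)} {b₁ b₂ : ℝ → ℝ}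
    (S : CoupledWave J e μ₁ μ₂ Φ₁ Φ₂ δ x b₁ b₂) (hμ₁ : 0 < μ₁) (hμ₂ : 0 < μ₂) {c L R : ℝ} (hL : 0 ≤ L)
    (h₁ : ∀ z, ‖Φ₁ z‖ ≤ c + L * ‖z‖) (h₂ : ∀ z, ‖Φ₂ z‖ ≤ c + L * ‖z‖) (hδ : 0 < δ) (hδ1 : δ ≤ 1)
    (hsmall : 6 * δ * ((μ₁⁻¹ + μ₂⁻¹ + 1) * (c ^ 2 + L ^ 2)) ≤ 1 / 2) (h0 : ‖x 0‖ ≤ R) :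
    ∀ t ∈ Icc 0 δ, ‖x t‖ ≤ 4 * R + 1 := by
  have hR : 0 ≤ R := (norm_nonneg _).trans h0
  -- With the maximum `m` of the norm the sources are at most `c + L m`. Stability at the maximal
  -- time and the smallness of `δ` give `m² ≤ 6R² + 1/2 + m²/2`, hence `m² ≤ 12R² + 1 ≤ (4R + 1)²`.
  obtain ⟨s, hs, hmax⟩ := isCompact_Icc.exists_isMaxOn ⟨0, le_rfl, hδ.le⟩ S.continuousOn.norm
  set m := ‖x s‖ with hm
  have hmax' : ∀ t ∈ Icc 0 δ, ‖x t‖ ≤ m := fun t ht => hmax ht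
  have hΦ : ∀ Φ : (𝓗 × 𝓗) × (𝓗 × 𝓗) → 𝓗 × ℝ, (∀ z, ‖Φ z‖ ≤ c + L * ‖z‖) → ∀ t ∈ Icc 0 δ, ‖Φ (x t)‖ ≤ c + L * m := fun Φ h t ht =>
    (h _).trans (by have := mul_le_mul_of_nonneg_left (hmax' t ht) hL; linarith)
  have bd₁ := S.fst.sq_add_sq_le hμ₁ hδ hδ1 ((norm_fst_le _).trans ((norm_fst_le _).trans h0)) ((norm_snd_le _).trans ((norm_fst_le _).trans h0))
    (fun t ht => (norm_fst_le _).trans (hΦ Φ₁ h₁ t ht)) (fun t ht => (norm_snd_le _).trans (hΦ Φ₁ h₁ t ht)) hs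
  have bd₂ := S.snd.sq_add_sq_le hμ₂ hδ hδ1 ((norm_fst_le _).trans ((norm_snd_le _).trans h0)) ((norm_snd_le _).trans ((norm_snd_le _).trans h0))
    (fun t ht => (norm_fst_le _).trans (hΦ Φ₂ h₂ t ht)) (fun t ht => (norm_snd_le _).trans (hΦ Φ₂ h₂ t ht)) hs
  have i1 := inv_pos.2 hμ₁
  have i2 := inv_pos.2 hμ₂
  set C := μ₁⁻¹ + μ₂⁻¹ + 1 with hC
  have up : ∀ a, a ≤ C → 3 * (2 * R ^ 2 + δ * (a * (c + L * m) ^ 2)) ≤ 6 * R ^ 2 + 1 / 2 + m ^ 2 / 2 := by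
    intro a ha
    have e1 : (c + L * m) ^ 2 ≤ 2 * (c ^ 2 + L ^ 2) * (1 + m ^ 2) := by
      nlinarith [sq_nonneg (c - L * m), mul_nonneg (sq_nonneg c) (sq_nonneg m), sq_nonneg L]
    have e2 : a * (c + L * m) ^ 2 ≤ C * (2 * (c ^ 2 + L ^ 2) * (1 + m ^ 2)) :=
      (mul_le_mul_of_nonneg_right ha (sq_nonneg _)).trans (mul_le_mul_of_nonneg_left e1 (by positivity))
    have e3 := mul_le_mul_of_nonneg_left e2 hδ.le
    have e4 := mul_le_mul_of_nonneg_right hsmall (by positivity : 0 ≤ 1 + m ^ 2)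
    nlinarith
  have b1 := bd₁.trans (up _ (by rw [hC]; linarith))
  have b2 := bd₂.trans (up _ (by rw [hC]; linarith))
  have hm2 : m ^ 2 ≤ 6 * R ^ 2 + 1 / 2 + m ^ 2 / 2 := by
    have hcases : m = ‖(x s).1.1‖ ∨ m = ‖(x s).1.2‖ ∨ m = ‖(x s).2.1‖ ∨ m = ‖(x s).2.2‖ := by
      rw [hm, Prod.norm_def, Prod.norm_def, Prod.norm_def]
      rcases max_choice (max ‖(x s).1.1‖ ‖(x s).1.2‖) (max ‖(x s).2.1‖ ‖(x s).2.2‖) with h | h <;> rw [h]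
      · rcases max_choice ‖(x s).1.1‖ ‖(x s).1.2‖ with h | h <;> rw [h] <;> simp
      · rcases max_choice ‖(x s).2.1‖ ‖(x s).2.2‖ with h | h <;> rw [h] <;> simp
    rcases hcases with h | h | h | h
    · rw [← h] at b1; linarith [sq_nonneg ‖(x s).1.2‖]
    · rw [← h] at b1; linarith [sq_nonneg ‖(x s).1.1‖]
    · rw [← h] at b2; linarith [sq_nonneg ‖(x s).2.2‖]
    · rw [← h] at b2; linarith [sq_nonneg ‖(x s).2.1‖]
  intro t ht
  refine (hmax' t ht).trans ?_
  exact abs_le_of_sq_le_sq' (by nlinarith) (by positivity) |>.2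

/-- Local existence for the system with locally Lipschitz sources, on a time interval whose length depends
only on a bound for the initial state. -/
theorem exists_coupledWave_source {lam₁ lam₂ mu₁ mu₂ K₁ K₂ p₁ p₂ : ℝ} (hmu₁ : 0 < mu₁) (hmu₂ : 0 < mu₂) (hp₁ : 2 < p₁) (hp₂ : 2 < p₂)
    {φ₁ φ₂ : C(ℝ × ℝ, ℝ)} (hφ₁ : ∀ R, ∃ L, LipschitzOnWith L φ₁ (Metric.closedBall 0 R))
    (hφ₂ : ∀ R, ∃ L, LipschitzOnWith L φ₂ (Metric.closedBall 0 R)) {R : ℝ} (hR : 0 ≤ R) :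
    ∃ δ > 0, ∀ x₀, ‖x₀‖ ≤ R → ∃ x b₁ b₂, CoupledWave volterra (chi 1) mu₁ mu₂ (source lam₁ (fun z => K₁ * Psi p₁ z) φ₁)
      (fun x => source lam₂ (fun z => K₂ * Psi p₂ z) φ₂ x.swap) δ x b₁ b₂ ∧ x 0 = x₀ := by
  -- The level of truncation is the bound of `CoupledWave.norm_le`, so that the solution of the
  -- truncated problem never notices the truncation.
  set R' := 4 * R + 1 with hR'
  have hR'0 : 0 ≤ R' := by positivity
  obtain ⟨L₁, hL₁⟩ := hφ₁ R'
  obtain ⟨L₂, hL₂⟩ := hφ₂ R'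
  obtain ⟨L₃, hL₃⟩ := exists_lipschitzOnWith_mul_Psi hp₁ K₁ R'
  obtain ⟨L₄, hL₄⟩ := exists_lipschitzOnWith_mul_Psi hp₂ K₂ R'
  set L : NNReal := L₁ + L₂ + L₃ + L₄ + ‖lam₁‖₊ + ‖lam₂‖₊ with hL
  set Φ₁ := source lam₁ ((fun z => K₁ * Psi p₁ z) ∘ clip R') (φ₁.comp (clipPair R')) with hΦ₁
  set Φ₂ : (L2 × L2) × (L2 × L2) → L2 × ℝ := fun x => source lam₂ ((fun z => K₂ * Psi p₂ z) ∘ clip R') (φ₂.comp (clipPair R')) x.swap with hΦ₂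
  have lip₁ : LipschitzWith L Φ₁ := by
    have h := lipschitzWith_source (lam := lam₁) ((lipschitzWith_comp_clipPair hR'0 hL₁).weaken (le_max_left L₁ L₃))
      ((lipschitzWith_comp_clip hR'0 hL₃).weaken (le_max_right L₁ L₃))
    refine h.weaken ?_
    have : max L₁ L₃ ≤ L₁ + L₃ := max_le (by simp) (by simp)
    calc max L₁ L₃ + ‖lam₁‖₊ ≤ L₁ + L₃ + ‖lam₁‖₊ := by gcongr
      _ ≤ L₁ + L₃ + ‖lam₁‖₊ + (L₂ + L₄ + ‖lam₂‖₊) := by simp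
      _ = L := by rw [hL]; ring
  have lip₂ : LipschitzWith L Φ₂ := by
    have h := lipschitzWith_source (lam := lam₂) ((lipschitzWith_comp_clipPair hR'0 hL₂).weaken (le_max_left L₂ L₄))
      ((lipschitzWith_comp_clip hR'0 hL₄).weaken (le_max_right L₂ L₄))
    have hsw : LipschitzWith 1 (Prod.swap : (L2 × L2) × (L2 × L2) → _) := by
      have := (LipschitzWith.prod_snd (α := L2 × L2) (β := L2 × L2)).prodMk LipschitzWith.prod_fst
      rw [max_self] at this
      exact this
    have h' := h.comp hsw
    rw [mul_one] at h'
    refine h'.weaken ?_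
    have : max L₂ L₄ ≤ L₂ + L₄ := max_le (by simp) (by simp)
    calc max L₂ L₄ + ‖lam₂‖₊ ≤ L₂ + L₄ + ‖lam₂‖₊ := by gcongr
      _ ≤ L₂ + L₄ + ‖lam₂‖₊ + (L₁ + L₃ + ‖lam₁‖₊) := by simp
      _ = L := by rw [hL]; ring
  obtain ⟨δ₀, hδ₀, hex⟩ := exists_coupledWave hmu₁ hmu₂ (homogeneousSolvable_volterra hmu₁) (homogeneousSolvable_volterra hmu₂) lip₁ lip₂
  set c := max ‖Φ₁ 0‖ ‖Φ₂ 0‖ with hc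
  have grow : ∀ {Φ : (L2 × L2) × (L2 × L2) → L2 × ℝ}, LipschitzWith L Φ → ‖Φ 0‖ ≤ c → ∀ z, ‖Φ z‖ ≤ c + L * ‖z‖ := by
    intro Φ h h0 z
    have := h.dist_le_mul z 0
    rw [dist_eq_norm, dist_zero_right] at this
    linarith [norm_le_norm_sub_add (Φ z) (Φ 0)]
  set D := 6 * ((mu₁⁻¹ + mu₂⁻¹ + 1) * (c ^ 2 + (L : ℝ) ^ 2)) with hD
  have i1 := inv_pos.2 hmu₁
  have i2 := inv_pos.2 hmu₂
  have hD0 : 0 ≤ D := by positivity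
  -- The three bounds serve the contraction, the estimate `exp t ≤ 3`, and the smallness condition
  -- `δ D ≤ 1/2`.
  set δ := min δ₀ (min 1 (1 / (2 * (D + 1)))) with hδ
  have hδpos : 0 < δ := by positivity
  refine ⟨δ, hδpos, fun x₀ hx₀ => ?_⟩
  obtain ⟨x, b₁, b₂, S, hx0⟩ := hex δ hδpos (min_le_left _ _) x₀
  have hbd := S.norm_le hmu₁ hmu₂ L.2 (grow lip₁ (le_max_left _ _)) (grow lip₂ (le_max_right _ _)) hδpos
    ((min_le_right _ _).trans (min_le_left _ _)) (by
      have h1 : δ ≤ 1 / (2 * (D + 1)) := (min_le_right _ _).trans (min_le_right _ _)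
      have h2 := mul_le_mul_of_nonneg_right h1 hD0
      have h3 : 1 / (2 * (D + 1)) * D ≤ 1 / 2 := by
        rw [div_mul_eq_mul_div, div_le_iff₀ (by positivity)]; linarith
      have h4 : 6 * δ * ((mu₁⁻¹ + mu₂⁻¹ + 1) * (c ^ 2 + (L : ℝ) ^ 2)) = δ * D := by rw [hD]; ring
      rw [show ((L.1 : ℝ)) = (L : ℝ) from rfl, h4]; linarith) (hx0 ▸ hx₀)
  refine ⟨x, b₁, b₂, S.congr_sources (fun t ht => ?_) (fun t ht => ?_), hx0⟩
  · exact (source_clip (hbd t ht)).symm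
  · refine (source_clip ?_).symm
    have : ‖(x t).swap‖ = ‖x t‖ := by rw [Prod.norm_def, Prod.norm_def]; exact max_comm _ _
    rw [this]; exact hbd t ht

end WaveSystem

/-! ### Passage between the system and its first order form -/

namespace WaveSystem

theorem SourceCondition.hasFDerivAt {f₁ f₂ F : ℝ → ℝ → ℝ} {α β d₁ d₂ e₁ e₂ : ℝ} (hF : SourceCondition f₁ f₂ F α β d₁ d₂ e₁ e₂)
    (z : ℝ × ℝ) : HasFDerivAt (fun z : ℝ × ℝ => F z.1 z.2)
      (f₁ z.1 z.2 • ContinuousLinearMap.fst ℝ ℝ ℝ + f₂ z.1 z.2 • ContinuousLinearMap.snd ℝ ℝ ℝ) z := by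
  have hd := (hF.contDiff.differentiable (by norm_num) z).hasFDerivAt
  set D := fderiv ℝ (fun z : ℝ × ℝ => F z.1 z.2) z with hD
  have h1 : D (1, 0) = f₁ z.1 z.2 := by
    have hc : HasDerivAt (fun s : ℝ => (s, z.2)) ((1 : ℝ), (0 : ℝ)) z.1 := (hasDerivAt_id _).prodMk (hasDerivAt_const _ _)
    exact (HasFDerivAt.comp_hasDerivAt (f := fun s : ℝ => (s, z.2)) z.1 hd hc).unique (hF.hasDerivAt_fst z.1 z.2)
  have h2 : D (0, 1) = f₂ z.1 z.2 := by
    have hc : HasDerivAt (fun s : ℝ => (z.1, s)) ((0 : ℝ), (1 : ℝ)) z.2 := (hasDerivAt_const _ _).prodMk (hasDerivAt_id _)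
    exact (HasFDerivAt.comp_hasDerivAt (f := fun s : ℝ => (z.1, s)) z.2 hd hc).unique (hF.hasDerivAt_snd z.1 z.2)
  have e : f₁ z.1 z.2 • ContinuousLinearMap.fst ℝ ℝ ℝ + f₂ z.1 z.2 • ContinuousLinearMap.snd ℝ ℝ ℝ = D := by
    ext
    · simp [h1]
    · simp [h2]
  rw [e]
  exact hd

theorem SourceCondition.contDiff_fst {f₁ f₂ F : ℝ → ℝ → ℝ} {α β d₁ d₂ e₁ e₂ : ℝ} (hF : SourceCondition f₁ f₂ F α β d₁ d₂ e₁ e₂) :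
    ContDiff ℝ 1 fun z : ℝ × ℝ => f₁ z.1 z.2 := by
  have h : ContDiff ℝ 1 (fderiv ℝ fun z : ℝ × ℝ => F z.1 z.2) := hF.contDiff.fderiv_right (by norm_num)
  have e : (fun z : ℝ × ℝ => f₁ z.1 z.2) = fun z => fderiv ℝ (fun z : ℝ × ℝ => F z.1 z.2) z (1, 0) := by
    ext z; rw [(hF.hasFDerivAt z).fderiv]; simp
  rw [e]
  exact h.clm_apply contDiff_const

theorem SourceCondition.contDiff_snd {f₁ f₂ F : ℝ → ℝ → ℝ} {α β d₁ d₂ e₁ e₂ : ℝ} (hF : SourceCondition f₁ f₂ F α β d₁ d₂ e₁ e₂) :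
    ContDiff ℝ 1 fun z : ℝ × ℝ => f₂ z.1 z.2 := by
  have h : ContDiff ℝ 1 (fderiv ℝ fun z : ℝ × ℝ => F z.1 z.2) := hF.contDiff.fderiv_right (by norm_num)
  have e : (fun z : ℝ × ℝ => f₂ z.1 z.2) = fun z => fderiv ℝ (fun z : ℝ × ℝ => F z.1 z.2) z (0, 1) := by
    ext z; rw [(hF.hasFDerivAt z).fderiv]; simp
  rw [e]
  exact h.clm_apply contDiff_const

theorem exists_lipschitzOnWith_closedBall {f : ℝ × ℝ → ℝ} (hf : ContDiff ℝ 1 f) (R : ℝ) :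
    ∃ L, LipschitzOnWith L f (Metric.closedBall 0 R) := by
  obtain ⟨C, hC⟩ := (isCompact_closedBall (0 : ℝ × ℝ) R).exists_bound_of_continuousOn
    (hf.continuous_fderiv (by norm_num)).continuousOn
  refine ⟨C.toNNReal, Convex.lipschitzOnWith_of_nnnorm_fderiv_le (𝕜 := ℝ) (fun z _ => hf.differentiable (by norm_num) z)
    (fun z hz => ?_) (convex_closedBall 0 R)⟩
  rw [← NNReal.coe_le_coe, coe_nnnorm]
  exact (hC z hz).trans (Real.le_coe_toNNReal C)

section

variable {P : Params} {f₁ f₂ : ℝ → ℝ → ℝ} {u₀ v₀ : H1} {u₁ v₁ : L2} {T : EReal} {u v : ℝ → H1} {u' v' : ℝ → L2}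
  {φ₁ φ₂ : C(ℝ × ℝ, ℝ)}

/-- The state `((u_x, u_t), (-v_x(1 - ·), v_t(1 - ·)))` of the first order system. -/
noncomputable def state (u v : H1) (u' v' : L2) : (L2 × L2) × (L2 × L2) :=
  ((u.dx, u'), (v.reflect.dx, reflect v'))

theorem norm_state_le (u v : H1) (u' v' : L2) : ‖state u v u' v'‖ ≤ ‖u‖ + ‖v‖ + ‖u'‖ + ‖v'‖ := by
  have h1 := u.norm_dx_le
  have h2 : ‖v.reflect.dx‖ ≤ ‖v‖ := by rw [H1.reflect_dx, norm_neg, LinearIsometry.norm_map]; exact v.norm_dx_le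
  have h3 : ‖reflect v'‖ = ‖v'‖ := LinearIsometry.norm_map _ _
  have := norm_nonneg u
  have := norm_nonneg v
  have := norm_nonneg u'
  have := norm_nonneg v'
  refine max_le (max_le ?_ ?_) (max_le ?_ ?_) <;> simp only [state] <;> linarith

/-- The coupled first order system that belongs to the parameters `P` and the sources `φ₁`, `φ₂`. -/
abbrev IsCoupled (P : Params) (φ₁ φ₂ : C(ℝ × ℝ, ℝ)) (τ : ℝ) (x : ℝ → (L2 × L2) × (L2 × L2)) (b₁ b₂ : ℝ → ℝ) : Prop :=
  CoupledWave volterra (chi 1) P.mu₁ P.mu₂ (source P.lam₁ (fun z => P.K₁ * Psi P.p₁ z) φ₁)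
    (fun x => source P.lam₂ (fun z => P.K₂ * Psi P.p₂ z) φ₂ x.swap) τ x b₁ b₂

theorem IsWeakSolution.mem_V_reflect (h : IsWeakSolution P f₁ f₂ u₀ v₀ u₁ v₁ T u v u' v') {t : ℝ} (ht : t ∈ timeIco T) :
    (v t).reflect ∈ V 0 := by
  have := H1.reflect_mem_V ⟨zero_le_one, le_rfl⟩ (h.snd.dirichlet t ht)
  rwa [sub_self] at this

theorem IsWeakSolution.rep_fst (h : IsWeakSolution P f₁ f₂ u₀ v₀ u₁ v₁ T u v u' v') {t : ℝ} (ht : t ∈ timeIco T)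
    {x : ℝ} (hx : x ∈ Icc (0 : ℝ) 1) : (u t).rep x = prim (u t).dx x := H1.rep_of_mem_V (h.fst.dirichlet t ht) hx

theorem IsWeakSolution.rep_snd (h : IsWeakSolution P f₁ f₂ u₀ v₀ u₁ v₁ T u v u' v') {t : ℝ} (ht : t ∈ timeIco T)
    {x : ℝ} (hx : x ∈ Icc (0 : ℝ) 1) : (v t).rep x = prim (v t).reflect.dx (1 - x) := by
  have hx' : 1 - x ∈ Icc (0 : ℝ) 1 := ⟨by linarith [hx.2], by linarith [hx.1]⟩
  rw [← H1.rep_of_mem_V (h.mem_V_reflect ht) hx', H1.reflect_rep _ hx', sub_sub_cancel]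

theorem IsWeakSolution.continuousOn_state (h : IsWeakSolution P f₁ f₂ u₀ v₀ u₁ v₁ T u v u' v') :
    ContinuousOn (fun t => state (u t) (v t) (u' t) (v' t)) (timeIco T) :=
  ((H1.continuous_dx.comp_continuousOn h.fst.continuousOn).prodMk h.fst.continuousOn_deriv).prodMk
    (((H1.continuous_dx.comp H1.continuous_reflect).comp_continuousOn h.snd.continuousOn).prodMk
      (reflect.continuous.comp_continuousOn h.snd.continuousOn_deriv))

/-- `nemytskii` reflects its second argument. In the equation for the reflected `v` that argument
must be `u`, so the unknowns trade places; this is why `φ₂` has its arguments in the order `(b, a)`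
and the state is swapped. -/
theorem IsWeakSolution.isCoupled (h : IsWeakSolution P f₁ f₂ u₀ v₀ u₁ v₁ T u v u' v') (hp₁ : 2 < P.p₁) (hp₂ : 2 < P.p₂)
    (hφ₁ : ∀ R, ∃ L, LipschitzOnWith L φ₁ (Metric.closedBall 0 R)) (hφ₂ : ∀ R, ∃ L, LipschitzOnWith L φ₂ (Metric.closedBall 0 R))
    (h₁ : ∀ a b, φ₁ (a, b) = f₁ a b) (h₂ : ∀ a b, φ₂ (b, a) = f₂ a b) :
    ∃ b₁ b₂ : ℝ → ℝ, ∀ τ : ℝ, 0 < τ → (τ : EReal) < T →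
      IsCoupled P φ₁ φ₂ τ (fun t => state (u t) (v t) (u' t) (v' t)) b₁ b₂ := by
  have hc := h.continuousOn_state
  have hcs : ContinuousOn (fun t => (state (u t) (v t) (u' t) (v' t)).swap) (timeIco T) := continuous_swap.comp_continuousOn hc
  obtain ⟨b₁, hb₁⟩ := h.fst.dampedWave hp₁ ((continuous_nemytskii hφ₁).comp_continuousOn hc) (fun t ht => by
    filter_upwards [nemytskii_ae φ₁ (u t).dx (v t).reflect.dx, ae_restrict_mem measurableSet_Ioo] with x hx hm
    have hm' := Ioo_subset_Icc_self hm
    simp only [state, Function.comp_def]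
    rw [hx, h₁, h.rep_fst ht hm', h.rep_snd ht hm'])
  have hs := h.snd.reflect ⟨zero_le_one, le_rfl⟩ ⟨le_rfl, zero_le_one⟩
  rw [sub_self, sub_zero] at hs
  obtain ⟨b₂, hb₂⟩ := hs.dampedWave hp₂ ((continuous_nemytskii hφ₂).comp_continuousOn hcs) (fun t ht => by
    filter_upwards [nemytskii_ae φ₂ (v t).reflect.dx (u t).dx, ae_restrict_mem measurableSet_Ioo] with x hx hm
    have hm' : 1 - x ∈ Icc (0 : ℝ) 1 := ⟨by linarith [hm.2], by linarith [hm.1]⟩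
    simp only [state, Function.comp_def, Prod.swap]
    rw [hx, h₂, h.rep_fst ht hm', h.rep_snd ht hm', sub_sub_cancel])
  exact ⟨b₁, b₂, fun τ h0 hτ => ⟨hb₁ τ h0 hτ, hb₂ τ h0 hτ⟩⟩

theorem IsCoupled.isWeakSolution {T : ℝ} {x : ℝ → (L2 × L2) × (L2 × L2)} {b₁ b₂ : ℝ → ℝ} (S : IsCoupled P φ₁ φ₂ T x b₁ b₂)
    (hp₁ : 2 < P.p₁) (hp₂ : 2 < P.p₂)
    (hφ₁ : ∀ R, ∃ L, LipschitzOnWith L φ₁ (Metric.closedBall 0 R)) (hφ₂ : ∀ R, ∃ L, LipschitzOnWith L φ₂ (Metric.closedBall 0 R))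
    (h₁ : ∀ a b, φ₁ (a, b) = f₁ a b) (h₂ : ∀ a b, φ₂ (b, a) = f₂ a b) :
    IsWeakSolution P f₁ f₂ (lift (x 0).1.1) (lift (x 0).2.1).reflect (x 0).1.2 (reflect (x 0).2.2) T
      (fun t => lift (x t).1.1) (fun t => (lift (x t).2.1).reflect) (fun t => (x t).1.2) (fun t => reflect (x t).2.2) := by
  have hc := S.continuousOn
  have hcs : ContinuousOn (fun t => (x t).swap) (Icc 0 T) := continuous_swap.comp_continuousOn hc
  have rs : ∀ {t y : ℝ}, y ∈ Icc (0 : ℝ) 1 → (lift (x t).2.1).reflect.rep y = prim (x t).2.1 (1 - y) := fun {t y} hy => by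
    rw [H1.reflect_rep _ hy, lift_rep _ ⟨by linarith [hy.2], by linarith [hy.1]⟩]
  refine ⟨?_, ?_, rfl, rfl, rfl, rfl⟩
  · refine IsWeakComponent.of_dampedWave hp₁ ((continuous_nemytskii hφ₁).comp_continuousOn hc) (fun t ht => ?_) S.fst
    filter_upwards [nemytskii_ae φ₁ (x t).1.1 (x t).2.1, ae_restrict_mem measurableSet_Ioo] with y hy hm
    have hm' := Ioo_subset_Icc_self hm
    simp only [Function.comp_def]
    rw [hy, h₁, lift_rep _ hm', rs hm']
  · have key : IsWeakComponent P.lam₂ P.mu₂ P.K₂ P.p₂ 0 1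
        (fun t y => f₂ ((lift (x t).1.1).rep (1 - y)) ((lift (x t).2.1).rep y)) T (fun t => lift (x t).2.1) (fun t => (x t).2.2) := by
      refine IsWeakComponent.of_dampedWave hp₂ ((continuous_nemytskii hφ₂).comp_continuousOn hcs) (fun t ht => ?_) S.snd
      filter_upwards [nemytskii_ae φ₂ (x t).2.1 (x t).1.1, ae_restrict_mem measurableSet_Ioo] with y hy hm
      have hm' : 1 - y ∈ Icc (0 : ℝ) 1 := ⟨by linarith [hm.2], by linarith [hm.1]⟩
      simp only [Function.comp_def, Prod.swap]
      rw [hy, h₂, lift_rep _ hm', lift_rep _ (Ioo_subset_Icc_self hm)]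
    have hr := key.reflect ⟨le_rfl, zero_le_one⟩ ⟨zero_le_one, le_rfl⟩
    rw [sub_self, sub_zero] at hr
    refine hr.congr_source fun t y hy => ?_
    rw [sub_sub_cancel, H1.reflect_rep _ hy]

end

end WaveSystem

/-! ### Uniqueness and continuation -/

namespace WaveSystem

theorem exists_norm_source_sub_le {lam K p : ℝ} (hp : 2 < p) {φ : C(ℝ × ℝ, ℝ)}
    (hφ : ∀ R, ∃ L, LipschitzOnWith L φ (Metric.closedBall 0 R)) (R : ℝ) :
    ∃ L : ℝ, 0 ≤ L ∧ ∀ x x' : (L2 × L2) × (L2 × L2), ‖x‖ ≤ R → ‖x'‖ ≤ R →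
      ‖source lam (fun z => K * Psi p z) φ x - source lam (fun z => K * Psi p z) φ x'‖ ≤ L * ‖x - x'‖ := by
  obtain ⟨L₁, hL₁⟩ := hφ R
  obtain ⟨L₂, hL₂⟩ := exists_lipschitzOnWith_mul_Psi hp K R
  refine ⟨(max L₁ L₂ : NNReal) + ‖lam‖, by positivity, fun x x' hx hx' => ?_⟩
  exact norm_source_sub_le (LipschitzOnWith.weaken hL₁ (le_max_left _ _)) (LipschitzOnWith.weaken hL₂ (le_max_right _ _)) hx hx'

theorem norm_swap {E : Type*} [NormedAddCommGroup E] (x : E × E) : ‖x.swap‖ = ‖x‖ := by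
  rw [Prod.norm_def, Prod.norm_def]; exact max_comm _ _

section

variable {P : Params} {f₁ f₂ : ℝ → ℝ → ℝ} {u₀ v₀ : H1} {u₁ v₁ : L2} {u v : ℝ → H1} {u' v' : ℝ → L2}
  {φ₁ φ₂ : C(ℝ × ℝ, ℝ)}

/-- Both trajectories are bounded on the compact interval, so a Lipschitz constant on one ball
suffices. -/
theorem IsCoupled.eqOn {τ : ℝ} {x x' : ℝ → (L2 × L2) × (L2 × L2)} {b₁ b₂ b₁' b₂' : ℝ → ℝ}
    (hmu₁ : 0 < P.mu₁) (hmu₂ : 0 < P.mu₂) (hp₁ : 2 < P.p₁) (hp₂ : 2 < P.p₂)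
    (hφ₁ : ∀ R, ∃ L, LipschitzOnWith L φ₁ (Metric.closedBall 0 R)) (hφ₂ : ∀ R, ∃ L, LipschitzOnWith L φ₂ (Metric.closedBall 0 R))
    (S : IsCoupled P φ₁ φ₂ τ x b₁ b₂) (S' : IsCoupled P φ₁ φ₂ τ x' b₁' b₂') (h0 : x 0 = x' 0) :
    ∀ t ∈ Icc 0 τ, x t = x' t := by
  obtain ⟨C, hC⟩ := isCompact_Icc.exists_bound_of_continuousOn S.continuousOn
  obtain ⟨C', hC'⟩ := isCompact_Icc.exists_bound_of_continuousOn S'.continuousOn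
  obtain ⟨L₁, h1, hL₁⟩ := exists_norm_source_sub_le (lam := P.lam₁) (K := P.K₁) hp₁ hφ₁ (max C C')
  obtain ⟨L₂, h2, hL₂⟩ := exists_norm_source_sub_le (lam := P.lam₂) (K := P.K₂) hp₂ hφ₂ (max C C')
  refine CoupledWave.eqOn hmu₁ hmu₂ S S' h0 (L := L₁ + L₂) (fun t ht => ?_) (fun t ht => ?_)
  · refine (hL₁ _ _ ((hC t ht).trans (le_max_left _ _)) ((hC' t ht).trans (le_max_right _ _))).trans ?_
    exact mul_le_mul_of_nonneg_right (by linarith) (norm_nonneg _)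
  · refine (hL₂ _ _ ?_ ?_).trans ?_
    · rw [norm_swap]; exact (hC t ht).trans (le_max_left _ _)
    · rw [norm_swap]; exact (hC' t ht).trans (le_max_right _ _)
    · have e : ‖(x t).swap - (x' t).swap‖ = ‖x t - x' t‖ := norm_swap (x t - x' t)
      rw [e]
      exact mul_le_mul_of_nonneg_right (by linarith) (norm_nonneg _)

/-- The norm of a maximal solution on a finite interval tends to infinity. -/
theorem IsMaximalWeakSolution.tendsto_norm {T : ℝ} (hT : 0 < T)
    (hmu₁ : 0 < P.mu₁) (hmu₂ : 0 < P.mu₂) (hp₁ : 2 < P.p₁) (hp₂ : 2 < P.p₂)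
    (hφ₁ : ∀ R, ∃ L, LipschitzOnWith L φ₁ (Metric.closedBall 0 R)) (hφ₂ : ∀ R, ∃ L, LipschitzOnWith L φ₂ (Metric.closedBall 0 R))
    (h₁ : ∀ a b, φ₁ (a, b) = f₁ a b) (h₂ : ∀ a b, φ₂ (b, a) = f₂ a b)
    (h : IsMaximalWeakSolution P f₁ f₂ u₀ v₀ u₁ v₁ T u v u' v') :
    Tendsto (fun t => ‖u t‖ + ‖v t‖ + ‖u' t‖ + ‖v' t‖) (𝓝[<] T) atTop := by
  obtain ⟨hsol, hmax⟩ := h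
  by_contra hn
  rw [tendsto_atTop] at hn
  push Not at hn
  -- If the norm does not tend to infinity, it lies below some `R` at times arbitrarily close to
  -- `T`.
  obtain ⟨R, hR⟩ := hn
  obtain ⟨δ, hδ, hloc⟩ := exists_coupledWave_source (lam₁ := P.lam₁) (lam₂ := P.lam₂) (K₁ := P.K₁) (K₂ := P.K₂) hmu₁ hmu₂ hp₁ hp₂
    hφ₁ hφ₂ (R := max R 0) (le_max_right _ _)
  have hev : ∀ᶠ t in 𝓝[<] T, t ∈ Ioo (max 0 (T - δ)) T := Ioo_mem_nhdsLT (max_lt hT (by linarith))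
  -- The restart time is closer to `T` than the guaranteed existence time `δ`, so the continuation
  -- passes `T`.
  obtain ⟨t₀, ht₀, hmem⟩ := (hR.and_eventually hev).exists
  have ht₀0 : 0 < t₀ := (le_max_left _ _).trans_lt hmem.1
  have ht₀δ : T < t₀ + δ := by linarith [(le_max_right 0 (T - δ)).trans_lt hmem.1]
  obtain ⟨b₁, b₂, S⟩ := hsol.isCoupled hp₁ hp₂ hφ₁ hφ₂ h₁ h₂
  obtain ⟨y, c₁, c₂, S', hy0⟩ := hloc (state (u t₀) (v t₀) (u' t₀) (v' t₀))
    ((norm_state_le _ _ _ _).trans (ht₀.le.trans (le_max_left _ _)))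
  have Z : IsCoupled P φ₁ φ₂ (t₀ + δ) _ _ _ := (S t₀ ht₀0 (EReal.coe_lt_coe_iff.2 hmem.2)).concat ht₀0.le hδ.le S' hy0
  set x : ℝ → (L2 × L2) × (L2 × L2) := fun t => state (u t) (v t) (u' t) (v' t) with hx
  have hz0 : joinAt t₀ x y 0 = x 0 := joinAt_of_le ht₀0.le
  -- On `(t₀, T)` the restarted solution could differ from the given one; uniqueness excludes it.
  have hz : ∀ t ∈ timeIco (T : EReal), joinAt t₀ x y t = x t := by
    intro t ht
    rcases ht.1.eq_or_lt with h0 | h0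
    · rw [← h0, hz0]
    · have htT : t < T := EReal.coe_lt_coe_iff.1 ht.2
      exact (IsCoupled.eqOn hmu₁ hmu₂ hp₁ hp₂ hφ₁ hφ₂ (Z.mono (htT.le.trans ht₀δ.le)) (S t h0 ht.2) hz0 t ⟨h0.le, le_rfl⟩)
  have back : ∀ t ∈ timeIco (T : EReal), lift (joinAt t₀ x y t).1.1 = u t ∧ (lift (joinAt t₀ x y t).2.1).reflect = v t := by
    intro t ht
    rw [hz t ht]
    refine ⟨lift_dx_of_mem_V (hsol.fst.dirichlet t ht), ?_⟩
    show (lift (v t).reflect.dx).reflect = v t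
    rw [lift_dx_of_mem_V (hsol.mem_V_reflect ht), H1.reflect_reflect]
  have W := Z.isWeakSolution hp₁ hp₂ hφ₁ hφ₂ h₁ h₂
  have m0 : (0 : ℝ) ∈ timeIco (T : EReal) := ⟨le_rfl, EReal.coe_lt_coe_iff.2 hT⟩
  rw [(back 0 m0).1, (back 0 m0).2, hz0, hsol.init_u, hsol.init_v] at W
  simp only [hx, state, reflect_reflect, hsol.init_u', hsol.init_v'] at W
  exact hmax _ _ _ _ _ (EReal.coe_lt_coe_iff.2 ht₀δ) W back

end

end WaveSystem

/-! ### A chain rule, a superlinear differential inequality, and right derivatives -/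

theorem LipschitzOnWith.comp_absolutelyContinuousOnInterval {f φ : ℝ → ℝ} {a b : ℝ} {L : NNReal} {s : Set ℝ}
    (hφ : LipschitzOnWith L φ s) (hf : AbsolutelyContinuousOnInterval f a b) (hs : MapsTo f (uIcc a b) s) :
    AbsolutelyContinuousOnInterval (fun x => φ (f x)) a b := by
  have h := hf.const_mul (L : ℝ)
  refine squeeze_zero' (Eventually.of_forall fun _ => Finset.sum_nonneg fun i hi => dist_nonneg) ?_ h
  rw [eventually_inf_principal]
  refine Eventually.of_forall fun E hE => Finset.sum_le_sum fun i hi => ?_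
  have hm := hE.1 i hi
  refine (hφ.dist_le_mul _ (hs hm.1) _ (hs hm.2)).trans (le_of_eq ?_)
  rw [Real.dist_eq, Real.dist_eq, ← mul_sub, abs_mul, NNReal.abs_eq]

/-- The chain rule for a `C¹` function of a primitive. -/
theorem integral_comp_mul_of_eq_add_integral {Φ ψ γ b : ℝ → ℝ} {τ : ℝ} (hΦ : ∀ z, HasDerivAt Φ (ψ z) z) (hψ : Continuous ψ)
    (hb : IntegrableOn b (Ioc 0 τ)) (hγ : ∀ t ∈ Icc 0 τ, γ t = γ 0 + ∫ s in (0 : ℝ)..t, b s) {t : ℝ} (ht : t ∈ Icc 0 τ) :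
    ∫ s in (0 : ℝ)..t, ψ (γ s) * b s = Φ (γ t) - Φ (γ 0) := by
  have hbI : IntervalIntegrable b volume 0 t := intervalIntegrable_of_integrableOn_Ioc hb ⟨le_rfl, ht.1.trans ht.2⟩ ht
  set G : ℝ → ℝ := fun s => γ 0 + ∫ r in (0 : ℝ)..s, b r with hG
  have hGac : AbsolutelyContinuousOnInterval G 0 t := by
    have h := hbI.absolutelyContinuousOnInterval_intervalIntegral (c := 0) (by simp)
    have hc : AbsolutelyContinuousOnInterval (fun _ : ℝ => γ 0) 0 t := by
      simp only [AbsolutelyContinuousOnInterval, dist_self, Finset.sum_const_zero]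
      exact tendsto_const_nhds
    exact hc.add h
  -- `Φ` is Lipschitz on the bounded range of `G`, so the composition is absolutely continuous.
  obtain ⟨R, hR⟩ := hGac.exists_bound
  obtain ⟨C, hC⟩ := (isCompact_closedBall (0 : ℝ) R).exists_bound_of_continuousOn hψ.continuousOn
  have hL : LipschitzOnWith C.toNNReal Φ (Metric.closedBall 0 R) :=
    Convex.lipschitzOnWith_of_nnnorm_hasDerivWithin_le (convex_closedBall 0 R) (fun z _ => (hΦ z).hasDerivWithinAt) fun z hz => by
      rw [← NNReal.coe_le_coe, coe_nnnorm]
      exact (hC z hz).trans (Real.le_coe_toNNReal C)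
  have hac := hL.comp_absolutelyContinuousOnInterval hGac fun s hs => by simpa using hR s hs
  have e := hac.integral_deriv_eq_sub
  have hγG : ∀ s ∈ Icc 0 t, γ s = G s := fun s hs => hγ s ⟨hs.1, hs.2.trans ht.2⟩
  rw [hγG t ⟨ht.1, le_rfl⟩, hγG 0 ⟨le_rfl, ht.1⟩, ← e]
  apply intervalIntegral.integral_congr_ae
  filter_upwards [hbI.ae_hasDerivAt_integral] with s hs hm
  have hm' := uIoc_subset_uIcc hm
  have hd : HasDerivAt G (b s) s := (hs hm' 0 (by simp)).const_add (γ 0)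
  rw [uIcc_of_le ht.1] at hm'
  rw [hγG s hm']
  exact ((hΦ (G s)).comp s hd).deriv.symm

/-- Finite time blow-up for a superlinear differential inequality. -/
theorem le_of_superlinear_growth {Y D X : ℝ → ℝ} {τ c C r : ℝ} (hY : ContinuousOn Y (Icc 0 τ))
    (hD : ∀ t ∈ Ico 0 τ, HasDerivWithinAt Y (D t) (Ici t) t) (hc : 0 < c) (hC : 0 < C) (hr : 1 < r)
    (hX : ∀ t ∈ Ico 0 τ, 1 ≤ X t) (hXD : ∀ t ∈ Ico 0 τ, c * X t ≤ D t) (hYX : ∀ t ∈ Ico 0 τ, 1 ≤ Y t → Y t ^ r ≤ C * X t) :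
    τ ≤ max 0 ((1 - Y 0) / c) + C / ((r - 1) * c) := by
  set t₁ := max 0 ((1 - Y 0) / c) with ht₁
  have hpos : 0 < C / ((r - 1) * c) := div_pos hC (mul_pos (by linarith) hc)
  rcases le_or_gt τ t₁ with h | h
  · linarith
  have t₁0 : 0 ≤ t₁ := le_max_left _ _
  -- `Y` may start negative. Since `D ≥ c X ≥ c`, it reaches 1 by the time `t₁` at the latest.
  have lin : ∀ t ∈ Icc 0 τ, Y 0 + c * t ≤ Y t := by
    refine image_le_of_deriv_right_le_deriv_boundary (f := fun t => Y 0 + c * t) (f' := fun _ => c) (by fun_prop)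
      (fun t _ => ?_) (by simp) hY hD (fun t ht => ?_)
    · simpa using (((hasDerivAt_id t).const_mul c).const_add (Y 0)).hasDerivWithinAt
    · have := mul_le_mul_of_nonneg_left (hX t ht) hc.le
      linarith [hXD t ht]
  have Y1 : ∀ t ∈ Icc t₁ τ, 1 ≤ Y t := fun t ht => by
    have h1 := lin t ⟨t₁0.trans ht.1, ht.2⟩
    have h2 : (1 - Y 0) / c ≤ t := (le_max_right _ _).trans ht.1
    rw [div_le_iff₀ hc] at h2
    linarith
  have sub : Icc t₁ τ ⊆ Icc 0 τ := Icc_subset_Icc_left t₁0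
  -- From `t₁` on `Y' ≥ (c/C) Y^r`, so the positive quantity `Y^(1-r)`, at most 1 at `t₁`, decreases
  -- at least at the rate `(r-1)c/C`. This cannot last longer than `C / ((r-1)c)`.
  have Zb : ∀ t ∈ Icc t₁ τ, Y t ^ (1 - r) ≤ 1 - (r - 1) * c / C * (t - t₁) := by
    refine image_le_of_deriv_right_le_deriv_boundary (f := fun t => Y t ^ (1 - r)) (f' := fun t => D t * (1 - r) * Y t ^ (1 - r - 1))
      (B := fun t => 1 - (r - 1) * c / C * (t - t₁)) (B' := fun _ => -((r - 1) * c / C))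
      ((hY.mono sub).rpow_const fun t ht => Or.inl (by linarith [Y1 t ht])) (fun t ht => ?_) ?_ (by fun_prop) (fun t _ => ?_)
      (fun t ht => ?_)
    · exact (hD t ⟨t₁0.trans ht.1, ht.2⟩).rpow_const (Or.inl (by linarith [Y1 t ⟨ht.1, ht.2.le⟩]))
    · simp only [sub_self, mul_zero, sub_zero]
      exact Real.rpow_le_one_of_one_le_of_nonpos (Y1 t₁ ⟨le_rfl, h.le⟩) (by linarith)
    · have := ((((hasDerivAt_id t).sub_const t₁).const_mul ((r - 1) * c / C)).const_sub 1).hasDerivWithinAt (s := Ici t)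
      simpa using this
    · have hm : t ∈ Ico 0 τ := ⟨t₁0.trans ht.1, ht.2⟩
      have y1 := Y1 t ⟨ht.1, ht.2.le⟩
      have ypos : 0 < Y t := by linarith
      have h1 := hYX t hm y1
      have h2 := hXD t hm
      have e1 : 1 - r - 1 = -r := by ring
      rw [e1, Real.rpow_neg ypos.le]
      have yr : 0 < Y t ^ r := Real.rpow_pos_of_pos ypos r
      have h3 : c / C * Y t ^ r ≤ D t := by
        calc c / C * Y t ^ r ≤ c / C * (C * X t) := mul_le_mul_of_nonneg_left h1 (by positivity)
          _ = c * X t := by field_simp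
          _ ≤ D t := h2
      have h4 : c / C ≤ D t * (Y t ^ r)⁻¹ := by rwa [← div_eq_mul_inv, le_div_iff₀ yr]
      have h5 := mul_le_mul_of_nonneg_left h4 (by linarith : 0 ≤ r - 1)
      calc D t * (1 - r) * (Y t ^ r)⁻¹ = -((r - 1) * (D t * (Y t ^ r)⁻¹)) := by ring
        _ ≤ -((r - 1) * (c / C)) := neg_le_neg h5
        _ = _ := by ring
  have fin := Zb τ ⟨h.le, le_rfl⟩
  have zpos : 0 < Y τ ^ (1 - r) := Real.rpow_pos_of_pos (by linarith [Y1 τ ⟨h.le, le_rfl⟩]) _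
  have h6 : (r - 1) * c / C * (τ - t₁) < 1 := by linarith
  have h7 : τ - t₁ < C / ((r - 1) * c) := by
    rw [lt_div_iff₀ (mul_pos (by linarith) hc)]
    rw [div_mul_eq_mul_div, div_lt_one hC] at h6
    linarith
  linarith

theorem hasDerivWithinAt_zero_of_abs_le {f ε : ℝ → ℝ} {t : ℝ} (h0 : f t = 0)
    (h : ∀ᶠ s in 𝓝[Ici t] t, |f s| ≤ ε s * (s - t)) (hε : Tendsto ε (𝓝[Ici t] t) (𝓝 0)) :
    HasDerivWithinAt f 0 (Ici t) t := by
  rw [hasDerivWithinAt_iff_isLittleO]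
  simp only [h0, sub_zero, smul_zero]
  have h1 : f =O[𝓝[Ici t] t] fun s => ε s * (s - t) := Asymptotics.IsBigO.of_bound 1 (by
    filter_upwards [h] with s hs
    rw [one_mul, Real.norm_eq_abs, Real.norm_eq_abs]
    exact hs.trans (le_abs_self _))
  have h2 : (fun s => ε s * (s - t)) =o[𝓝[Ici t] t] fun s => 1 * (s - t) :=
    ((Asymptotics.isLittleO_one_iff ℝ).2 hε).mul_isBigO (Asymptotics.isBigO_refl _ _)
  simpa using h1.trans_isLittleO h2

section

variable {E : Type*} [NormedAddCommGroup E] [NormedSpace ℝ E] [CompleteSpace E]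

theorem hasDerivWithinAt_integral_self {k : ℝ → E} {τ t : ℝ} (hk : ContinuousOn k (Icc 0 τ))
    (ht : t ∈ Ico 0 τ) : HasDerivWithinAt (fun s => ∫ r in t..s, k r) (k t) (Ici t) t := by
  have hI := integrableOn_Ioc_of_continuousOn_Icc hk
  have m0 : (0 : ℝ) ∈ Icc 0 τ := ⟨le_rfl, ht.1.trans ht.2.le⟩
  refine ((hasDerivWithinAt_integral_Ici hk ht).sub_const (∫ r in (0 : ℝ)..t, k r)).congr_of_eventuallyEq ?_ (by simp)
  filter_upwards [Icc_mem_nhdsGE ht.2] with s hs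
  rw [intervalIntegral.integral_interval_sub_left
    (intervalIntegrable_of_integrableOn_Ioc hI m0 ⟨ht.1.trans hs.1, hs.2⟩)
    (intervalIntegrable_of_integrableOn_Ioc hI m0 ⟨ht.1, ht.2.le⟩)]

theorem exists_norm_integral_le {E : Type*} [NormedAddCommGroup E] [NormedSpace ℝ E] {k : ℝ → E} {τ : ℝ} (hk : ContinuousOn k (Icc 0 τ)) :
    ∃ M, 0 ≤ M ∧ ∀ t ∈ Icc 0 τ, ∀ s ∈ Icc t τ, ‖∫ r in t..s, k r‖ ≤ M * (s - t) := by
  obtain ⟨M, hM⟩ := isCompact_Icc.exists_bound_of_continuousOn hk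
  refine ⟨max M 0, le_max_right _ _, fun t ht s hs => ?_⟩
  have := intervalIntegral.norm_integral_le_of_norm_le_const (a := t) (b := s) (f := k) (C := max M 0) fun r hr => by
    rw [uIoc_of_le hs.1] at hr
    exact (hM r ⟨ht.1.trans hr.1.le, hr.2.trans hs.2⟩).trans (le_max_left _ _)
  rwa [abs_of_nonneg (sub_nonneg.2 hs.1)] at this

end

/-! ### The right derivative of the virial of one component -/

namespace WaveSystem.DampedWave

variable {𝓗 : Type*} [NormedAddCommGroup 𝓗] [InnerProductSpace ℝ 𝓗] [CompleteSpace 𝓗]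
    {J : 𝓗 →L[ℝ] 𝓗} {e : 𝓗} {μ τ lam : ℝ} {h : ℝ → ℝ} {𝒮 g k : ℝ → 𝓗} {b : ℝ → ℝ}

/-- The right derivative of `⟪w, w_t⟫` plus the terms that come from the damping. -/
theorem hasDerivWithinAt_virial (S : DampedWave J e μ τ (fun t => 𝒮 t - lam • k t) h g k b) (hh : ContinuousOn h (Icc 0 τ))
    (h𝒮 : ContinuousOn 𝒮 (Icc 0 τ)) {t : ℝ} (ht : t ∈ Ico 0 τ) :
    HasDerivWithinAt (fun s => inner ℝ (J (g s)) (k s) + lam / 2 * ‖J (g s)‖ ^ 2 + μ / 2 * inner ℝ e (g s) ^ 2)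
      (‖k t‖ ^ 2 - ‖g t‖ ^ 2 + h t * inner ℝ e (g t) + inner ℝ (J (g t)) (𝒮 t)) (Ici t) t := by
  have hτ : 0 ≤ τ := ht.1.trans ht.2.le
  have htm : t ∈ Icc 0 τ := ⟨ht.1, ht.2.le⟩
  have hev : ∀ᶠ s in 𝓝[Ici t] t, s ∈ Icc t τ := Icc_mem_nhdsGE ht.2
  have hk := S.continuousOn_k
  obtain ⟨M, hM0, hM⟩ := exists_norm_integral_le hk
  have dk := hasDerivWithinAt_integral_self hk ht
  have dg := hasDerivWithinAt_integral_self S.continuousOn_g ht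
  have dh := hasDerivWithinAt_integral_self hh ht
  have dS := hasDerivWithinAt_integral_self h𝒮 ht
  -- The product of the increments of `w` and `w_t`: the first is `O(s - t)`, the second tends to
  -- zero by continuity. No derivative of `k` is needed.
  have r1 : HasDerivWithinAt (fun s => inner ℝ (∫ r in t..s, k r) (k s - k t)) 0 (Ici t) t := by
    refine hasDerivWithinAt_zero_of_abs_le (ε := fun s => M * ‖k s - k t‖) (by simp) ?_ ?_
    · filter_upwards [hev] with s hs
      refine (abs_real_inner_le_norm _ _).trans ?_
      have := mul_le_mul_of_nonneg_right (hM t htm s hs) (norm_nonneg (k s - k t))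
      linarith
    · have hc : Tendsto k (𝓝[Ici t] t) (𝓝 (k t)) := (hk t htm).mono_of_mem_nhdsWithin
        (mem_of_superset (Icc_mem_nhdsGE ht.2) (Icc_subset_Icc_left ht.1))
      have := ((hc.sub_const (k t)).norm).const_mul M
      simpa using this
  have r2 : HasDerivWithinAt (fun s => ‖∫ r in t..s, k r‖ ^ 2) 0 (Ici t) t := by
    have := dk.norm_sq
    simpa using this
  -- The trace is only `H¹` in time and need not be differentiable at `t`; Cauchy–Schwarz gives `(∫
  -- b)² ≤ (s - t) ∫ b²`, which is still `o(s - t)`.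
  have r3 : HasDerivWithinAt (fun s => (∫ r in t..s, b r) ^ 2) 0 (Ici t) t := by
    refine hasDerivWithinAt_zero_of_abs_le (ε := fun s => ∫ r in t..s, b r ^ 2) (by simp) ?_ ?_
    · filter_upwards [hev] with s hs
      have hs' : s ∈ Icc 0 τ := ⟨ht.1.trans hs.1, hs.2⟩
      have := norm_intervalIntegral_sq_le hs.1 (intervalIntegrable_of_integrableOn_Ioc S.integrableOn_b htm hs')
        (intervalIntegrable_sq_of_memLp_Ioc S.memLp_b htm hs')
      simp only [Real.norm_eq_abs, sq_abs] at this
      rw [abs_of_nonneg (sq_nonneg _), mul_comm]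
      exact this
    · have hi : IntegrableOn (fun r => b r ^ 2) (Ioc 0 τ) := S.memLp_b.integrable_sq
      have hii : IntervalIntegrable (fun r => b r ^ 2) volume 0 τ := (intervalIntegrable_iff_integrableOn_Ioc_of_le hτ).2 hi
      have hc : ContinuousOn (fun s => ∫ r in t..s, b r ^ 2) (uIcc 0 τ) :=
        intervalIntegral.continuousOn_primitive_interval' hii (by rw [uIcc_of_le hτ]; exact htm)
      rw [uIcc_of_le hτ] at hc
      have : Tendsto (fun s => ∫ r in t..s, b r ^ 2) (𝓝[Ici t] t) (𝓝 (∫ r in t..t, b r ^ 2)) :=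
        (hc t htm).mono_of_mem_nhdsWithin (mem_of_superset (Icc_mem_nhdsGE ht.2) (Icc_subset_Icc_left ht.1))
      simpa using this
  have main := ((((((dk.inner ℝ (hasDerivWithinAt_const t (Ici t) (k t))).add r1).sub
    ((hasDerivWithinAt_const t (Ici t) (g t)).inner ℝ dg)).add (dh.mul_const (inner ℝ e (g t)))).add
    ((hasDerivWithinAt_const t (Ici t) (J (g t))).inner ℝ dS)).add (r2.const_mul (lam / 2))).add (r3.const_mul (μ / 2))
  have main' := main.const_add (inner ℝ (J (g t)) (k t) + lam / 2 * ‖J (g t)‖ ^ 2 + μ / 2 * inner ℝ e (g t) ^ 2)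
  refine (main'.congr_deriv ?_).congr_of_eventuallyEq ?_ ?_
  · simp only [intervalIntegral.integral_same, inner_zero_right, real_inner_self_eq_norm_sq]
    ring
  · filter_upwards [hev] with s hs
    have hs' : s ∈ Icc 0 τ := ⟨ht.1.trans hs.1, hs.2⟩
    have a1 : J (g s) = J (g t) + ∫ r in t..s, k r := by
      rw [← S.apply_g_sub htm hs', map_sub]; abel
    have a2 : inner ℝ e (g s) = inner ℝ e (g t) + ∫ r in t..s, b r := by
      rw [← S.trace_sub htm hs', inner_sub_right]; ring
    -- The equation tested with the frozen function `g t` gives the increment of `⟨w(t), w_t⟩`. The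
    -- damping terms linear in the increments cancel against the added quadratic terms; only `r2`
    -- and `r3` remain of them.
    have a3 := S.weak_sub htm hs' (g t)
    have hkI := intervalIntegrable_of_integrableOn_Ioc S.integrableOn_k htm hs'
    have hSI := intervalIntegrable_of_integrableOn_Ioc (integrableOn_Ioc_of_continuousOn_Icc h𝒮) htm hs'
    have a4 : ∫ r in t..s, (𝒮 r - lam • k r) = (∫ r in t..s, 𝒮 r) - lam • ∫ r in t..s, k r := by
      rw [← intervalIntegral.integral_smul]
      exact intervalIntegral.integral_sub hSI (hkI.smul lam)
    rw [a4, inner_sub_right, inner_sub_right, inner_smul_right] at a3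
    simp only [Pi.add_apply, Pi.sub_apply]
    rw [a1, a2, norm_add_sq_real, inner_add_left, inner_sub_right, real_inner_comm (g t) e]
    rw [real_inner_comm (g t) e] at a3
    linear_combination a3
  · simp

end WaveSystem.DampedWave

/-! ### Second order expansion of the potential -/

namespace WaveSystem

/-- The mean value inequality on the segment from `z` to `z'`, where the gradient differs from its
value at `z` by at most `(L₁ + L₂) ‖z' - z‖`. -/
theorem abs_sub_sub_le_of_lipschitz_gradient {F f₁ f₂ : ℝ × ℝ → ℝ} {R : ℝ} {L₁ L₂ : NNReal}
    (hF : ∀ z, HasFDerivAt F (f₁ z • ContinuousLinearMap.fst ℝ ℝ ℝ + f₂ z • ContinuousLinearMap.snd ℝ ℝ ℝ) z)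
    (h₁ : LipschitzOnWith L₁ f₁ (Metric.closedBall 0 R)) (h₂ : LipschitzOnWith L₂ f₂ (Metric.closedBall 0 R))
    {z z' : ℝ × ℝ} (hz : ‖z‖ ≤ R) (hz' : ‖z'‖ ≤ R) :
    |F z' - F z - f₁ z * (z'.1 - z.1) - f₂ z * (z'.2 - z.2)| ≤ (L₁ + L₂) * ((z'.1 - z.1) ^ 2 + (z'.2 - z.2) ^ 2) := by
  have hb : segment ℝ z z' ⊆ Metric.closedBall 0 R :=
    (convex_closedBall 0 R).segment_subset (by simpa using hz) (by simpa using hz')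
  have key := Convex.norm_image_sub_le_of_norm_hasFDerivWithin_le' (𝕜 := ℝ) (s := segment ℝ z z')
    (fun y _ => (hF y).hasFDerivWithinAt)
    (φ := f₁ z • ContinuousLinearMap.fst ℝ ℝ ℝ + f₂ z • ContinuousLinearMap.snd ℝ ℝ ℝ) (C := (L₁ + L₂) * ‖z' - z‖) (fun y hy => by
      have hyz : ‖y - z‖ ≤ ‖z' - z‖ := norm_sub_le_of_mem_segment hy
      have e1 := h₁.dist_le_mul y (hb hy) z (by simpa using hz)
      have e2 := h₂.dist_le_mul y (hb hy) z (by simpa using hz)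
      rw [dist_eq_norm, dist_eq_norm] at e1 e2
      have e3 : f₁ y • ContinuousLinearMap.fst ℝ ℝ ℝ + f₂ y • ContinuousLinearMap.snd ℝ ℝ ℝ
          - (f₁ z • ContinuousLinearMap.fst ℝ ℝ ℝ + f₂ z • ContinuousLinearMap.snd ℝ ℝ ℝ)
          = (f₁ y - f₁ z) • ContinuousLinearMap.fst ℝ ℝ ℝ + (f₂ y - f₂ z) • ContinuousLinearMap.snd ℝ ℝ ℝ := by
        module
      rw [e3]
      refine (norm_add_le _ _).trans ?_
      rw [norm_smul, norm_smul]
      have f1 := ContinuousLinearMap.norm_fst_le ℝ ℝ ℝ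
      have f2 := ContinuousLinearMap.norm_snd_le ℝ ℝ ℝ
      have g1 := mul_le_mul e1 f1 (norm_nonneg _) (by positivity)
      have g2 := mul_le_mul e2 f2 (norm_nonneg _) (by positivity)
      have g3 := mul_le_mul_of_nonneg_left hyz L₁.2
      have g4 := mul_le_mul_of_nonneg_left hyz L₂.2
      change (L₁ : ℝ) * _ ≤ L₁ * _ at g3
      change (L₂ : ℝ) * _ ≤ L₂ * _ at g4
      linarith)
    (convex_segment z z') (left_mem_segment ℝ z z') (right_mem_segment ℝ z z')
  have e : F z' - F z - f₁ z * (z'.1 - z.1) - f₂ z * (z'.2 - z.2)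
      = F z' - F z - (f₁ z • ContinuousLinearMap.fst ℝ ℝ ℝ + f₂ z • ContinuousLinearMap.snd ℝ ℝ ℝ) (z' - z) := by
    simp; ring
  rw [e, ← Real.norm_eq_abs]
  refine key.trans ?_
  rw [mul_assoc]
  refine mul_le_mul_of_nonneg_left ?_ (by positivity)
  rw [Prod.norm_def, ← sq]
  rcases max_choice ‖(z' - z).1‖ ‖(z' - z).2‖ with h | h <;> rw [h, Real.norm_eq_abs, sq_abs]
  · simp only [Prod.fst_sub]; linarith [sq_nonneg (z'.2 - z.2)]
  · simp only [Prod.snd_sub]; linarith [sq_nonneg (z'.1 - z.1)]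

end WaveSystem

/-! ### Energy inequality of one component, and the potential energy -/

namespace WaveSystem

theorem hasDerivAt_const_mul_abs_rpow {p : ℝ} (hp : 2 < p) (K z : ℝ) :
    HasDerivAt (fun z => K / p * |z| ^ p) (K * Psi p z) z := by
  refine ((hasDerivAt_abs_rpow z (by linarith : 1 < p)).const_mul (K / p)).congr_deriv ?_
  rw [Psi]
  field_simp

/-- The energy inequality for one component with a conservative boundary source. -/
theorem DampedWave.energy_le {𝓗 : Type*} [NormedAddCommGroup 𝓗] [InnerProductSpace ℝ 𝓗] [CompleteSpace 𝓗]
    {J : 𝓗 →L[ℝ] 𝓗} {e : 𝓗} {μ τ lam K p : ℝ} {𝒮 g k : ℝ → 𝓗} {b : ℝ → ℝ}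
    (S : DampedWave J e μ τ (fun t => 𝒮 t - lam • k t) (fun t => K * Psi p (inner ℝ e (g t))) g k b)
    (hμ : 0 ≤ μ) (hlam : 0 ≤ lam) (hp : 2 < p) (h𝒮 : ContinuousOn 𝒮 (Icc 0 τ)) {t : ℝ} (ht : t ∈ Ico 0 τ) :
    1 / 2 * (‖k t‖ ^ 2 + ‖g t‖ ^ 2) - K / p * |inner ℝ e (g t)| ^ p
      ≤ 1 / 2 * (‖k 0‖ ^ 2 + ‖g 0‖ ^ 2) - K / p * |inner ℝ e (g 0)| ^ p + ∫ s in (0 : ℝ)..t, inner ℝ (𝒮 s) (k s) := by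
  have htm : t ∈ Icc 0 τ := ⟨ht.1, ht.2.le⟩
  have m0 : (0 : ℝ) ∈ Icc 0 τ := ⟨le_rfl, ht.1.trans ht.2.le⟩
  have hk := S.continuousOn_k
  have hΨ : Continuous fun z => K * Psi p z := continuous_const.mul (continuous_Psi hp)
  -- The boundary source is conservative: its work along the trace is the increment of `K/p |w|^p`.
  have chain := integral_comp_mul_of_eq_add_integral (hasDerivAt_const_mul_abs_rpow hp K) hΨ S.integrableOn_b S.trace htm
  have hid := S.energy_identity ht.1 ht.2
  have hh : ContinuousOn (fun s => K * Psi p (inner ℝ e (g s))) (Icc 0 t) :=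
    hΨ.comp_continuousOn (continuousOn_const.inner (S.continuousOn_g.mono (Icc_subset_Icc_right htm.2)))
  have ib := intervalIntegrable_of_integrableOn_Ioc S.integrableOn_b m0 htm
  have ihb : IntervalIntegrable (fun s => K * Psi p (inner ℝ e (g s)) * b s) volume 0 t :=
    ib.continuousOn_mul (by rw [uIcc_of_le ht.1]; exact hh)
  have ib2 : IntervalIntegrable (fun s => b s ^ 2) volume 0 t := by
    simpa using intervalIntegrable_sq_of_memLp_Ioc S.memLp_b m0 htm
  have e1 : ∫ s in (0 : ℝ)..t, (K * Psi p (inner ℝ e (g s)) - μ * b s) * b s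
      = (∫ s in (0 : ℝ)..t, K * Psi p (inner ℝ e (g s)) * b s) - μ * ∫ s in (0 : ℝ)..t, b s ^ 2 := by
    rw [← intervalIntegral.integral_const_mul, ← intervalIntegral.integral_sub ihb (ib2.const_mul μ)]
    congr 1; ext s; ring
  have iS : IntervalIntegrable (fun s => inner ℝ (𝒮 s) (k s)) volume 0 t :=
    intervalIntegrable_of_integrableOn_Ioc (integrableOn_Ioc_of_continuousOn_Icc (h𝒮.inner hk)) m0 htm
  have ik : IntervalIntegrable (fun s => ‖k s‖ ^ 2) volume 0 t :=
    intervalIntegrable_of_integrableOn_Ioc (integrableOn_Ioc_of_continuousOn_Icc (hk.norm.pow 2)) m0 htm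
  have e2 : ∫ s in (0 : ℝ)..t, inner ℝ (𝒮 s - lam • k s) (k s)
      = (∫ s in (0 : ℝ)..t, inner ℝ (𝒮 s) (k s)) - lam * ∫ s in (0 : ℝ)..t, ‖k s‖ ^ 2 := by
    rw [← intervalIntegral.integral_const_mul, ← intervalIntegral.integral_sub iS (ik.const_mul lam)]
    congr 1; ext s
    rw [inner_sub_left, real_inner_smul_left, real_inner_self_eq_norm_sq]
  rw [e1, e2, chain] at hid
  have p1 : 0 ≤ μ * ∫ s in (0 : ℝ)..t, b s ^ 2 := mul_nonneg hμ (intervalIntegral.integral_nonneg ht.1 fun s _ => sq_nonneg _)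
  have p2 : 0 ≤ lam * ∫ s in (0 : ℝ)..t, ‖k s‖ ^ 2 := mul_nonneg hlam (intervalIntegral.integral_nonneg ht.1 fun s _ => sq_nonneg _)
  linarith

/-- `F` is a potential with gradient `(φ₁(a, b), φ₂(b, a))`, and all three functions are Lipschitz on bounded sets. -/
structure IsPotential (F φ₁ φ₂ : C(ℝ × ℝ, ℝ)) : Prop where
  hasFDerivAt : ∀ z : ℝ × ℝ, HasFDerivAt F (φ₁ z • ContinuousLinearMap.fst ℝ ℝ ℝ + φ₂ z.swap • ContinuousLinearMap.snd ℝ ℝ ℝ) z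
  lipschitz : ∀ R, ∃ L, LipschitzOnWith L F (Metric.closedBall 0 R)
  lipschitz_fst : ∀ R, ∃ L, LipschitzOnWith L φ₁ (Metric.closedBall 0 R)
  lipschitz_snd : ∀ R, ∃ L, LipschitzOnWith L φ₂ (Metric.closedBall 0 R)

theorem one_sub_mem_Icc {y : ℝ} (hy : y ∈ Icc (0 : ℝ) 1) : 1 - y ∈ Icc (0 : ℝ) 1 := ⟨by linarith [hy.2], by linarith [hy.1]⟩

theorem continuousOn_prim_one_sub (g : L2) : ContinuousOn (fun y => prim g (1 - y)) (Icc 0 1) :=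
  (continuousOn_prim g).comp (by fun_prop) fun _ hy => one_sub_mem_Icc hy

theorem integrableOn_Ioo_of_continuousOn {f : ℝ → ℝ} (hf : ContinuousOn f (Icc 0 1)) : IntegrableOn f (Ioo 0 1) :=
  hf.integrableOn_Icc.mono_set Ioo_subset_Icc_self

theorem continuousOn_comp_prim (φ : C(ℝ × ℝ, ℝ)) (g₁ g₂ : L2) :
    ContinuousOn (fun y => φ (prim g₁ y, prim g₂ (1 - y))) (Icc 0 1) :=
  φ.continuous.comp_continuousOn ((continuousOn_prim g₁).prodMk (continuousOn_prim_one_sub g₂))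

theorem inner_nemytskii_volterra (φ : C(ℝ × ℝ, ℝ)) (g₁ g₂ w : L2) :
    inner ℝ (nemytskii φ g₁ g₂) (volterra w) = ∫ y in Ioo (0 : ℝ) 1, φ (prim g₁ y, prim g₂ (1 - y)) * prim w y :=
  L2.inner_eq_of_ae (nemytskii_ae φ g₁ g₂) (volterra_ae w)

theorem inner_nemytskii_volterra_one_sub (φ : C(ℝ × ℝ, ℝ)) (g₁ g₂ w : L2) :
    inner ℝ (nemytskii φ g₁ g₂) (volterra w) = ∫ y in Ioo (0 : ℝ) 1, φ (prim g₁ (1 - y), prim g₂ y) * prim w (1 - y) := by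
  rw [inner_nemytskii_volterra, ← integral_one_sub]
  simp only [sub_sub_cancel]

theorem norm_sq_volterra (w : L2) : ‖volterra w‖ ^ 2 = ∫ y in Ioo (0 : ℝ) 1, prim w y ^ 2 := by
  rw [← real_inner_self_eq_norm_sq, L2.inner_eq_of_ae (volterra_ae w) (volterra_ae w)]
  simp only [sq]

theorem norm_sq_volterra_one_sub (w : L2) : ‖volterra w‖ ^ 2 = ∫ y in Ioo (0 : ℝ) 1, prim w (1 - y) ^ 2 := by
  rw [norm_sq_volterra, ← integral_one_sub]

/-- The potential energy of the interior sources. -/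
noncomputable def potential (F : C(ℝ × ℝ, ℝ)) (x : (L2 × L2) × (L2 × L2)) : ℝ :=
  ∫ y in Ioo (0 : ℝ) 1, F (prim x.1.1 y, prim x.2.1 (1 - y))

theorem potential_eq_prim (F : C(ℝ × ℝ, ℝ)) (x : (L2 × L2) × (L2 × L2)) :
    potential F x = prim (nemytskii F x.1.1 x.2.1) 1 := by
  rw [prim_eq _ ⟨zero_le_one, le_rfl⟩, ← integral_Ioo_eq_intervalIntegral, potential]
  exact integral_congr_ae (nemytskii_ae F _ _).symm

theorem continuous_potential {F : C(ℝ × ℝ, ℝ)} (hF : ∀ R, ∃ L, LipschitzOnWith L F (Metric.closedBall 0 R)) :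
    Continuous (potential F) := by
  simp only [funext (potential_eq_prim F)]
  exact continuous_const.inner (continuous_nemytskii hF)

/-- The pointwise expansion, integrated over `(0,1)`. It matters that the remainder contains the
`L²` norms of the increments of the functions and not of their derivatives: along a solution only
the former are `O(s - t)`. -/
theorem IsPotential.abs_potential_sub_le {F φ₁ φ₂ : C(ℝ × ℝ, ℝ)} (hF : IsPotential F φ₁ φ₂) (R : ℝ) :
    ∃ C, 0 ≤ C ∧ ∀ x x' : (L2 × L2) × (L2 × L2), ‖x‖ ≤ R → ‖x'‖ ≤ R →
      |potential F x' - potential F x - inner ℝ (nemytskii φ₁ x.1.1 x.2.1) (volterra (x'.1.1 - x.1.1))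
        - inner ℝ (nemytskii φ₂ x.2.1 x.1.1) (volterra (x'.2.1 - x.2.1))|
      ≤ C * (‖volterra (x'.1.1 - x.1.1)‖ ^ 2 + ‖volterra (x'.2.1 - x.2.1)‖ ^ 2) := by
  obtain ⟨L₁, hL₁⟩ := hF.lipschitz_fst R
  obtain ⟨L₂, hL₂⟩ := hF.lipschitz_snd R
  have hL₂' : LipschitzOnWith L₂ (fun z : ℝ × ℝ => φ₂ z.swap) (Metric.closedBall 0 R) :=
    LipschitzOnWith.of_dist_le_mul fun z hz z' hz' => by
      have h := hL₂.dist_le_mul z.swap (by simpa [norm_swap] using hz) z'.swap (by simpa [norm_swap] using hz')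
      have e : dist z.swap z'.swap = dist z z' := by
        rw [dist_eq_norm, dist_eq_norm]; exact norm_swap (z - z')
      rwa [e] at h
  refine ⟨L₁ + L₂, by positivity, fun x x' hx hx' => ?_⟩
  set Δ₁ := x'.1.1 - x.1.1 with hΔ₁
  set Δ₂ := x'.2.1 - x.2.1 with hΔ₂
  have c1 := integrableOn_Ioo_of_continuousOn (continuousOn_comp_prim F x'.1.1 x'.2.1)
  have c2 := integrableOn_Ioo_of_continuousOn (continuousOn_comp_prim F x.1.1 x.2.1)
  have c12 : IntegrableOn (fun y => F (prim x'.1.1 y, prim x'.2.1 (1 - y)) - F (prim x.1.1 y, prim x.2.1 (1 - y))) (Ioo 0 1) := c1.sub c2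
  have c3 : IntegrableOn (fun y => φ₁ (prim x.1.1 y, prim x.2.1 (1 - y)) * prim Δ₁ y) (Ioo 0 1) :=
    integrableOn_Ioo_of_continuousOn ((continuousOn_comp_prim φ₁ x.1.1 x.2.1).mul (continuousOn_prim Δ₁))
  have c123 : IntegrableOn (fun y => F (prim x'.1.1 y, prim x'.2.1 (1 - y)) - F (prim x.1.1 y, prim x.2.1 (1 - y))
      - φ₁ (prim x.1.1 y, prim x.2.1 (1 - y)) * prim Δ₁ y) (Ioo 0 1) := c12.sub c3
  have c4 : IntegrableOn (fun y => φ₂ (prim x.2.1 (1 - y), prim x.1.1 y) * prim Δ₂ (1 - y)) (Ioo 0 1) :=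
    integrableOn_Ioo_of_continuousOn ((φ₂.continuous.comp_continuousOn ((continuousOn_prim_one_sub x.2.1).prodMk
      (continuousOn_prim x.1.1))).mul (continuousOn_prim_one_sub Δ₂))
  have c5 : IntegrableOn (fun y => prim Δ₁ y ^ 2) (Ioo 0 1) := integrableOn_Ioo_of_continuousOn ((continuousOn_prim Δ₁).pow 2)
  have c6 : IntegrableOn (fun y => prim Δ₂ (1 - y) ^ 2) (Ioo 0 1) := integrableOn_Ioo_of_continuousOn ((continuousOn_prim_one_sub Δ₂).pow 2)
  rw [inner_nemytskii_volterra, inner_nemytskii_volterra_one_sub, norm_sq_volterra Δ₁, norm_sq_volterra_one_sub Δ₂, potential, potential,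
    ← integral_sub c1 c2, ← integral_sub c12 c3, ← integral_sub c123 c4, ← integral_add c5 c6,
    ← integral_const_mul, ← Real.norm_eq_abs]
  refine norm_integral_le_of_norm_le ((c5.add c6).const_mul _) (Eventually.of_forall fun y => ?_)
  have := abs_sub_sub_le_of_lipschitz_gradient (F := F) (f₁ := φ₁) (f₂ := fun z => φ₂ z.swap) hF.hasFDerivAt hL₁ hL₂'
    ((norm_prim_pair_le x y (1 - y)).trans hx) ((norm_prim_pair_le x' y (1 - y)).trans hx')
  simp only [← prim_sub, Prod.swap_prod_mk] at this
  exact this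

end WaveSystem

/-! ### Energy and virial along solutions -/

namespace WaveSystem

theorem hasDerivWithinAt_potential {P : Params} {F φ₁ φ₂ : C(ℝ × ℝ, ℝ)} (hF : IsPotential F φ₁ φ₂) {τ : ℝ}
    {x : ℝ → (L2 × L2) × (L2 × L2)} {b₁ b₂ : ℝ → ℝ} (S : IsCoupled P φ₁ φ₂ τ x b₁ b₂) {t : ℝ} (ht : t ∈ Ico 0 τ) :
    HasDerivWithinAt (fun s => potential F (x s)) (inner ℝ (nemytskii φ₁ (x t).1.1 (x t).2.1) (x t).1.2
      + inner ℝ (nemytskii φ₂ (x t).2.1 (x t).1.1) (x t).2.2) (Ici t) t := by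
  have htm : t ∈ Icc 0 τ := ⟨ht.1, ht.2.le⟩
  obtain ⟨R, hR⟩ := isCompact_Icc.exists_bound_of_continuousOn S.continuousOn
  obtain ⟨C, hC0, hC⟩ := hF.abs_potential_sub_le R
  set A₁ := nemytskii φ₁ (x t).1.1 (x t).2.1 with hA₁
  set A₂ := nemytskii φ₂ (x t).2.1 (x t).1.1 with hA₂
  obtain ⟨M₁, hM₁, hI₁⟩ := exists_norm_integral_le S.fst.continuousOn_k
  obtain ⟨M₂, hM₂, hI₂⟩ := exists_norm_integral_le S.snd.continuousOn_k
  have d₁ := (hasDerivWithinAt_const t (Ici t) A₁).inner ℝ (hasDerivWithinAt_integral_self S.fst.continuousOn_k ht)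
  have d₂ := (hasDerivWithinAt_const t (Ici t) A₂).inner ℝ (hasDerivWithinAt_integral_self S.snd.continuousOn_k ht)
  have rem : HasDerivWithinAt (fun s => potential F (x s) - potential F (x t) - inner ℝ A₁ (∫ r in t..s, (x r).1.2)
      - inner ℝ A₂ (∫ r in t..s, (x r).2.2)) 0 (Ici t) t := by
    refine hasDerivWithinAt_zero_of_abs_le (ε := fun s => C * (M₁ ^ 2 + M₂ ^ 2) * (s - t)) (by simp) ?_ ?_
    · filter_upwards [Icc_mem_nhdsGE ht.2] with s hs
      have hs' : s ∈ Icc 0 τ := ⟨ht.1.trans hs.1, hs.2⟩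
      have key := hC (x t) (x s) (hR t htm) (hR s hs')
      rw [S.fst.apply_g_sub htm hs', S.snd.apply_g_sub htm hs'] at key
      refine key.trans ?_
      have q1 := pow_le_pow_left₀ (norm_nonneg _) (hI₁ t htm s hs) 2
      have q2 := pow_le_pow_left₀ (norm_nonneg _) (hI₂ t htm s hs) 2
      have := mul_le_mul_of_nonneg_left (add_le_add q1 q2) hC0
      refine this.trans (le_of_eq ?_)
      ring
    · have hc : Continuous fun s : ℝ => C * (M₁ ^ 2 + M₂ ^ 2) * (s - t) := by fun_prop
      have := (hc.tendsto t).mono_left (nhdsWithin_le_nhds (s := Ici t))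
      simpa using this
  have main := ((rem.add d₁).add d₂).add_const (potential F (x t))
  refine (main.congr_deriv ?_).congr_of_eventuallyEq (Eventually.of_forall fun s => ?_) ?_
  · simp
  · simp only [Pi.add_apply]; ring
  · simp

/-- The total energy in terms of the state of the first order system. -/
noncomputable def stateEnergy (P : Params) (F : C(ℝ × ℝ, ℝ)) (x : (L2 × L2) × (L2 × L2)) : ℝ :=
  1 / 2 * (‖x.1.2‖ ^ 2 + ‖x.1.1‖ ^ 2) + 1 / 2 * (‖x.2.2‖ ^ 2 + ‖x.2.1‖ ^ 2)
    - P.K₁ / P.p₁ * |prim x.1.1 1| ^ P.p₁ - P.K₂ / P.p₂ * |prim x.2.1 1| ^ P.p₂ - potential F x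

theorem IsCoupled.continuousOn_nemytskii {P : Params} {φ₁ φ₂ : C(ℝ × ℝ, ℝ)} {τ : ℝ}
    {x : ℝ → (L2 × L2) × (L2 × L2)} {b₁ b₂ : ℝ → ℝ} (S : IsCoupled P φ₁ φ₂ τ x b₁ b₂)
    (h₁ : ∀ R, ∃ L, LipschitzOnWith L φ₁ (Metric.closedBall 0 R)) (h₂ : ∀ R, ∃ L, LipschitzOnWith L φ₂ (Metric.closedBall 0 R)) :
    ContinuousOn (fun t => nemytskii φ₁ (x t).1.1 (x t).2.1) (Icc 0 τ) ∧
      ContinuousOn (fun t => nemytskii φ₂ (x t).2.1 (x t).1.1) (Icc 0 τ) :=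
  ⟨(continuous_nemytskii h₁).comp_continuousOn S.continuousOn,
    ((continuous_nemytskii h₂).comp continuous_swap).comp_continuousOn S.continuousOn⟩

/-- Adding the energy inequalities of both components leaves the work of the interior sources, which
is the increment of the potential because the sources form a gradient. -/
theorem IsCoupled.stateEnergy_le {P : Params} {F φ₁ φ₂ : C(ℝ × ℝ, ℝ)} (hF : IsPotential F φ₁ φ₂) {τ : ℝ}
    (hlam₁ : 0 ≤ P.lam₁) (hlam₂ : 0 ≤ P.lam₂) (hmu₁ : 0 ≤ P.mu₁) (hmu₂ : 0 ≤ P.mu₂) (hp₁ : 2 < P.p₁) (hp₂ : 2 < P.p₂)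
    {x : ℝ → (L2 × L2) × (L2 × L2)} {b₁ b₂ : ℝ → ℝ} (S : IsCoupled P φ₁ φ₂ τ x b₁ b₂) {t : ℝ} (ht : t ∈ Ico 0 τ) :
    stateEnergy P F (x t) ≤ stateEnergy P F (x 0) := by
  have htm : t ∈ Icc 0 τ := ⟨ht.1, ht.2.le⟩
  have m0 : (0 : ℝ) ∈ Icc 0 τ := ⟨le_rfl, ht.1.trans ht.2.le⟩
  obtain ⟨c₁, c₂⟩ := S.continuousOn_nemytskii hF.lipschitz_fst hF.lipschitz_snd
  have e₁ := DampedWave.energy_le (𝒮 := fun t => nemytskii φ₁ (x t).1.1 (x t).2.1) S.fst hmu₁ hlam₁ hp₁ c₁ ht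
  have e₂ := DampedWave.energy_le (𝒮 := fun t => nemytskii φ₂ (x t).2.1 (x t).1.1) S.snd hmu₂ hlam₂ hp₂ c₂ ht
  have i₁ : IntervalIntegrable (fun s => inner ℝ (nemytskii φ₁ (x s).1.1 (x s).2.1) (x s).1.2) volume 0 t := intervalIntegrable_of_integrableOn_Ioc (integrableOn_Ioc_of_continuousOn_Icc (c₁.inner S.fst.continuousOn_k)) m0 htm
  have i₂ : IntervalIntegrable (fun s => inner ℝ (nemytskii φ₂ (x s).2.1 (x s).1.1) (x s).2.2) volume 0 t := intervalIntegrable_of_integrableOn_Ioc (integrableOn_Ioc_of_continuousOn_Icc (c₂.inner S.snd.continuousOn_k)) m0 htm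
  have ftc := intervalIntegral.integral_eq_sub_of_hasDeriv_right_of_le (a := 0) (b := t) ht.1
    (((continuous_potential hF.lipschitz).comp_continuousOn S.continuousOn).mono (Icc_subset_Icc_right htm.2))
    (fun s hs => (hasDerivWithinAt_potential hF S ⟨hs.1.le, hs.2.trans ht.2⟩).mono Ioi_subset_Ici_self) (i₁.add i₂)
  rw [intervalIntegral.integral_add i₁ i₂] at ftc
  simp only [Function.comp_def] at ftc
  simp only [stateEnergy]
  change _ - P.K₁ / P.p₁ * |prim (x t).1.1 1| ^ P.p₁ ≤ _ - P.K₁ / P.p₁ * |prim (x 0).1.1 1| ^ P.p₁ + _ at e₁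
  change _ - P.K₂ / P.p₂ * |prim (x t).2.1 1| ^ P.p₂ ≤ _ - P.K₂ / P.p₂ * |prim (x 0).2.1 1| ^ P.p₂ + _ at e₂
  simp only [Prod.fst_swap] at e₂
  linarith

/-- `⟪u, u_t⟫ + ⟪v, v_t⟫` plus the quadratic terms that come from the damping. -/
noncomputable def virial (P : Params) (x : (L2 × L2) × (L2 × L2)) : ℝ :=
  (inner ℝ (volterra x.1.1) x.1.2 + P.lam₁ / 2 * ‖volterra x.1.1‖ ^ 2 + P.mu₁ / 2 * prim x.1.1 1 ^ 2)
    + (inner ℝ (volterra x.2.1) x.2.2 + P.lam₂ / 2 * ‖volterra x.2.1‖ ^ 2 + P.mu₂ / 2 * prim x.2.1 1 ^ 2)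

theorem continuous_virial (P : Params) : Continuous (virial P) := by
  unfold virial prim
  have c1 : Continuous fun x : (L2 × L2) × (L2 × L2) => x.1.1 := by fun_prop
  have c2 : Continuous fun x : (L2 × L2) × (L2 × L2) => x.2.1 := by fun_prop
  have j1 := volterra.continuous.comp c1
  have j2 := volterra.continuous.comp c2
  exact (((j1.inner (by fun_prop)).add (continuous_const.mul (j1.norm.pow 2))).add (continuous_const.mul ((continuous_const.inner c1).pow 2))).add
    (((j2.inner (by fun_prop)).add (continuous_const.mul (j2.norm.pow 2))).add (continuous_const.mul ((continuous_const.inner c2).pow 2)))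

/-- The right derivative of `virial` along solutions. -/
noncomputable def virialRate (P : Params) (φ₁ φ₂ : C(ℝ × ℝ, ℝ)) (x : (L2 × L2) × (L2 × L2)) : ℝ :=
  (‖x.1.2‖ ^ 2 - ‖x.1.1‖ ^ 2 + P.K₁ * Psi P.p₁ (prim x.1.1 1) * prim x.1.1 1
      + inner ℝ (volterra x.1.1) (nemytskii φ₁ x.1.1 x.2.1))
    + (‖x.2.2‖ ^ 2 - ‖x.2.1‖ ^ 2 + P.K₂ * Psi P.p₂ (prim x.2.1 1) * prim x.2.1 1
      + inner ℝ (volterra x.2.1) (nemytskii φ₂ x.2.1 x.1.1))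

theorem IsCoupled.hasDerivWithinAt_virial {P : Params} {φ₁ φ₂ : C(ℝ × ℝ, ℝ)} {τ : ℝ} (hp₁ : 2 < P.p₁) (hp₂ : 2 < P.p₂)
    {x : ℝ → (L2 × L2) × (L2 × L2)} {b₁ b₂ : ℝ → ℝ} (S : IsCoupled P φ₁ φ₂ τ x b₁ b₂)
    (h₁ : ∀ R, ∃ L, LipschitzOnWith L φ₁ (Metric.closedBall 0 R)) (h₂ : ∀ R, ∃ L, LipschitzOnWith L φ₂ (Metric.closedBall 0 R))
    {t : ℝ} (ht : t ∈ Ico 0 τ) :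
    HasDerivWithinAt (fun s => virial P (x s)) (virialRate P φ₁ φ₂ (x t)) (Ici t) t := by
  obtain ⟨c₁, c₂⟩ := S.continuousOn_nemytskii h₁ h₂
  exact (DampedWave.hasDerivWithinAt_virial (𝒮 := fun t => nemytskii φ₁ (x t).1.1 (x t).2.1) S.fst
    (continuousOn_Psi_prim hp₁ P.K₁ S.fst.continuousOn_g) c₁ ht).add
    (DampedWave.hasDerivWithinAt_virial (𝒮 := fun t => nemytskii φ₂ (x t).2.1 (x t).1.1) S.snd
    (continuousOn_Psi_prim hp₂ P.K₂ S.snd.continuousOn_g) c₂ ht)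

end WaveSystem

/-! ### Growth of the virial against its size -/

namespace WaveSystem

theorem Psi_mul_self {p : ℝ} (hp : 2 < p) (z : ℝ) : Psi p z * z = |z| ^ p := by
  have h := Real.rpow_add_of_nonneg (abs_nonneg z) (by linarith : 0 ≤ p - 2) (by norm_num : (0 : ℝ) ≤ 2)
  rw [sub_add_cancel, Real.rpow_two, sq_abs] at h
  rw [h, Psi]; ring

/-- The powers that control the sources. -/
noncomputable def sourcePower (p₁ p₂ α β : ℝ) (x : (L2 × L2) × (L2 × L2)) : ℝ :=
  |prim x.1.1 1| ^ p₁ + |prim x.2.1 1| ^ p₂ + ∫ y in Ioo (0 : ℝ) 1, (|prim x.1.1 y| ^ α + |prim x.2.1 (1 - y)| ^ β)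

theorem integrableOn_abs_rpow {f : ℝ → ℝ} (hf : ContinuousOn f (Icc 0 1)) {α : ℝ} (hα : 0 ≤ α) :
    IntegrableOn (fun y => |f y| ^ α) (Ioo 0 1) :=
  integrableOn_Ioo_of_continuousOn (hf.abs.rpow_const fun _ _ => Or.inr hα)

section

variable {P : Params} {F φ₁ φ₂ : C(ℝ × ℝ, ℝ)} {α β d₁ e₁ e₂ : ℝ}

theorem le_inner_add_inner (hd₁ : 0 < d₁) (hα : 2 < α) (hβ : 2 < β)
    (hlow : ∀ a b, d₁ * F (a, b) ≤ a * φ₁ (a, b) + b * φ₂ (b, a)) (hpow : ∀ a b, e₁ * (|a| ^ α + |b| ^ β) ≤ F (a, b))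
    (x : (L2 × L2) × (L2 × L2)) :
    d₁ * e₁ * ∫ y in Ioo (0 : ℝ) 1, (|prim x.1.1 y| ^ α + |prim x.2.1 (1 - y)| ^ β)
      ≤ inner ℝ (volterra x.1.1) (nemytskii φ₁ x.1.1 x.2.1) + inner ℝ (volterra x.2.1) (nemytskii φ₂ x.2.1 x.1.1) := by
  have c3 : IntegrableOn (fun y => φ₁ (prim x.1.1 y, prim x.2.1 (1 - y)) * prim x.1.1 y) (Ioo 0 1) :=
    integrableOn_Ioo_of_continuousOn ((continuousOn_comp_prim φ₁ x.1.1 x.2.1).mul (continuousOn_prim x.1.1))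
  have c4 : IntegrableOn (fun y => φ₂ (prim x.2.1 (1 - y), prim x.1.1 y) * prim x.2.1 (1 - y)) (Ioo 0 1) :=
    integrableOn_Ioo_of_continuousOn ((φ₂.continuous.comp_continuousOn ((continuousOn_prim_one_sub x.2.1).prodMk
      (continuousOn_prim x.1.1))).mul (continuousOn_prim_one_sub x.2.1))
  rw [real_inner_comm, real_inner_comm (nemytskii φ₂ x.2.1 x.1.1), inner_nemytskii_volterra, inner_nemytskii_volterra_one_sub,
    ← integral_add c3 c4, ← integral_const_mul]
  refine setIntegral_mono_on (((integrableOn_abs_rpow (continuousOn_prim x.1.1) (by linarith)).add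
    (integrableOn_abs_rpow (continuousOn_prim_one_sub x.2.1) (by linarith))).const_mul _) (c3.add c4) measurableSet_Ioo fun y _ => ?_
  have h1 := mul_le_mul_of_nonneg_left (hpow (prim x.1.1 y) (prim x.2.1 (1 - y))) hd₁.le
  have h2 := hlow (prim x.1.1 y) (prim x.2.1 (1 - y))
  linarith

theorem potential_le (hα : 2 < α) (hβ : 2 < β) (hpow : ∀ a b, F (a, b) ≤ e₂ * (|a| ^ α + |b| ^ β)) (x : (L2 × L2) × (L2 × L2)) :
    potential F x ≤ e₂ * ∫ y in Ioo (0 : ℝ) 1, (|prim x.1.1 y| ^ α + |prim x.2.1 (1 - y)| ^ β) := by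
  rw [potential, ← integral_const_mul]
  exact setIntegral_mono_on (integrableOn_Ioo_of_continuousOn (continuousOn_comp_prim F x.1.1 x.2.1))
    (((integrableOn_abs_rpow (continuousOn_prim x.1.1) (by linarith)).add
    (integrableOn_abs_rpow (continuousOn_prim_one_sub x.2.1) (by linarith))).const_mul _) measurableSet_Ioo fun y _ => hpow _ _

theorem integral_abs_rpow_add_nonneg (g₁ g₂ : L2) (α β : ℝ) :
    0 ≤ ∫ y in Ioo (0 : ℝ) 1, (|prim g₁ y| ^ α + |prim g₂ (1 - y)| ^ β) :=
  setIntegral_nonneg measurableSet_Ioo fun _ _ => by positivity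

theorem sourcePower_nonneg (p₁ p₂ α β : ℝ) (x : (L2 × L2) × (L2 × L2)) : 0 ≤ sourcePower p₁ p₂ α β x := by
  have := integral_abs_rpow_add_nonneg x.1.1 x.2.1 α β
  unfold sourcePower
  positivity

/-- The energy bound, doubled, replaces `-‖u_x‖² - ‖v_x‖²` by the kinetic terms plus `2H` minus
twice the potentials. The sources enter the rate with coefficients at least the minimum and the
potentials with coefficients at most the maximum; their weighted difference multiplies
`sourcePower`. -/
theorem le_virialRate (hp₁ : 2 < P.p₁) (hp₂ : 2 < P.p₂) (hd₁ : 0 < d₁) (hα : 2 < α) (hβ : 2 < β)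
    (hlow : ∀ a b, d₁ * F (a, b) ≤ a * φ₁ (a, b) + b * φ₂ (b, a)) (hpow₁ : ∀ a b, e₁ * (|a| ^ α + |b| ^ β) ≤ F (a, b))
    (hpow₂ : ∀ a b, F (a, b) ≤ e₂ * (|a| ^ α + |b| ^ β)) {H : ℝ} {x : (L2 × L2) × (L2 × L2)} (hx : stateEnergy P F x ≤ -H) :
    2 * (‖x.1.2‖ ^ 2 + ‖x.2.2‖ ^ 2) + 2 * H
      + (min (min P.K₁ P.K₂) (d₁ * e₁) - 2 * max (max (P.K₁ / P.p₁) (P.K₂ / P.p₂)) e₂) * sourcePower P.p₁ P.p₂ α β x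
      ≤ virialRate P φ₁ φ₂ x := by
  have hW := le_inner_add_inner hd₁ hα hβ hlow hpow₁ x
  have hB := potential_le hα hβ hpow₂ x
  have hI := integral_abs_rpow_add_nonneg x.1.1 x.2.1 α β
  unfold virialRate sourcePower
  unfold stateEnergy at hx
  rw [mul_assoc P.K₁, mul_assoc P.K₂, Psi_mul_self hp₁, Psi_mul_self hp₂]
  set I := ∫ y in Ioo (0 : ℝ) 1, (|prim x.1.1 y| ^ α + |prim x.2.1 (1 - y)| ^ β)
  set A := |prim x.1.1 1| ^ P.p₁
  set B := |prim x.2.1 1| ^ P.p₂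
  have hA0 : 0 ≤ A := by positivity
  have hB0 : 0 ≤ B := by positivity
  set M := max (max (P.K₁ / P.p₁) (P.K₂ / P.p₂)) e₂
  set m := min (min P.K₁ P.K₂) (d₁ * e₁)
  have a1 := mul_le_mul_of_nonneg_right ((le_max_left (P.K₁ / P.p₁) (P.K₂ / P.p₂)).trans (le_max_left _ e₂)) hA0
  have a2 := mul_le_mul_of_nonneg_right ((le_max_right (P.K₁ / P.p₁) (P.K₂ / P.p₂)).trans (le_max_left _ e₂)) hB0
  have a3 := mul_le_mul_of_nonneg_right (le_max_right (max (P.K₁ / P.p₁) (P.K₂ / P.p₂)) e₂) hI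
  have b1 := mul_le_mul_of_nonneg_right ((min_le_left (min P.K₁ P.K₂) (d₁ * e₁)).trans (min_le_left _ _)) hA0
  have b2 := mul_le_mul_of_nonneg_right ((min_le_left (min P.K₁ P.K₂) (d₁ * e₁)).trans (min_le_right _ _)) hB0
  have b3 := mul_le_mul_of_nonneg_right (min_le_right (min P.K₁ P.K₂) (d₁ * e₁)) hI
  change P.K₁ / P.p₁ * A ≤ M * A at a1
  change P.K₂ / P.p₂ * B ≤ M * B at a2
  change e₂ * I ≤ M * I at a3
  change m * A ≤ P.K₁ * A at b1
  change m * B ≤ P.K₂ * B at b2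
  change m * I ≤ d₁ * e₁ * I at b3
  linarith

/-- For `s = |z| / X^(1/q)` one has `s² ≤ 1 + s^α`, and `s^α ≤ |z|^α / X` because `X ≥ 1` and `α ≥
q`. It serves as Hölder's inequality with the same exponent `q` for all powers `α`, `β`, `p₁`, `p₂`.
-/
theorem sq_le_rpow_mul {X q α : ℝ} (hX : 1 ≤ X) (hq : 2 < q) (hqα : q ≤ α) (z : ℝ) :
    z ^ 2 ≤ X ^ (2 / q) * (1 + |z| ^ α / X) := by
  have hX0 : 0 < X := by linarith
  have hq0 : 0 < q := by linarith
  have hpos : 0 < X ^ (1 / q) := Real.rpow_pos_of_pos hX0 _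
  set s := |z| / X ^ (1 / q) with hs
  have hs0 : 0 ≤ s := by positivity
  have h1 : s ^ 2 ≤ 1 + s ^ α := by
    have hα0 : 0 ≤ s ^ α := Real.rpow_nonneg hs0 α
    rcases le_or_gt s 1 with h | h
    · nlinarith
    · have := Real.rpow_le_rpow_of_exponent_le h.le (by linarith : (2 : ℝ) ≤ α)
      rw [Real.rpow_two] at this
      linarith
  have h2 : s ^ α ≤ |z| ^ α / X := by
    rw [hs, Real.div_rpow (abs_nonneg _) hpos.le, ← Real.rpow_mul hX0.le]
    refine div_le_div_of_nonneg_left (by positivity) hX0 ?_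
    calc X = X ^ (1 : ℝ) := (Real.rpow_one X).symm
      _ ≤ X ^ (1 / q * α) := Real.rpow_le_rpow_of_exponent_le hX (by
        rw [one_div, inv_mul_eq_div, le_div_iff₀ hq0]; linarith)
  have h3 : X ^ (2 / q) = (X ^ (1 / q)) ^ 2 := by
    rw [← Real.rpow_natCast, ← Real.rpow_mul hX0.le]; congr 1; push_cast; ring
  have h4 : z ^ 2 = (X ^ (1 / q)) ^ 2 * s ^ 2 := by
    rw [hs, div_pow, sq_abs]; field_simp
  rw [h3, h4]
  exact mul_le_mul_of_nonneg_left (h1.trans (by linarith)) (by positivity)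

theorem integral_sq_le_rpow {f : ℝ → ℝ} (hf : ContinuousOn f (Icc 0 1)) {X q α : ℝ} (hX : 1 ≤ X) (hq : 2 < q) (hqα : q ≤ α)
    (h : ∫ y in Ioo (0 : ℝ) 1, |f y| ^ α ≤ X) : ∫ y in Ioo (0 : ℝ) 1, f y ^ 2 ≤ 2 * X ^ (2 / q) := by
  have hX0 : 0 < X := by linarith
  have hi := integrableOn_abs_rpow hf (α := α) (by linarith)
  have h1 : ∫ y in Ioo (0 : ℝ) 1, f y ^ 2 ≤ ∫ y in Ioo (0 : ℝ) 1, X ^ (2 / q) * (1 + |f y| ^ α / X) :=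
    setIntegral_mono_on (integrableOn_Ioo_of_continuousOn (hf.pow 2)) ((((integrable_const (1 : ℝ)).add (hi.div_const X))).const_mul _)
      measurableSet_Ioo fun y _ => sq_le_rpow_mul hX hq hqα (f y)
  rw [integral_const_mul, integral_add (integrable_const 1) (hi.div_const X), integral_div] at h1
  have h2 : ∫ _ in Ioo (0 : ℝ) 1, (1 : ℝ) = 1 := by simp
  rw [h2] at h1
  refine h1.trans ?_
  have h3 : (∫ y in Ioo (0 : ℝ) 1, |f y| ^ α) / X ≤ 1 := by rw [div_le_one hX0]; exact h
  have := mul_le_mul_of_nonneg_left h3 (Real.rpow_nonneg hX0.le (2 / q))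
  linarith

/-- Since `X` dominates every source power, `‖u‖²`, `‖v‖²` and the squared traces are at most `2
X^(2/q)`, and `2/q ≤ 1/2 + 1/q`. The products `⟨u, u_t⟩` and `⟨v, v_t⟩` are bounded by `√2 X^(1/q)
X^(1/2)`, rounded up to twice the power; this yields the 4. -/
theorem virial_le (hlam₁ : 0 < P.lam₁) (hlam₂ : 0 < P.lam₂) (hmu₁ : 0 < P.mu₁) (hmu₂ : 0 < P.mu₂) {q : ℝ} (hq : 2 < q)
    (hqp₁ : q ≤ P.p₁) (hqp₂ : q ≤ P.p₂) (hqα : q ≤ α) (hqβ : q ≤ β) {X : ℝ} {x : (L2 × L2) × (L2 × L2)}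
    (hX : X = ‖x.1.2‖ ^ 2 + ‖x.2.2‖ ^ 2 + sourcePower P.p₁ P.p₂ α β x + 1) :
    virial P x ≤ (4 + P.lam₁ + P.lam₂ + P.mu₁ + P.mu₂) * X ^ (1 / 2 + 1 / q) := by
  have hq0 : 0 < q := by linarith
  have hQ := sourcePower_nonneg P.p₁ P.p₂ α β x
  have hX1 : 1 ≤ X := by rw [hX]; linarith [sq_nonneg ‖x.1.2‖, sq_nonneg ‖x.2.2‖]
  have hX0 : 0 < X := by linarith
  have iα := integrableOn_abs_rpow (continuousOn_prim x.1.1) (α := α) (by linarith)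
  have iβ := integrableOn_abs_rpow (continuousOn_prim_one_sub x.2.1) (α := β) (by linarith)
  have hQe := hX
  unfold sourcePower at hQe
  rw [integral_add iα iβ] at hQe
  have nα : 0 ≤ ∫ y in Ioo (0 : ℝ) 1, |prim x.1.1 y| ^ α := setIntegral_nonneg measurableSet_Ioo fun _ _ => by positivity
  have nβ : 0 ≤ ∫ y in Ioo (0 : ℝ) 1, |prim x.2.1 (1 - y)| ^ β := setIntegral_nonneg measurableSet_Ioo fun _ _ => by positivity
  have nA : 0 ≤ |prim x.1.1 1| ^ P.p₁ := by positivity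
  have nB : 0 ≤ |prim x.2.1 1| ^ P.p₂ := by positivity
  have n1 := sq_nonneg ‖x.1.2‖
  have n2 := sq_nonneg ‖x.2.2‖
  have bu : ‖volterra x.1.1‖ ^ 2 ≤ 2 * X ^ (2 / q) := by
    rw [norm_sq_volterra]; exact integral_sq_le_rpow (continuousOn_prim _) hX1 hq hqα (by linarith)
  have bv : ‖volterra x.2.1‖ ^ 2 ≤ 2 * X ^ (2 / q) := by
    rw [norm_sq_volterra_one_sub]; exact integral_sq_le_rpow (continuousOn_prim_one_sub _) hX1 hq hqβ (by linarith)
  have bγ : ∀ {z p : ℝ}, q ≤ p → |z| ^ p ≤ X → z ^ 2 ≤ 2 * X ^ (2 / q) := fun {z p} hqp hz => by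
    have h1 := sq_le_rpow_mul hX1 hq hqp z
    have h2 : |z| ^ p / X ≤ 1 := by rw [div_le_one hX0]; exact hz
    have := mul_le_mul_of_nonneg_left h2 (Real.rpow_nonneg hX0.le (2 / q))
    linarith
  have b1 : prim x.1.1 1 ^ 2 ≤ 2 * X ^ (2 / q) := bγ hqp₁ (by linarith)
  have b2 : prim x.2.1 1 ^ 2 ≤ 2 * X ^ (2 / q) := bγ hqp₂ (by linarith)
  set Z := X ^ (1 / 2 + 1 / q) with hZ
  have hZ0 : 0 < Z := Real.rpow_pos_of_pos hX0 _
  have hqZ : X ^ (2 / q) ≤ Z := Real.rpow_le_rpow_of_exponent_le hX1 (by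
    have : 1 / q ≤ 1 / 2 := one_div_le_one_div_of_le (by norm_num) hq.le
    have e : 2 / q = 1 / q + 1 / q := by ring
    linarith)
  have hZ2 : Z ^ 2 = X ^ (2 / q) * X := by
    rw [hZ, ← Real.rpow_natCast, ← Real.rpow_mul hX0.le, ← Real.rpow_add_one hX0.ne']; congr 1; push_cast; ring
  have inn : ∀ {w k : L2}, ‖w‖ ^ 2 ≤ 2 * X ^ (2 / q) → ‖k‖ ^ 2 ≤ X → inner ℝ w k ≤ 2 * Z := fun {w k} hw hk => by
    refine (real_inner_le_norm w k).trans ?_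
    refine (abs_le_of_sq_le_sq' ?_ (by positivity)).2
    rw [mul_pow, mul_pow, hZ2]
    have := mul_le_mul hw hk (sq_nonneg _) (by positivity)
    have h0 : 0 ≤ X ^ (2 / q) * X := by positivity
    linarith
  have i1 := inn bu (show ‖x.1.2‖ ^ 2 ≤ X by linarith)
  have i2 := inn bv (show ‖x.2.2‖ ^ 2 ≤ X by linarith)
  have c1 := mul_le_mul_of_nonneg_left (bu.trans (mul_le_mul_of_nonneg_left hqZ two_pos.le)) hlam₁.le
  have c2 := mul_le_mul_of_nonneg_left (bv.trans (mul_le_mul_of_nonneg_left hqZ two_pos.le)) hlam₂.le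
  have c3 := mul_le_mul_of_nonneg_left (b1.trans (mul_le_mul_of_nonneg_left hqZ two_pos.le)) hmu₁.le
  have c4 := mul_le_mul_of_nonneg_left (b2.trans (mul_le_mul_of_nonneg_left hqZ two_pos.le)) hmu₂.le
  unfold virial
  linarith

end

end WaveSystem

/-! ### The time bound and the conclusion -/

namespace WaveSystem

theorem stateEnergy_state {P : Params} {F : ℝ → ℝ → ℝ} {G : C(ℝ × ℝ, ℝ)} (hG : ∀ a b, G (a, b) = F a b) {u v : H1}
    (hu : u ∈ V 0) (hv : v ∈ V 1) (u' v' : L2) : stateEnergy P G (state u v u' v') = energy P F u v u' v' := by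
  have hvr : v.reflect ∈ V 0 := by
    have := H1.reflect_mem_V ⟨zero_le_one, le_rfl⟩ hv
    rwa [sub_self] at this
  have ru : ∀ {y : ℝ}, y ∈ Icc (0 : ℝ) 1 → prim u.dx y = u.rep y := fun hy => (H1.rep_of_mem_V hu hy).symm
  have rv : ∀ {y : ℝ}, y ∈ Icc (0 : ℝ) 1 → prim v.reflect.dx (1 - y) = v.rep y := fun {y} hy => by
    rw [← H1.rep_of_mem_V hvr (one_sub_mem_Icc hy), H1.reflect_rep _ (one_sub_mem_Icc hy), sub_sub_cancel]
  have rv0 : prim v.reflect.dx 1 = v.rep 0 := by simpa using rv (y := 0) ⟨le_rfl, zero_le_one⟩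
  have hpot : potential G (state u v u' v') = ∫ x in Ioo (0 : ℝ) 1, F (u.rep x) (v.rep x) :=
    setIntegral_congr_fun measurableSet_Ioo fun y hy => by
      have hy' := Ioo_subset_Icc_self hy
      simp only [state]
      rw [hG, ru hy', rv hy']
  rw [stateEnergy, hpot, energy]
  simp only [state]
  rw [ru ⟨zero_le_one, le_rfl⟩, rv0, H1.reflect_dx, norm_neg, LinearIsometry.norm_map, LinearIsometry.norm_map]
  ring

/-- Solutions of the coupled system with negative initial energy have a bounded time of existence. -/
theorem exists_time_bound {P : Params} (hlam₁ : 0 < P.lam₁) (hlam₂ : 0 < P.lam₂) (hmu₁ : 0 < P.mu₁) (hmu₂ : 0 < P.mu₂)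
    (hp₁ : 2 < P.p₁) (hp₂ : 2 < P.p₂) {F φ₁ φ₂ : C(ℝ × ℝ, ℝ)} (hF : IsPotential F φ₁ φ₂) {α β d₁ e₁ e₂ : ℝ}
    (hd₁ : 0 < d₁) (hα : 2 < α) (hβ : 2 < β) (hlow : ∀ a b, d₁ * F (a, b) ≤ a * φ₁ (a, b) + b * φ₂ (b, a))
    (hpow₁ : ∀ a b, e₁ * (|a| ^ α + |b| ^ β) ≤ F (a, b)) (hpow₂ : ∀ a b, F (a, b) ≤ e₂ * (|a| ^ α + |b| ^ β))
    (hD : 2 * max (max (P.K₁ / P.p₁) (P.K₂ / P.p₂)) e₂ < min (min P.K₁ P.K₂) (d₁ * e₁))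
    {x₀ : (L2 × L2) × (L2 × L2)} (hx₀ : 0 < -stateEnergy P F x₀) :
    ∃ Tstar : ℝ, 0 < Tstar ∧ ∀ (τ : ℝ) (x : ℝ → (L2 × L2) × (L2 × L2)) (b₁ b₂ : ℝ → ℝ),
      IsCoupled P φ₁ φ₂ τ x b₁ b₂ → x 0 = x₀ → τ ≤ Tstar := by
  set q := min (min P.p₁ P.p₂) (min α β) with hq
  have hq2 : 2 < q := lt_min (lt_min hp₁ hp₂) (lt_min hα hβ)
  have hq0 : 0 < q := by linarith
  -- The exponent of `virial_le`. It is below 1 exactly because `q > 2`, so its inverse `r` is a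
  -- superlinear power.
  set θ := 1 / 2 + 1 / q with hθ
  have hθ0 : 0 < θ := by positivity
  have hθ1 : θ < 1 := by
    have : 1 / q < 1 / 2 := one_div_lt_one_div_of_lt two_pos hq2
    linarith
  set r := θ⁻¹ with hr
  have hr1 : 1 < r := (one_lt_inv₀ hθ0).2 hθ1
  set H := -stateEnergy P F x₀ with hH
  set κ := min (min P.K₁ P.K₂) (d₁ * e₁) - 2 * max (max (P.K₁ / P.p₁) (P.K₂ / P.p₂)) e₂ with hκ
  have hκ0 : 0 < κ := sub_pos.2 hD
  -- The three coefficients in `le_virialRate`: of the kinetic terms, of the summand 1 in `X`, and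
  -- of `sourcePower`.
  set c := min 2 (min (2 * H) κ) with hc
  have hc0 : 0 < c := lt_min two_pos (lt_min (by linarith) hκ0)
  set A := 4 + P.lam₁ + P.lam₂ + P.mu₁ + P.mu₂ with hA
  have hA0 : 0 < A := by linarith
  set C := A ^ r with hC
  have hC0 : 0 < C := Real.rpow_pos_of_pos hA0 r
  refine ⟨max 0 ((1 - virial P x₀) / c) + C / ((r - 1) * c),
    add_pos_of_nonneg_of_pos (le_max_left _ _) (div_pos hC0 (mul_pos (by linarith) hc0)), fun τ x b₁ b₂ S hx => ?_⟩
  rw [← hx]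
  have hX1 : ∀ t, 1 ≤ ‖(x t).1.2‖ ^ 2 + ‖(x t).2.2‖ ^ 2 + sourcePower P.p₁ P.p₂ α β (x t) + 1 := fun t => by
    linarith [sourcePower_nonneg P.p₁ P.p₂ α β (x t), sq_nonneg ‖(x t).1.2‖, sq_nonneg ‖(x t).2.2‖]
  refine le_of_superlinear_growth (Y := fun t => virial P (x t)) (D := fun t => virialRate P φ₁ φ₂ (x t))
    (X := fun t => ‖(x t).1.2‖ ^ 2 + ‖(x t).2.2‖ ^ 2 + sourcePower P.p₁ P.p₂ α β (x t) + 1)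
    ((continuous_virial P).comp_continuousOn S.continuousOn)
    (fun t ht => S.hasDerivWithinAt_virial hp₁ hp₂ hF.lipschitz_fst hF.lipschitz_snd ht) hc0 hC0 hr1
    (fun t _ => hX1 t) (fun t ht => ?_) (fun t _ hY => ?_)
  · have hE : stateEnergy P F (x t) ≤ -H := by
      have := S.stateEnergy_le hF hlam₁.le hlam₂.le hmu₁.le hmu₂.le hp₁ hp₂ ht
      rw [hx] at this
      rwa [hH, neg_neg]
    refine le_trans ?_ (le_virialRate hp₁ hp₂ hd₁ hα hβ hlow hpow₁ hpow₂ hE)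
    rw [← hκ]
    have m1 := mul_le_mul_of_nonneg_right (min_le_left 2 (min (2 * H) κ))
      (add_nonneg (sq_nonneg ‖(x t).1.2‖) (sq_nonneg ‖(x t).2.2‖))
    have m2 : c ≤ 2 * H := (min_le_right _ _).trans (min_le_left _ _)
    have m3 := mul_le_mul_of_nonneg_right ((min_le_right 2 (min (2 * H) κ)).trans (min_le_right _ _))
      (sourcePower_nonneg P.p₁ P.p₂ α β (x t))
    rw [← hc] at m1 m3
    linarith
  · have hle := virial_le (α := α) (β := β) (x := x t) hlam₁ hlam₂ hmu₁ hmu₂ hq2 ((min_le_left _ _).trans (min_le_left _ _))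
      ((min_le_left _ _).trans (min_le_right _ _)) ((min_le_right _ _).trans (min_le_left _ _))
      ((min_le_right _ _).trans (min_le_right _ _)) rfl
    have hX0 := zero_le_one.trans (hX1 t)
    refine (Real.rpow_le_rpow (zero_le_one.trans hY) hle (by linarith : 0 ≤ r)).trans_eq ?_
    rw [Real.mul_rpow hA0.le (Real.rpow_nonneg hX0 _), ← Real.rpow_mul hX0, ← hθ, hr, mul_inv_cancel₀ hθ0.ne', Real.rpow_one]

section

variable {f₁ f₂ F : ℝ → ℝ → ℝ} {α β d₁ d₂ e₁ e₂ : ℝ}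

/-- The interior sources as continuous maps, the second one with its arguments swapped. -/
theorem SourceCondition.exists_isPotential (hF : SourceCondition f₁ f₂ F α β d₁ d₂ e₁ e₂) :
    ∃ G φ₁ φ₂ : C(ℝ × ℝ, ℝ), IsPotential G φ₁ φ₂ ∧ (∀ a b, G (a, b) = F a b) ∧ (∀ a b, φ₁ (a, b) = f₁ a b) ∧
      ∀ a b, φ₂ (b, a) = f₂ a b := by
  have h₂ : ContDiff ℝ 1 fun z : ℝ × ℝ => f₂ z.2 z.1 := hF.contDiff_snd.comp (_root_.contDiff_snd.prodMk _root_.contDiff_fst)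
  exact ⟨⟨fun z => F z.1 z.2, hF.contDiff.continuous⟩, ⟨fun z => f₁ z.1 z.2, hF.contDiff_fst.continuous⟩,
    ⟨fun z => f₂ z.2 z.1, h₂.continuous⟩,
    ⟨hF.hasFDerivAt, exists_lipschitzOnWith_closedBall (hF.contDiff.of_le (by norm_num)),
      exists_lipschitzOnWith_closedBall hF.contDiff_fst, exists_lipschitzOnWith_closedBall h₂⟩,
    fun _ _ => rfl, fun _ _ => rfl, fun _ _ => rfl⟩

end

end WaveSystem

theorem theorem13 (P : WaveSystem.Params)
    (hlam₁ : 0 < P.lam₁) (hlam₂ : 0 < P.lam₂) (hmu₁ : 0 < P.mu₁) (hmu₂ : 0 < P.mu₂)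
    (hK₁ : 0 < P.K₁) (hK₂ : 0 < P.K₂) (hp₁ : 2 < P.p₁) (hp₂ : 2 < P.p₂)
    (f₁ f₂ F : ℝ → ℝ → ℝ) (α β d₁ d₂ e₁ e₂ : ℝ)
    (hF : WaveSystem.SourceCondition f₁ f₂ F α β d₁ d₂ e₁ e₂)
    (hD : 2 * max (max (P.K₁ / P.p₁) (P.K₂ / P.p₂)) e₂ < min (min P.K₁ P.K₂) (d₁ * e₁))
    (u₀ v₀ : WaveSystem.H1) (u₁ v₁ : WaveSystem.L2)
    (hu₀ : u₀ ∈ WaveSystem.V 0) (hv₀ : v₀ ∈ WaveSystem.V 1)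
    (hH : 0 < -WaveSystem.energy P F u₀ v₀ u₁ v₁) :
    ∃ Tstar : ℝ, 0 < Tstar ∧
      ∀ (T : EReal) (u v : ℝ → WaveSystem.H1) (u' v' : ℝ → WaveSystem.L2), 0 < T →
        WaveSystem.IsWeakSolution P f₁ f₂ u₀ v₀ u₁ v₁ T u v u' v' →
        ∃ Tfin : ℝ, T = (Tfin : EReal) ∧ Tfin ≤ Tstar ∧
          (WaveSystem.IsMaximalWeakSolution P f₁ f₂ u₀ v₀ u₁ v₁ T u v u' v' →
            Tendsto (fun t => ‖u t‖ + ‖v t‖ + ‖u' t‖ + ‖v' t‖) (𝓝[<] Tfin) atTop) := by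
  obtain ⟨G, φ₁, φ₂, hG, hGF, h₁, h₂⟩ := hF.exists_isPotential
  obtain ⟨Tstar, hpos, hbound⟩ := WaveSystem.exists_time_bound hlam₁ hlam₂ hmu₁ hmu₂ hp₁ hp₂ hG hF.d₁_pos hF.two_lt_α
    hF.two_lt_β (fun a b => by rw [hGF, h₁, h₂]; exact hF.lower a b) (fun a b => by rw [hGF]; exact hF.lower_pow a b)
    (fun a b => by rw [hGF]; exact hF.upper_pow a b) hD (x₀ := WaveSystem.state u₀ v₀ u₁ v₁)
    (by rwa [WaveSystem.stateEnergy_state hGF hu₀ hv₀])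
  refine ⟨Tstar, hpos, fun T u v u' v' hT h => ?_⟩
  obtain ⟨b₁, b₂, S⟩ := h.isCoupled hp₁ hp₂ hG.lipschitz_fst hG.lipschitz_snd h₁ h₂
  have hle : ∀ τ : ℝ, 0 < τ → (τ : EReal) < T → τ ≤ Tstar := fun τ h0 hτ =>
    hbound τ _ b₁ b₂ (S τ h0 hτ) (by rw [h.init_u, h.init_v, h.init_u', h.init_v'])
  -- The bound is available for real times `τ < T` only; a `T` beyond `Tstar`, in particular `T =
  -- ∞`, would leave room for such a `τ > Tstar`.
  have hTle : T ≤ Tstar := by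
    by_contra hlt
    obtain ⟨τ, hτ, hτT⟩ := EReal.lt_iff_exists_real_btwn.1 (not_le.1 hlt)
    have hτ' := EReal.coe_lt_coe_iff.1 hτ
    exact (hle τ (hpos.trans hτ') hτT).not_gt hτ'
  have hreal : ((T.toReal : ℝ) : EReal) = T :=
    EReal.coe_toReal (hTle.trans_lt (EReal.coe_lt_top _)).ne (EReal.bot_lt_zero.trans hT).ne'
  refine ⟨T.toReal, hreal.symm, EReal.coe_le_coe_iff.1 (hreal.trans_le hTle), fun hmax => ?_⟩
  rw [← hreal] at hmax hT
  exact hmax.tendsto_norm (EReal.coe_pos.1 hT) hmu₁ hmu₂ hp₁ hp₂ hG.lipschitz_fst hG.lipschitz_snd h₁ h₂
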